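/- Let $\mathbf k$ be a commutative ring and let $A$ be a $\mathbb Z$-graded (for instance non-negatively graded), graded commutative, unital differential graded $\mathbf k$-algebra with differential $d$ of degree $+1$ and with an augmentation $\varepsilon:A\to\mathbf k$ (a morphism of differential graded algebras); write $\bar A=\ker\varepsilon$, so $A=\mathbf k\oplus\bar A$, and write also $a$ for the image of $a\in A$ in $\bar A$. Suppose that $A$ is a symmetric open Frobenius algebra of degree $m\in\mathbb Z$, i.e. it carries a $\mathbf k$-linear coproduct $\delta:A\to A\otimes A$, $\delta x=\sum x'\otimes x''$, of degree $m$ such that, with the Koszul sign rule, $(\delta\otimes1)\delta=(-1)^m(1\otimes\delta)\delta$, $\delta d=(-1)^m(d\otimes1+1\otimes d)\delta$, $\delta(xy)=\sum(-1)^{m|x|}xy'\otimes y''=\sum x'\otimes x''y$, and $\sum1'\otimes1''=\sum(-1)^{|1'||1''|+m}1''\otimes1'$. Let $C_*(A,A)=A\otimes T(s\bar A)$ be the normalized Hochschild chains, with $|a_0[a_1,\dots,a_n]|=\sum_{i\ge0}|a_i|-n$. With $\epsilon_i=\sum_{j<i}|a_j|-i+1$ for $i\ge1$, the Hochschild differential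 $D$, of degree $+1$, is $$\begin{aligned}D(a_0[a_1,\dots,a_n])={}&da_0[a_1,\dots,a_n]-\sum_{i=1}^n(-1)^{\epsilon_i}a_0[\dots,da_i,\dots]+(-1)^{|a_0|}a_0a_1[a_2,\dots,a_n]\\&+\sum_{i=2}^n(-1)^{\epsilon_i}a_0[\dots,a_{i-1}a_i,\dots]-(-1)^{\epsilon_n(|a_n|+1)}a_na_0[a_1,\dots,a_{n-1}]\end{aligned}$$ (the external terms being absent for $n=0$), and the Connes operator $B$, of degree $-1$, is $$B(a_0[a_1,\dots,a_n])=\sum_{i=1}^{n+1}(-1)^{(|a_0|+\dots+|a_{i-1}|-i)(|a_i|+\dots+|a_n|-n+i-1)}\,1[a_i,\dots,a_n,a_0,\dots,a_{i-1}].$$ Let $\widetilde C_*(A,A)=\bigoplus_{n\ge1}A\otimes\bar A^{\otimes n}$ be the relative chains. Then: 1. $D^2=0$, $B^2=0$, $DB+BD=0$ on $C_*(A,A)$, and $D$ and $B$ preserve $\widetilde C_*(A,A)$; let $\widetilde{HH}_*(A,A)$ be the homology of $(\widetilde C_*(A,A),D)$. 2. For $x=a_0[a_1,\dots,a_p]$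 and $y=b_0[b_1,\dots,b_q]$ the following three expressions agree and define a bilinear product $\ast$, which on $\widetilde C_*(A,A)$ has degree $m-1$: $$\begin{aligned}x\ast y&=\sum_{(a_0b_0)}(-1)^{|(a_0b_0)'|+(|(a_0b_0)''|+|b_0|+1)(|a_1|+\dots+|a_p|+p)}(a_0b_0)'[a_1,\dots,a_p,(a_0b_0)'',b_1,\dots,b_q]\\&=\sum_{(a_0)}(-1)^{|a_0'|+(|a_0''|+1)(|a_1|+\dots+|a_p|+p)}a_0'[a_1,\dots,a_p,a_0''b_0,b_1,\dots,b_q]\\&=\sum_{(b_0)}(-1)^{(m+1)|a_0|+|b_0'|+(|b_0''|+|b_0|+1)(|a_1|+\dots+|a_p|+p)}a_0b_0'[a_1,\dots,a_p,b_0'',b_1,\dots,b_q].\end{aligned}$$ 3. On $\widetilde C_*(A,A)$ the product is a chain map, $D(x\ast y)=(-1)^{m-1}(Dx\ast y+(-1)^{|x|}x\ast Dy)$, and it is strictly associative of degree $m-1$: $(x\ast y)\ast z=(-1)^{(m-1)|x|+(m-1)}x\ast(y\ast z)$. Equivalently, the product $x\cdot y=(-1)^{(m-1)|x|}x\ast y$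 on the shifted complex $\widetilde C_*(A,A)[m-1]$, where $C[r]_k=C_{k-r}$, has degree $0$ and is strictly associative. 4. The product is commutative up to the homotopy $T$ of degree $m-2$, $$T(x,y)=\sum_{i=0}^q\sum_{(a_0)}(-1)^{\mu_i}b_0[b_1,\dots,b_i,a_0',a_1,\dots,a_p,a_0'',b_{i+1},\dots,b_q],$$ $$\mu_i=(|b_0|+\dots+|b_i|+i)(m+|a_0|+\dots+|a_p|+p)+|a_0'|+(|a_0''|+1)(|a_1|+\dots+|a_p|+p);$$ that is, on $\widetilde C_*(A,A)$, $DT(x,y)-(-1)^{m-2}\big(T(Dx,y)+(-1)^{|x|}T(x,Dy)\big)=x\ast y-(-1)^{|x||y|+m-1}y\ast x$. 5. On $\widetilde C_*(A,A)[m-1]$, with the product $\cdot$, the operator $\Delta=B$ and $|\cdot|$ now the shifted degrees, the 7-term relation $$\Delta(xyz)=\Delta(xy)z+(-1)^{|x|}x\Delta(yz)+(-1)^{(|x|-1)|y|}y\Delta(xz)-\Delta(x)yz-(-1)^{|x|}x\Delta(y)z-(-1)^{|x|+|y|}xy\Delta(z)$$ holds up to homotopy: there is a trilinear map $K$ of degree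 $-2$ such that the left side minus the right side equals $DK(x,y,z)-K(Dx,y,z)-(-1)^{|x|}K(x,Dy,z)-(-1)^{|x|+|y|}K(x,y,Dz)$. 6. Consequently $\cdot$ and $B$ induce operations on $\widetilde{HH}_*(A,A)[m-1]$ that make it a (not necessarily unital) BV-algebra with BV-operator $\Delta=B$, which has degree $-1$ in this grading: the product is associative and graded commutative, $\Delta^2=0$, and $[x,y]=(-1)^{|x|}\Delta(xy)-(-1)^{|x|}\Delta(x)y-x\Delta(y)$ is a Gerstenhaber bracket, i.e. $[x,yz]=[x,y]z+(-1)^{(|x|-1)|y|}y[x,z]$, $[x,y]=-(-1)^{(|x|-1)(|y|-1)}[y,x]$ and $[[x,y],z]=[x,[y,z]]-(-1)^{(|x|-1)(|y|-1)}[y,[x,z]]$. -/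

import Mathlib

open scoped TensorProduct

noncomputable section

namespace OpenFrobenius

/-! ### Graded modules

A `ℤ`-grading on a `k`-module `M` is recorded by the linear map `ρ : M → (ℤ →₀ M)` that sends an
element to its family of homogeneous components. -/

section Grading

variable {k : Type*} [CommRing k] {M N : Type*} [AddCommGroup M] [Module k M]
  [AddCommGroup N] [Module k N]

variable (k) in
/-- The sign `(-1)^n`, as an element of `k`. -/
def sgn (n : ℤ) : k := ((n.negOnePow : ℤˣ) : ℤ)

/-- The elements that are homogeneous of degree `i`. -/
def homogeneousPart (ρ : M →ₗ[k] (ℤ →₀ M)) (i : ℤ) : Submodule k M :=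
  LinearMap.eqLocus ρ (Finsupp.lsingle i)

/-- `x ↦ (-1)^{f |x|} x` for homogeneous `x`. -/
def signBy (ρ : M →ₗ[k] (ℤ →₀ M)) (f : ℤ → ℤ) : M →ₗ[k] M :=
  Finsupp.lsum k (fun i => sgn k (f i) • (LinearMap.id : M →ₗ[k] M)) ∘ₗ ρ

/-- The family of the tensors `xᵢ ⊗ yⱼ`, where `xᵢ` and `yⱼ` are the homogeneous components. -/
def bicomponents (ρ : M →ₗ[k] (ℤ →₀ M)) (σ : N →ₗ[k] (ℤ →₀ N)) :
    M ⊗[k] N →ₗ[k] (ℤ × ℤ →₀ M ⊗[k] N) :=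
  (finsuppTensorFinsupp k k M N ℤ ℤ).toLinearMap ∘ₗ TensorProduct.map ρ σ

/-- `x ⊗ y ↦ (-1)^{f |x| |y|} x ⊗ y` for homogeneous `x`, `y`. -/
def tensorSign (ρ : M →ₗ[k] (ℤ →₀ M)) (σ : N →ₗ[k] (ℤ →₀ N)) (f : ℤ → ℤ → ℤ) :
    M ⊗[k] N →ₗ[k] M ⊗[k] N :=
  Finsupp.lsum k (fun p : ℤ × ℤ =>
    sgn k (f p.1 p.2) • (LinearMap.id : M ⊗[k] N →ₗ[k] M ⊗[k] N)) ∘ₗ bicomponents ρ σ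

/-- The total grading `|x ⊗ y| = |x| + |y|` on a tensor product. -/
def tensorComponents (ρ : M →ₗ[k] (ℤ →₀ M)) (σ : N →ₗ[k] (ℤ →₀ N)) :
    M ⊗[k] N →ₗ[k] (ℤ →₀ M ⊗[k] N) :=
  Finsupp.lsum k (fun p : ℤ × ℤ => Finsupp.lsingle (p.1 + p.2)) ∘ₗ bicomponents ρ σ

/-- The Koszul flip `x ⊗ y ↦ (-1)^{|x||y|} y ⊗ x`. -/
def koszulFlip (ρ : M →ₗ[k] (ℤ →₀ M)) (σ : N →ₗ[k] (ℤ →₀ N)) : M ⊗[k] N →ₗ[k] N ⊗[k] M :=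
  (TensorProduct.comm k M N).toLinearMap ∘ₗ tensorSign ρ σ (fun i j => i * j)

theorem mem_homogeneousPart {ρ : M →ₗ[k] (ℤ →₀ M)} {i : ℤ} {x : M} :
    x ∈ homogeneousPart ρ i ↔ ρ x = Finsupp.single i x := Iff.rfl

theorem signBy_apply {ρ : M →ₗ[k] (ℤ →₀ M)} {i : ℤ} {x : M} (hx : x ∈ homogeneousPart ρ i)
    (f : ℤ → ℤ) : signBy ρ f x = sgn k (f i) • x := by
  simp [signBy, mem_homogeneousPart.1 hx]

theorem bicomponents_apply {ρ : M →ₗ[k] (ℤ →₀ M)} {σ : N →ₗ[k] (ℤ →₀ N)} {i j : ℤ} {x : M} {y : N}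
    (hx : x ∈ homogeneousPart ρ i) (hy : y ∈ homogeneousPart σ j) :
    bicomponents ρ σ (x ⊗ₜ y) = Finsupp.single (i, j) (x ⊗ₜ y) := by
  simp [bicomponents, mem_homogeneousPart.1 hx, mem_homogeneousPart.1 hy]

theorem tensorSign_apply {ρ : M →ₗ[k] (ℤ →₀ M)} {σ : N →ₗ[k] (ℤ →₀ N)} {i j : ℤ} {x : M} {y : N}
    (hx : x ∈ homogeneousPart ρ i) (hy : y ∈ homogeneousPart σ j) (f : ℤ → ℤ → ℤ) :
    tensorSign ρ σ f (x ⊗ₜ y) = sgn k (f i j) • (x ⊗ₜ[k] y) := by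
  simp [tensorSign, bicomponents_apply hx hy]

theorem tmul_mem_homogeneousPart {ρ : M →ₗ[k] (ℤ →₀ M)} {σ : N →ₗ[k] (ℤ →₀ N)} {i j : ℤ}
    {x : M} {y : N} (hx : x ∈ homogeneousPart ρ i) (hy : y ∈ homogeneousPart σ j) :
    x ⊗ₜ[k] y ∈ homogeneousPart (tensorComponents ρ σ) (i + j) := by
  simp [mem_homogeneousPart, tensorComponents, bicomponents_apply hx hy]

end Grading

section Algebra

variable {k A : Type*} [CommRing k] [Ring A] [Algebra k A] (𝒜 : ℤ → Submodule k A)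
  [GradedAlgebra 𝒜]

/-- The homogeneous components in a graded algebra. -/
def components : A →ₗ[k] (ℤ →₀ A) :=
  DirectSum.toModule k ℤ (ℤ →₀ A) (fun i => Finsupp.lsingle i ∘ₗ (𝒜 i).subtype) ∘ₗ
    (DirectSum.decomposeLinearEquiv 𝒜).toLinearMap

theorem mem_homogeneousPart_components {i : ℤ} {a : A} (ha : a ∈ 𝒜 i) :
    a ∈ homogeneousPart (components 𝒜) i := by
  rw [mem_homogeneousPart]
  lift a to 𝒜 i using ha
  simp [components]

/-- `(A, d, ε)` is a graded commutative differential graded `k`-algebra with differential of degree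
`+1`, augmented by `ε : A → k`. -/
structure IsAugmentedCDGA (d : A →ₗ[k] A) (ε : A →ₐ[k] k) : Prop where
  d_mem : ∀ (i : ℤ) (a : A), a ∈ 𝒜 i → d a ∈ 𝒜 (i + 1)
  d_d : ∀ a : A, d (d a) = 0
  d_mul : ∀ (i : ℤ) (a b : A), a ∈ 𝒜 i → d (a * b) = d a * b + sgn k i • (a * d b)
  mul_comm : ∀ (i j : ℤ) (a b : A), a ∈ 𝒜 i → b ∈ 𝒜 j → a * b = sgn k (i * j) • (b * a)
  aug_d : ∀ a : A, ε (d a) = 0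
  aug_eq_zero : ∀ (i : ℤ) (a : A), a ∈ 𝒜 i → i ≠ 0 → ε a = 0

/-- `δ` is a coproduct of degree `m` that makes the differential graded algebra `(A, d)` a symmetric
open Frobenius algebra of degree `m`. With the Koszul rule for maps,
`(1 ⊗ δ)(x ⊗ y) = (-1)^{m|x|} x ⊗ δ y` and `(1 ⊗ d)(x ⊗ y) = (-1)^{|x|} x ⊗ d y`. -/
structure IsSymmetricOpenFrobenius (d : A →ₗ[k] A) (m : ℤ) (δ : A →ₗ[k] A ⊗[k] A) : Prop where
  /-- `δ` has degree `m` -/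
  coprod_mem : ∀ (i : ℤ) (a : A), a ∈ 𝒜 i →
    δ a ∈ homogeneousPart (tensorComponents (components 𝒜) (components 𝒜)) (i + m)
  /-- `(δ ⊗ 1) δ = (-1)^m (1 ⊗ δ) δ` -/
  coassoc : ∀ a : A,
    TensorProduct.assoc k A A A (LinearMap.rTensor A δ (δ a)) =
      sgn k m • TensorProduct.map (signBy (components 𝒜) (fun i => m * i)) δ (δ a)
  /-- `δ d = (-1)^m (d ⊗ 1 + 1 ⊗ d) δ` -/
  coprod_d : ∀ a : A,
    δ (d a) = sgn k m • (LinearMap.rTensor A d (δ a) +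
      TensorProduct.map (signBy (components 𝒜) (fun i => i)) d (δ a))
  /-- `δ (x y) = (-1)^{m|x|} x y' ⊗ y''` -/
  coprod_mul_left : ∀ (i : ℤ) (x y : A), x ∈ 𝒜 i →
    δ (x * y) = sgn k (m * i) • LinearMap.rTensor A (LinearMap.mulLeft k x) (δ y)
  /-- `δ (x y) = x' ⊗ x'' y` -/
  coprod_mul_right : ∀ x y : A,
    δ (x * y) = LinearMap.lTensor A (LinearMap.mulRight k y) (δ x)
  /-- `1' ⊗ 1'' = (-1)^{|1'||1''| + m} 1'' ⊗ 1'` -/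
  symm : δ 1 = sgn k m • koszulFlip (components 𝒜) (components 𝒜) (δ 1)

/-! ### Hochschild chains -/

variable (ε : A →ₐ[k] k)

/-- The augmentation ideal `Ā`, the kernel of the augmentation. -/
abbrev Bar : Submodule k A := LinearMap.ker ε.toLinearMap

/-- The projection `A = k ⊕ Ā → Ā`. -/
def barProj : A →ₗ[k] Bar ε :=
  (LinearMap.id - Algebra.linearMap k A ∘ₗ ε.toLinearMap).codRestrict (Bar ε)
    (fun a => by simp)

/-- The module `T(sĀ)`. The word `[a₁, …, aₙ]` is the product `ι a₁ * ⋯ * ι aₙ`. -/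
abbrev Words : Type _ := TensorAlgebra k (Bar ε)

/-- The word `[a₁, …, aₙ]`. -/
def word (L : List (Bar ε)) : Words ε := (L.map (TensorAlgebra.ι k)).prod

/-- The one-letter word `[a]` for `a : A`, the letter being the image of `a` in `Ā`. -/
def letter : A →ₗ[k] Words ε := TensorAlgebra.ι k ∘ₗ barProj ε

/-- The linear map with `[a] ↦ a` that vanishes on words of length `≠ 1`. -/
def unletter : Words ε →ₗ[k] A := (Bar ε).subtype ∘ₗ TensorAlgebra.ιInv

/-- The grading of `T(sĀ)`, as a coaction `u ↦ ∑ⱼ uⱼ tʲ`: the letter `[a]` has degree `|a| - 1`. -/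
def wordCoaction : Words ε →ₐ[k] AddMonoidAlgebra (Words ε) ℤ :=
  TensorAlgebra.lift k
    ((AddMonoidAlgebra.coeffLinearEquiv k).symm.toLinearMap ∘ₗ
      Finsupp.lsum k (fun i : ℤ => Finsupp.lsingle (i - 1) ∘ₗ letter ε) ∘ₗ
      components 𝒜 ∘ₗ (Bar ε).subtype)

/-- The homogeneous components of a word; the degree of `[a₁, …, aₙ]` is `∑ (|aᵢ| - 1)`. -/
def wordComponents : Words ε →ₗ[k] (ℤ →₀ Words ε) :=
  (AddMonoidAlgebra.coeffLinearEquiv k).toLinearMap ∘ₗ (wordCoaction 𝒜 ε).toLinearMap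

/-- The action of a letter `a` on pairs: `(u, y) ↦ ([a] u, 1 ⊗ [a] u + ([a] ⊗ 1) y)`. -/
def cutStep : Bar ε →ₗ[k] Module.End k (Words ε × (Words ε ⊗[k] Words ε)) where
  toFun v :=
    (LinearMap.mul k (Words ε) (TensorAlgebra.ι k v) ∘ₗ LinearMap.fst k _ _).prod
      (TensorProduct.mk k (Words ε) (Words ε) 1 ∘ₗ
          LinearMap.mul k (Words ε) (TensorAlgebra.ι k v) ∘ₗ LinearMap.fst k _ _ +
        LinearMap.rTensor (Words ε) (LinearMap.mul k (Words ε) (TensorAlgebra.ι k v)) ∘ₗ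
          LinearMap.snd k _ _)
  map_add' v w := by
    refine LinearMap.ext fun p => Prod.ext ?_ ?_
    · simp
    · simp [LinearMap.rTensor_add, TensorProduct.tmul_add]
      abel
  map_smul' c v := by
    refine LinearMap.ext fun p => Prod.ext ?_ ?_
    · simp
    · simp [LinearMap.rTensor_smul]

/-- Deconcatenation `[a₁, …, aₙ] ↦ ∑_{0 ≤ i ≤ n} [a₁, …, aᵢ] ⊗ [aᵢ₊₁, …, aₙ]`. -/
def deconc : Words ε →ₗ[k] Words ε ⊗[k] Words ε :=
  LinearMap.snd k _ _ ∘ₗ LinearMap.applyₗ ((1, 1 ⊗ₜ 1) : Words ε × (Words ε ⊗[k] Words ε)) ∘ₗ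
    (TensorAlgebra.lift k (cutStep ε)).toLinearMap

/-- `u ⊗ (v ⊗ w) ↦ u v w` on words. -/
def concat3 : Words ε ⊗[k] (Words ε ⊗[k] Words ε) →ₗ[k] Words ε :=
  LinearMap.mul' k (Words ε) ∘ₗ LinearMap.lTensor (Words ε) (LinearMap.mul' k (Words ε))

/-- The normalized Hochschild chains `A ⊗ T(sĀ)`; `a₀ ⊗ₜ [a₁, …, aₙ]` is `a₀[a₁, …, aₙ]`. -/
abbrev Chains : Type _ := A ⊗[k] Words ε

/-- The grading of chains: `|a₀[a₁, …, aₙ]| = |a₀| + ∑ |aᵢ| - n`. -/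
def chainComponents : Chains ε →ₗ[k] (ℤ →₀ Chains ε) :=
  tensorComponents (components 𝒜) (wordComponents 𝒜 ε)

/-- Cutting the word of a chain: `a₀[a₁, …, aₙ] ↦ ∑ᵢ a₀[a₁, …, aᵢ] ⊗ [aᵢ₊₁, …, aₙ]`. -/
def cut : Chains ε →ₗ[k] Chains ε ⊗[k] Words ε :=
  (TensorProduct.assoc k A (Words ε) (Words ε)).symm.toLinearMap ∘ₗ
    LinearMap.lTensor A (deconc ε)

/-- `[a] ↦ -[d a]`, `[a, b] ↦ (-1)^{|a| - 1} [a b]`, and `0` on words of other lengths. -/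
def barLocal (d : A →ₗ[k] A) : Words ε →ₗ[k] Words ε :=
  letter ε ∘ₗ LinearMap.mul' k A ∘ₗ
      TensorProduct.map (unletter ε ∘ₗ signBy (wordComponents 𝒜 ε) (fun j => j)) (unletter ε) ∘ₗ
      deconc ε -
    letter ε ∘ₗ d ∘ₗ unletter ε

/-- `[a₁, …, aₙ] ↦ ∑ (-1)^{|u|} u · barLocal v · w`, over all `[a₁, …, aₙ] = u v w`. -/
def barDiff (d : A →ₗ[k] A) : Words ε →ₗ[k] Words ε :=
  concat3 ε ∘ₗ
    TensorProduct.map (signBy (wordComponents 𝒜 ε) (fun j => j))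
      (LinearMap.rTensor (Words ε) (barLocal 𝒜 ε d)) ∘ₗ
    LinearMap.lTensor (Words ε) (deconc ε) ∘ₗ deconc ε

/-- `a₀[a₁, …, aₙ] ↦ (-1)^{|a₀|} a₀a₁[a₂, …, aₙ]`. -/
def firstFace : Chains ε →ₗ[k] Chains ε :=
  LinearMap.rTensor (Words ε) (LinearMap.mul' k A) ∘ₗ
    (TensorProduct.assoc k A A (Words ε)).symm.toLinearMap ∘ₗ
    TensorProduct.map (signBy (components 𝒜) (fun i => i))
      (LinearMap.rTensor (Words ε) (unletter ε) ∘ₗ deconc ε)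

/-- `a₀[a₁, …, aₙ] ↦ (-1)^{(|aₙ| - 1)(|a₀[a₁, …, aₙ₋₁]|)} aₙa₀[a₁, …, aₙ₋₁]`. -/
def lastFace : Chains ε →ₗ[k] Chains ε :=
  LinearMap.rTensor (Words ε) (LinearMap.mul' k A) ∘ₗ
    (TensorProduct.assoc k A A (Words ε)).symm.toLinearMap ∘ₗ
    LinearMap.rTensor (Chains ε) (unletter ε) ∘ₗ
    koszulFlip (chainComponents 𝒜 ε) (wordComponents 𝒜 ε) ∘ₗ cut ε

/-- The Hochschild differential `D = d₀ + d₁`, of degree `+1`. -/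
def hochschildD (d : A →ₗ[k] A) : Chains ε →ₗ[k] Chains ε :=
  LinearMap.rTensor (Words ε) d +
    TensorProduct.map (signBy (components 𝒜) (fun i => i)) (barDiff 𝒜 ε d) +
    firstFace 𝒜 ε - lastFace 𝒜 ε

/-- The Connes operator
`a₀[a₁, …, aₙ] ↦ ∑_{0 ≤ i ≤ n} (-1)^{s t} 1[aᵢ₊₁, …, aₙ, a₀, a₁, …, aᵢ]`, with
`s = ∑_{j ≤ i} (|aⱼ| - 1)` and `t = ∑_{j > i} (|aⱼ| - 1)`. -/
def connesB : Chains ε →ₗ[k] Chains ε :=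
  TensorProduct.mk k A (Words ε) 1 ∘ₗ concat3 ε ∘ₗ
    LinearMap.lTensor (Words ε) (LinearMap.rTensor (Words ε) (letter ε)) ∘ₗ
    (TensorProduct.comm k (Chains ε) (Words ε)).toLinearMap ∘ₗ
    tensorSign (chainComponents 𝒜 ε) (wordComponents 𝒜 ε) (fun i j => (i - 1) * j) ∘ₗ cut ε

/-! ### The product and the homotopy -/

/-- `a₀ u ↦ ∑ (-1)^{|a₀'| + (|a₀''| + 1)|u|} a₀' ⊗ a₀'' u`, for a word `u`. -/
def splitHead (δ : A →ₗ[k] A ⊗[k] A) : Chains ε →ₗ[k] A ⊗[k] Chains ε :=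
  TensorProduct.map (signBy (components 𝒜) (fun i => i))
      (tensorSign (components 𝒜) (wordComponents 𝒜 ε) (fun i l => (i + 1) * l)) ∘ₗ
    (TensorProduct.assoc k A A (Words ε)).toLinearMap ∘ₗ LinearMap.rTensor (Words ε) δ

/-- `(c u) ⊗ (b v) ↦ u [c b] v`, for words `u`, `v`. -/
def glue : Chains ε ⊗[k] Chains ε →ₗ[k] Words ε :=
  concat3 ε ∘ₗ
    LinearMap.lTensor (Words ε)
      (LinearMap.rTensor (Words ε) (letter ε ∘ₗ LinearMap.mul' k A)) ∘ₗ
    (TensorProduct.leftComm k (A ⊗[k] A) (Words ε) (Words ε)).toLinearMap ∘ₗ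
    (TensorProduct.tensorTensorTensorComm k A (Words ε) A (Words ε)).toLinearMap

/-- The product of degree `m - 1` on chains: for `x = a₀ u` and `y = b₀ v`,
`x ∗ y = ∑ (-1)^{|a₀'| + (|a₀''| + 1)|u|} a₀' u [a₀'' b₀] v`. -/
def starMul (δ : A →ₗ[k] A ⊗[k] A) : Chains ε →ₗ[k] Chains ε →ₗ[k] Chains ε :=
  TensorProduct.curry
    (LinearMap.lTensor A (glue ε) ∘ₗ
      (TensorProduct.assoc k A (Chains ε) (Chains ε)).toLinearMap ∘ₗ
      LinearMap.rTensor (Chains ε) (splitHead 𝒜 ε δ))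

/-- `a₀ u ↦ ∑ (-1)^{|a₀'| + (|a₀''| + 1)|u|} [a₀'] u [a₀'']`, for a word `u`. -/
def wrap (δ : A →ₗ[k] A ⊗[k] A) : Chains ε →ₗ[k] Words ε :=
  concat3 ε ∘ₗ
    TensorProduct.map (letter ε)
      ((TensorProduct.comm k (Words ε) (Words ε)).toLinearMap ∘ₗ
        LinearMap.rTensor (Words ε) (letter ε)) ∘ₗ
    splitHead 𝒜 ε δ

/-- The homotopy for the commutativity: for `x = a₀[a₁, …, aₚ]` and `y = b₀[b₁, …, b_q]`,
`T(x, y) = ∑_{0 ≤ i ≤ q} ± b₀[b₁, …, bᵢ, a₀', a₁, …, aₚ, a₀'', bᵢ₊₁, …, b_q]` with the sign exponent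
`|b₀[b₁, …, bᵢ]| (m + |x|) + |a₀'| + (|a₀''| + 1)(|a₁| + ⋯ + |aₚ| + p)`. -/
def homotopyT (m : ℤ) (δ : A →ₗ[k] A ⊗[k] A) : Chains ε →ₗ[k] Chains ε →ₗ[k] Chains ε :=
  TensorProduct.curry
    (LinearMap.lTensor A (concat3 ε ∘ₗ
        (TensorProduct.leftComm k (Words ε) (Words ε) (Words ε)).toLinearMap) ∘ₗ
      (TensorProduct.leftComm k (Words ε) A (Words ε ⊗[k] Words ε)).toLinearMap ∘ₗ
      TensorProduct.map (wrap 𝒜 ε δ) (TensorProduct.assoc k A (Words ε) (Words ε)).toLinearMap ∘ₗ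
      (TensorProduct.assoc k (Chains ε) (Chains ε) (Words ε)).toLinearMap ∘ₗ
      LinearMap.rTensor (Words ε)
        (tensorSign (chainComponents 𝒜 ε) (chainComponents 𝒜 ε) (fun i j => (m + i) * j)) ∘ₗ
      (TensorProduct.assoc k (Chains ε) (Chains ε) (Words ε)).symm.toLinearMap ∘ₗ
      LinearMap.lTensor (Chains ε) (cut ε))

/-! ### The operators on homogeneous elements

The maps above, written out on words of homogeneous letters. In these formulas `L` is a word whose
letters have the degrees listed in `e`. -/

section Formulas

open TensorProduct

theorem sgn_add (a b : ℤ) : sgn k (a + b) = sgn k a * sgn k b := by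
  simp [sgn, Int.negOnePow_add]

theorem barProj_coe (v : Bar ε) : barProj ε (v : A) = v := by
  ext
  have : ε (v : A) = 0 := v.2
  change (v : A) - algebraMap k A (ε (v : A)) = v
  simp [this]

theorem letter_coe (v : Bar ε) : letter ε (v : A) = TensorAlgebra.ι k v := by
  simp [letter, barProj_coe]

theorem wordComponents_ι {i : ℤ} {v : Bar ε} (hv : (v : A) ∈ 𝒜 i) :
    TensorAlgebra.ι k v ∈ homogeneousPart (wordComponents 𝒜 ε) (i - 1) := by
  rw [mem_homogeneousPart]
  have := mem_homogeneousPart.1 (mem_homogeneousPart_components 𝒜 hv)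
  simp [wordComponents, wordCoaction, this, letter_coe, -LaurentPolynomial.single_eq_C_mul_T]

theorem mul_mem_homogeneousPart_words {i j : ℤ} {u v : Words ε}
    (hu : u ∈ homogeneousPart (wordComponents 𝒜 ε) i)
    (hv : v ∈ homogeneousPart (wordComponents 𝒜 ε) j) :
    u * v ∈ homogeneousPart (wordComponents 𝒜 ε) (i + j) := by
  rw [mem_homogeneousPart] at *
  have hu' : wordCoaction 𝒜 ε u = AddMonoidAlgebra.single i u :=
    (AddMonoidAlgebra.coeffLinearEquiv k).injective hu
  have hv' : wordCoaction 𝒜 ε v = AddMonoidAlgebra.single j v :=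
    (AddMonoidAlgebra.coeffLinearEquiv k).injective hv
  rw [wordComponents, LinearMap.comp_apply, AlgHom.toLinearMap_apply, map_mul, hu', hv', AddMonoidAlgebra.single_mul_single]
  rfl

theorem one_mem_homogeneousPart_words :
    (1 : Words ε) ∈ homogeneousPart (wordComponents 𝒜 ε) 0 := by
  rw [mem_homogeneousPart]
  rw [wordComponents, LinearMap.comp_apply, AlgHom.toLinearMap_apply, map_one]
  rfl

theorem word_mem {L : List (Bar ε)} {e : List ℤ}
    (h : List.Forall₂ (fun (v : Bar ε) (i : ℤ) => (v : A) ∈ 𝒜 i) L e) :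
    word ε L ∈ homogeneousPart (wordComponents 𝒜 ε) (e.map (· - 1)).sum := by
  induction h with
  | nil => exact one_mem_homogeneousPart_words 𝒜 ε
  | cons h _ ih =>
    simpa [word] using mul_mem_homogeneousPart_words 𝒜 ε (wordComponents_ι 𝒜 ε h) ih

theorem lift_cutStep_fst (u w : Words ε) (y : Words ε ⊗[k] Words ε) :
    ((TensorAlgebra.lift k (cutStep ε) u) (w, y)).1 = u * w := by
  induction u using TensorAlgebra.induction generalizing w y with
  | algebraMap r => simp [Algebra.algebraMap_eq_smul_one]
  | ι x => simp [cutStep]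
  | mul a b ha hb =>
    rw [map_mul, Module.End.mul_apply, ← Prod.mk.eta (p := (TensorAlgebra.lift k (cutStep ε) b) (w, y)), ha, hb, mul_assoc]
  | add a b ha hb => simp [ha, hb, add_mul]

theorem deconc_one : deconc ε 1 = 1 ⊗ₜ 1 := by
  simp [deconc]

theorem deconc_ι_mul (v : Bar ε) (u : Words ε) :
    deconc ε (TensorAlgebra.ι k v * u) = 1 ⊗ₜ (TensorAlgebra.ι k v * u) +
      LinearMap.rTensor (Words ε) (LinearMap.mulLeft k (TensorAlgebra.ι k v)) (deconc ε u) := by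
  have h := lift_cutStep_fst ε u 1 (1 ⊗ₜ 1)
  rw [mul_one] at h
  simp only [deconc, LinearMap.comp_apply, AlgHom.toLinearMap_apply, map_mul, TensorAlgebra.lift_ι_apply,
    LinearMap.applyₗ_apply_apply, Module.End.mul_apply, LinearMap.snd_apply]
  rw [← Prod.mk.eta (p := (TensorAlgebra.lift k (cutStep ε) u) (1, 1 ⊗ₜ 1)), h]
  rfl

theorem deconc_word (L : List (Bar ε)) : deconc ε (word ε L) =
    ∑ i ∈ Finset.range (L.length + 1), word ε (L.take i) ⊗ₜ[k] word ε (L.drop i) := by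
  induction L with
  | nil => simp [word, deconc_one]
  | cons v L ih =>
    rw [List.length_cons, Finset.sum_range_succ']
    have : word ε (v :: L) = TensorAlgebra.ι k v * word ε L := by simp [word]
    rw [this, deconc_ι_mul, ih, add_comm]
    simp [word]

theorem unletter_one : unletter ε (1 : Words ε) = 0 := by
  simp only [unletter, LinearMap.comp_apply]
  have : TensorAlgebra.ιInv (1 : Words ε) = 0 := by
    let _ : Module kᵐᵒᵖ (Bar ε) := Module.compHom _ ((RingHom.id k).fromOpposite mul_comm)
    have _ : IsCentralScalar k (Bar ε) := ⟨fun r m => rfl⟩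
    change TrivSqZeroExt.snd (TensorAlgebra.toTrivSqZeroExt (R := k) (1 : Words ε)) = 0
    rw [map_one]; rfl
  simp [this]

theorem unletter_ι (v : Bar ε) : unletter ε (TensorAlgebra.ι k v) = (v : A) := by
  simp [unletter, TensorAlgebra.ι_leftInverse v]

theorem unletter_ι_mul_ι_mul (v w : Bar ε) (u : Words ε) :
    unletter ε (TensorAlgebra.ι k v * (TensorAlgebra.ι k w * u)) = 0 := by
  simp only [unletter, LinearMap.comp_apply]
  have : TensorAlgebra.ιInv (TensorAlgebra.ι k v * (TensorAlgebra.ι k w * u)) = 0 := by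
    let _ : Module kᵐᵒᵖ (Bar ε) := Module.compHom _ ((RingHom.id k).fromOpposite mul_comm)
    have _ : IsCentralScalar k (Bar ε) := ⟨fun r m => rfl⟩
    change TrivSqZeroExt.snd (TensorAlgebra.toTrivSqZeroExt (R := k) _) = 0
    rw [map_mul, map_mul]
    simp [TrivSqZeroExt.snd_mul]
  simp [this]

theorem unletter_word {L : List (Bar ε)} (h : L.length ≠ 1) : unletter ε (word ε L) = 0 := by
  match L with
  | [] => simp [word, unletter_one]
  | [v] => simp at h
  | v :: w :: L => simp [word, unletter_ι_mul_ι_mul]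

theorem unletter_word_singleton (v : Bar ε) : unletter ε (word ε [v]) = (v : A) := by
  simp [word, unletter_ι]

/-- `a₀ u ∗ b₀ v = ∑ (-1)^{|a₀'| + (|a₀''| + 1)|u|} a₀' u [a₀'' b₀] v`. -/
theorem starMul_apply (δ : A →ₗ[k] A ⊗[k] A) {l : ℤ} {u : Words ε}
    (hu : u ∈ homogeneousPart (wordComponents 𝒜 ε) l) (a b : A) (v : Words ε)
    {n : ℕ} (c c' : Fin n → A) (p q : Fin n → ℤ) (hc : ∀ r, c r ∈ 𝒜 (p r)) (hc' : ∀ r, c' r ∈ 𝒜 (q r))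
    (h : δ a = ∑ r, c r ⊗ₜ[k] c' r) :
    starMul 𝒜 ε δ (a ⊗ₜ u) (b ⊗ₜ v) =
      ∑ r, sgn k (p r + (q r + 1) * l) • (c r ⊗ₜ[k] (u * letter ε (c' r * b) * v)) := by
  have key : ∀ r, tensorSign (components 𝒜) (wordComponents 𝒜 ε) (fun i l => (i + 1) * l) (c' r ⊗ₜ u)
    = sgn k ((q r + 1) * l) • (c' r ⊗ₜ[k] u) := fun r =>
      tensorSign_apply (mem_homogeneousPart_components 𝒜 (hc' r)) hu _
  have key2 : ∀ r, signBy (components 𝒜) (fun i => i) (c r) = sgn k (p r) • c r := fun r =>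
      signBy_apply (mem_homogeneousPart_components 𝒜 (hc r)) _
  simp only [starMul, splitHead, TensorProduct.curry_apply, LinearMap.comp_apply, LinearMap.rTensor_tmul, h, sum_tmul, map_sum,
     LinearEquiv.coe_coe, assoc_tmul, map_tmul, key, key2]
  refine Finset.sum_congr rfl fun r _ => ?_
  simp only [sgn_add, mul_comm (sgn k (p r)), mul_smul, ← TensorProduct.smul_tmul', tmul_smul, map_smul, assoc_tmul, LinearMap.lTensor_tmul, map_tmul, LinearMap.comp_apply, LinearEquiv.coe_coe]; simp [glue, concat3, mul_assoc]

theorem cut_word (a : A) (L : List (Bar ε)) : cut ε (a ⊗ₜ word ε L) =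
    ∑ i ∈ Finset.range (L.length + 1), (a ⊗ₜ[k] word ε (L.take i)) ⊗ₜ[k] word ε (L.drop i) := by
  simp [cut, deconc_word, tmul_sum]

theorem connesB_apply {i : ℤ} {a : A} (ha : a ∈ 𝒜 i) {L : List (Bar ε)} {e : List ℤ}
    (h : List.Forall₂ (fun (v : Bar ε) (i : ℤ) => (v : A) ∈ 𝒜 i) L e) :
    connesB 𝒜 ε (a ⊗ₜ word ε L) = ∑ r ∈ Finset.range (L.length + 1),
      sgn k ((i + ((e.take r).map (· - 1)).sum - 1) * ((e.drop r).map (· - 1)).sum) •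
        ((1 : A) ⊗ₜ[k] (word ε (L.drop r) * letter ε a * word ε (L.take r))) := by
  have ht : ∀ r, _ := fun r => word_mem 𝒜 ε (List.forall₂_take r h)
  have hd : ∀ r, _ := fun r => word_mem 𝒜 ε (List.forall₂_drop r h)
  have key : ∀ r, tensorSign (chainComponents 𝒜 ε) (wordComponents 𝒜 ε) (fun i j => (i - 1) * j)
      ((a ⊗ₜ word ε (L.take r)) ⊗ₜ word ε (L.drop r)) = _ := fun r => tensorSign_apply
    (tmul_mem_homogeneousPart (mem_homogeneousPart_components 𝒜 ha) (ht r)) (hd r) _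
  simp only [connesB, LinearMap.comp_apply, cut_word, map_sum, key]
  refine Finset.sum_congr rfl fun r _ => ?_
  simp [concat3, mul_assoc]

theorem homotopyT_apply (m : ℤ) (δ : A →ₗ[k] A ⊗[k] A) {i j l : ℤ} {a b : A} (ha : a ∈ 𝒜 i) (hb : b ∈ 𝒜 j)
   {u : Words ε} (hu : u ∈ homogeneousPart (wordComponents 𝒜 ε) l)
   {L : List (Bar ε)} {e : List ℤ} (h : List.Forall₂ (fun (v : Bar ε) (i : ℤ) => (v : A) ∈ 𝒜 i) L e) 
    {n : ℕ} (c c' : Fin n → A) (p q : Fin n → ℤ) (hc : ∀ r, c r ∈ 𝒜 (p r)) (hc' : ∀ r, c' r ∈ 𝒜 (q r))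
    (hδ : δ a = ∑ r, c r ⊗ₜ[k] c' r) :
    homotopyT 𝒜 ε m δ (a ⊗ₜ u) (b ⊗ₜ word ε L) =
      ∑ s ∈ Finset.range (L.length + 1), ∑ r, sgn k ((m + (i + l)) * (j + ((e.take s).map (· - 1)).sum) + (p r + (q r + 1) * l)) • 
        (b ⊗ₜ[k] (word ε (L.take s) * (letter ε (c r) * u * letter ε (c' r)) * word ε (L.drop s))) := by
  have key : ∀ r, tensorSign (components 𝒜) (wordComponents 𝒜 ε) (fun i l => (i + 1) * l) (c' r ⊗ₜ u)
    = sgn k ((q r + 1) * l) • (c' r ⊗ₜ[k] u) := fun r =>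
      tensorSign_apply (mem_homogeneousPart_components 𝒜 (hc' r)) hu _
  have key2 : ∀ r, signBy (components 𝒜) (fun i => i) (c r) = sgn k (p r) • c r := fun r =>
      signBy_apply (mem_homogeneousPart_components 𝒜 (hc r)) _
  have ht : ∀ r, _ := fun r => word_mem 𝒜 ε (List.forall₂_take r h)
  have key3 : ∀ s, tensorSign (chainComponents 𝒜 ε) (chainComponents 𝒜 ε) (fun i j => (m + i) * j)
      ((a ⊗ₜ u) ⊗ₜ (b ⊗ₜ word ε (L.take s))) = _ := fun r => tensorSign_apply
    (tmul_mem_homogeneousPart (mem_homogeneousPart_components 𝒜 ha) hu) 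
    (tmul_mem_homogeneousPart (mem_homogeneousPart_components 𝒜 hb) (ht r)) _
  have hw : wrap 𝒜 ε δ (a ⊗ₜ u) = ∑ r, sgn k (p r + (q r + 1) * l) • (letter ε (c r) * u * letter ε (c' r)) := by
    simp only [wrap, splitHead, LinearMap.comp_apply, LinearMap.rTensor_tmul, hδ, sum_tmul, map_sum,
     LinearEquiv.coe_coe, assoc_tmul, map_tmul, key, key2]
    refine Finset.sum_congr rfl fun r _ => ?_
    simp only [sgn_add, mul_comm (sgn k (p r)), mul_smul, ← TensorProduct.smul_tmul', tmul_smul, map_smul, assoc_tmul, LinearMap.lTensor_tmul, map_tmul, LinearMap.comp_apply, LinearEquiv.coe_coe]; simp [concat3, mul_assoc]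
  simp only [homotopyT, TensorProduct.curry_apply, LinearMap.comp_apply, LinearMap.lTensor_tmul, cut_word, tmul_sum, map_sum,
     LinearEquiv.coe_coe, assoc_symm_tmul, LinearMap.rTensor_tmul, key3]
  refine Finset.sum_congr rfl fun s _ => ?_
  simp only [← TensorProduct.smul_tmul', map_smul, assoc_tmul, map_tmul, LinearEquiv.coe_coe, hw, sum_tmul, map_sum, leftComm_tmul, LinearMap.lTensor_tmul, LinearMap.comp_apply, tmul_sum, Finset.smul_sum]
  refine Finset.sum_congr rfl fun r _ => ?_
  simp [concat3, mul_assoc, sgn_add, ← TensorProduct.smul_tmul', smul_smul]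

theorem firstFace_cons {i : ℤ} {a : A} (ha : a ∈ 𝒜 i) (v : Bar ε) (L : List (Bar ε)) :
   firstFace 𝒜 ε (a ⊗ₜ word ε (v :: L)) = sgn k i • ((a * v) ⊗ₜ[k] word ε L) := by
  have key2 : signBy (components 𝒜) (fun i => i) a = sgn k i • a := 
      signBy_apply (mem_homogeneousPart_components 𝒜 ha) _
  simp only [firstFace, LinearMap.comp_apply, map_tmul, deconc_word, map_sum, LinearMap.rTensor_tmul, key2, tmul_sum]
  rw [Finset.sum_eq_single 1]
  · simp [unletter_word_singleton, ← TensorProduct.smul_tmul']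
  · intro b hb hb1
    rw [unletter_word]
    · simp
    · simp at hb ⊢; omega
  · simp

theorem firstFace_nil (a : A) : firstFace 𝒜 ε (a ⊗ₜ 1) = 0 := by
  simp [firstFace, deconc_one, unletter_one]

theorem lastFace_append {i j : ℤ} {a : A} (ha : a ∈ 𝒜 i) (v : Bar ε) (hv : (v : A) ∈ 𝒜 j) 
  {L : List (Bar ε)} {e : List ℤ}
    (h : List.Forall₂ (fun (v : Bar ε) (i : ℤ) => (v : A) ∈ 𝒜 i) L e):
   lastFace 𝒜 ε (a ⊗ₜ word ε (L ++ [v])) = sgn k ((i + (e.map (· - 1)).sum) * (j - 1)) • (((v : A) * a) ⊗ₜ[k] word ε L) := by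
  have h' : List.Forall₂ (fun (v : Bar ε) (i : ℤ) => (v : A) ∈ 𝒜 i) (L ++ [v]) (e ++ [j]) := List.rel_append h (List.Forall₂.cons hv List.Forall₂.nil)
  have ht : ∀ r, _ := fun r => word_mem 𝒜 ε (List.forall₂_take r h')
  have hd : ∀ r, _ := fun r => word_mem 𝒜 ε (List.forall₂_drop r h')
  have key : ∀ r, koszulFlip (chainComponents 𝒜 ε) (wordComponents 𝒜 ε) 
      ((a ⊗ₜ word ε ((L ++ [v]).take r)) ⊗ₜ word ε ((L ++ [v]).drop r)) = _ := fun r => congrArg (TensorProduct.comm k _ _) (tensorSign_apply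
    (tmul_mem_homogeneousPart (mem_homogeneousPart_components 𝒜 ha) (ht r)) (hd r) _)
  simp only [lastFace, LinearMap.comp_apply, cut_word, map_sum, key]
  rw [Finset.sum_eq_single L.length]
  · have := h.length_eq
    simp [unletter_word_singleton, this]
  · intro b hb hb1
    rw [map_smul, map_smul, comm_tmul, LinearMap.rTensor_tmul, unletter_word]
    · simp
    · simp at hb ⊢; omega
  · simp

theorem lastFace_nil {i : ℤ} {a : A} (ha : a ∈ 𝒜 i) : lastFace 𝒜 ε (a ⊗ₜ 1) = 0 := by
  have h1 := one_mem_homogeneousPart_words 𝒜 ε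
  have := tensorSign_apply
    (tmul_mem_homogeneousPart (mem_homogeneousPart_components 𝒜 ha) h1) h1 (fun i j => i * j)
  simp [lastFace, cut, deconc_one, koszulFlip, chainComponents, this, unletter_one]

theorem barLocal_one (d : A →ₗ[k] A) : barLocal 𝒜 ε d 1 = 0 := by
  simp [barLocal, deconc_one, unletter_one]

theorem barLocal_ι (d : A →ₗ[k] A) (v : Bar ε) : barLocal 𝒜 ε d (TensorAlgebra.ι k v) = - letter ε (d v) := by
  have := deconc_word ε [v]
  simp [word, Finset.sum_range_succ] at this
  have h1 := mem_homogeneousPart.1 (one_mem_homogeneousPart_words 𝒜 ε)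
  simp [barLocal, this, unletter_one, unletter_ι, signBy, h1]

theorem barLocal_ι_mul_ι (d : A →ₗ[k] A) {i : ℤ} (v w : Bar ε) (hv : (v : A) ∈ 𝒜 i) :
   barLocal 𝒜 ε d (TensorAlgebra.ι k v * TensorAlgebra.ι k w) = sgn k (i - 1) • letter ε (v * w) := by
  have := deconc_word ε [v, w]
  simp [word, Finset.sum_range_succ] at this
  have h1 := mem_homogeneousPart.1 (one_mem_homogeneousPart_words 𝒜 ε)
  have h2 := unletter_ι_mul_ι_mul ε v w 1
  rw [mul_one] at h2
  have h3 := signBy_apply (wordComponents_ι 𝒜 ε hv) (fun i => i)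
  simp [barLocal, this, unletter_one, unletter_ι, h1, h2, h3, ← TensorProduct.smul_tmul']

end Formulas

/-! ### Relative Hochschild homology -/

/-- The relative chains `⊕_{n ≥ 1} A ⊗ Ā^{⊗ n}`. -/
def relChains : Submodule k (Chains ε) :=
  Submodule.span k {x | ∃ (a : A) (v : Bar ε) (u : Words ε),
    x = a ⊗ₜ[k] (TensorAlgebra.ι k v * u)}

/-- The relative cycles. -/
def relCycles (d : A →ₗ[k] A) : Submodule k (Chains ε) :=
  relChains ε ⊓ LinearMap.ker (hochschildD 𝒜 ε d)

/-- The relative boundaries. -/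
def relBoundaries (d : A →ₗ[k] A) : Submodule k (Chains ε) :=
  (relChains ε).map (hochschildD 𝒜 ε d)

/-- The relative Hochschild homology of `A`, the homology of the relative chains. -/
abbrev RelHH (d : A →ₗ[k] A) : Type _ :=
  ↥(relCycles 𝒜 ε d) ⧸ (relBoundaries 𝒜 ε d).comap (relCycles 𝒜 ε d).subtype

/-- The homology class of a relative cycle. -/
def relClass (d : A →ₗ[k] A) : ↥(relCycles 𝒜 ε d) →ₗ[k] RelHH 𝒜 ε d :=
  ((relBoundaries 𝒜 ε d).comap (relCycles 𝒜 ε d).subtype).mkQ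

/-- The degree `n` part of relative Hochschild homology: the classes of the cycles of degree `n`. -/
def relHHDegree (d : A →ₗ[k] A) (n : ℤ) : Submodule k (RelHH 𝒜 ε d) :=
  ((homogeneousPart (chainComponents 𝒜 ε) n).comap (relCycles 𝒜 ε d).subtype).map
    (relClass 𝒜 ε d)

/-- The product `(-1)^{(m-1)|x|} x ∗ y` on the chains shifted by `m - 1`. -/
def shiftedMul (m : ℤ) (δ : A →ₗ[k] A ⊗[k] A) : Chains ε →ₗ[k] Chains ε →ₗ[k] Chains ε :=
  starMul 𝒜 ε δ ∘ₗ signBy (chainComponents 𝒜 ε) (fun i => (m - 1) * i)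

/-- The chains whose degree is `n` after the shift by `m - 1`, where `C[r]ₙ = Cₙ₋ᵣ`. -/
def shiftedRelChains (m n : ℤ) : Submodule k (Chains ε) :=
  relChains ε ⊓ homogeneousPart (chainComponents 𝒜 ε) (n - (m - 1))

end Algebra

/-! ### Batalin-Vilkovisky algebras -/

section BV

variable {k V : Type*} [CommRing k] [AddCommGroup V] [Module k V]

/-- The left side minus the right side of the `7`-term relation, for `|a| = i` and `|b| = j`. -/
def sevenTermDefect (mul : V →ₗ[k] V →ₗ[k] V) (Δ : V →ₗ[k] V) (i j : ℤ) (a b c : V) : V :=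
  Δ (mul (mul a b) c) -
    (mul (Δ (mul a b)) c + sgn k i • mul a (Δ (mul b c)) +
      sgn k ((i - 1) * j) • mul b (Δ (mul a c)) -
      mul (mul (Δ a) b) c - sgn k i • mul (mul a (Δ b)) c -
      sgn k (i + j) • mul (mul a b) (Δ c))

/-- `(V, mul, br)` is a Gerstenhaber algebra, not necessarily unital, with a bracket of odd
degree `e`. -/
structure IsGerstenhaberAlgebra (gr : ℤ → Submodule k V) (e : ℤ)
    (mul br : V →ₗ[k] V →ₗ[k] V) : Prop where
  isInternal : DirectSum.IsInternal gr
  mul_mem : ∀ (i j : ℤ) (a b : V), a ∈ gr i → b ∈ gr j → mul a b ∈ gr (i + j)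
  br_mem : ∀ (i j : ℤ) (a b : V), a ∈ gr i → b ∈ gr j → br a b ∈ gr (i + j + e)
  mul_assoc : ∀ a b c : V, mul (mul a b) c = mul a (mul b c)
  mul_comm : ∀ (i j : ℤ) (a b : V), a ∈ gr i → b ∈ gr j →
    mul a b = sgn k (i * j) • mul b a
  leibniz : ∀ (i j : ℤ) (a b c : V), a ∈ gr i → b ∈ gr j →
    br a (mul b c) = mul (br a b) c + sgn k ((i - 1) * j) • mul b (br a c)
  antisymm : ∀ (i j : ℤ) (a b : V), a ∈ gr i → b ∈ gr j →
    br a b = -(sgn k ((i - 1) * (j - 1)) • br b a)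
  jacobi : ∀ (i j : ℤ) (a b c : V), a ∈ gr i → b ∈ gr j →
    br (br a b) c = br a (br b c) - sgn k ((i - 1) * (j - 1)) • br b (br a c)

/-- `(V, mul, br, Δ)` is a BV-algebra: a Gerstenhaber algebra with an operator `Δ` of degree `e` and
square zero, whose deviation from being a derivation of the product is the bracket. Here `e = 1` or
`e = -1`, according to whether `V` is graded cohomologically or homologically with respect to
`Δ`. -/
structure IsBVAlgebra (gr : ℤ → Submodule k V) (e : ℤ) (mul br : V →ₗ[k] V →ₗ[k] V)
    (Δ : V →ₗ[k] V) : Prop extends IsGerstenhaberAlgebra gr e mul br where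
  op_mem : ∀ (i : ℤ) (a : V), a ∈ gr i → Δ a ∈ gr (i + e)
  op_op : ∀ a : V, Δ (Δ a) = 0
  br_eq : ∀ (i : ℤ) (a b : V), a ∈ gr i →
    br a b = sgn k i • Δ (mul a b) - sgn k i • mul (Δ a) b - mul a (Δ b)

end BV

end OpenFrobenius

end

open OpenFrobenius

open scoped TensorProduct

set_option linter.unusedSimpArgs false
set_option linter.unusedSectionVars false

noncomputable section

namespace OpenFrobenius

/-! ### Signs -/

section Signs

variable {k : Type*} [CommRing k]

/-! A chain a₀[a₁, …, aₙ] is encoded as the element a₀ t a₁ t ⋯ t aₙ t of the free product R of A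
with k[t]/(t²), where the separator t has degree -1 (`SepAlgebra`). The relation t² = 0 encodes
normalization: t 1 t = 0, so between two separators only the image of a letter in Ā matters.
Conversely, `trace` maps R onto the chains by rotating the last factor from A to the front. It
vanishes on A, is invariant up to Koszul sign under rotation of elements of A, and inverts the
encoding (`isRelTrace_trace`, `trace_ofChain`). Each operation of the theorem has a short
description in R, and the identities are proved there by induction on products of generators.

The dictionary is as follows. D is the odd derivation that extends d and sends t to 1: deleting a
separator multiplies its neighbours, and deleting the last one gives the cyclic face
(`hochschildD_trace`). B cuts r = P t Q at each separator and rotates it to t Q P t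
(`connesB_trace`). For x = trace r let c_x = ∑ ± 1' r 1'', where δ 1 = ∑ 1' ⊗ 1''. The bimodule
property of δ makes c_x commute with A (`isCentralizing_conj`). Compatibility of δ with d gives D
c_x = c_{Dx} (`diff_conj`). The symmetry of δ 1 gives trace(s c_x) = ± trace(c_y r) for y = trace s
(`trace_mul_conj`). In these terms x y = trace(c_x s), and T(x, y) is the trace of the insertion of
c_x into s, that is, of the derivation over A with t ↦ t c_x t (`starMul_trace`, `homotopyT_trace`).
The shifted degree of x is the degree of c_x, which is why the shift simplifies the signs.

Associativity now reads c_{xy} = c_x c_y (`conj_conj_mul`), and the chain map property is the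
Leibniz rule in R. Differentiating t c t leaves c t and ± t c besides the term with dc, so the
boundary of an insertion into s is c s - ± s c (`diff_ins`); with the symmetry this is commutativity
up to T.

For the BV structure, a rotation of c_x s cuts either c_x or s. Each half is homotopic, by a
rotation combined with an insertion (`trace_diff_cycIns`), to a value of T plus a product with B of
one argument. Hence B(xy) - (Bx)y ∓ x(By) is homotopic to T(x, y) ± T(y, x) (`connesB_shiftedMul`).
This bracket is a derivation in y up to homotopy: T(x, –) is one strictly, because insertion is a
derivation that commutes with s ↦ c_s (`shiftedT_shiftedMul`), and T(–, x) is one up to the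
insertion of two elements (`diff_insTwo`). That yields the seven-term relation up to homotopy
(`sevenTermDefect_eq`). On homology the relation is exact and equivalent to the Leibniz rule of the
bracket, and applying Δ to the Leibniz rule gives Jacobi (`bvBracket_jacobi`).

Relative chains are needed because the trace kills A: the formulas for the product and for T require
a separator in each argument. Elements with two separators still have one after differentiation, and
these correspond to chains with at least one letter. -/

theorem sgn_eq_ite (n : ℤ) : sgn k n = if Even n then 1 else -1 := by
  split_ifs with h
  · simp [sgn, Int.negOnePow_even n h]
  · simp [sgn, Int.negOnePow_odd n (Int.not_even_iff_odd.1 h)]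

theorem sgn_zero : sgn k 0 = 1 := by simp [sgn]

theorem sgn_one : sgn k 1 = -1 := by simp [sgn]

theorem sgn_neg (n : ℤ) : sgn k (-n) = sgn k n := by
  simp [sgn]

theorem sgn_mul_self (n : ℤ) : sgn k n * sgn k n = 1 := by
  rw [sgn_eq_ite]; split_ifs <;> simp

theorem sgn_smul_sgn_smul {M : Type*} [AddCommGroup M] [Module k M] (n : ℤ) (x : M) :
    sgn k n • sgn k n • x = x := by
  rw [smul_smul, sgn_mul_self, one_smul]

theorem sgn_congr {a b : ℤ} (h : Even (a - b)) : sgn k a = sgn k b := by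
  rw [sgn_eq_ite, sgn_eq_ite]
  have : Even a ↔ Even b := by simpa [Int.even_sub] using h
  simp [this]

end Signs

/-! ### Homogeneous elements of the algebra and of its tensor square -/

section Homogeneous

variable {k A : Type*} [CommRing k] [Ring A] [Algebra k A] (𝒜 : ℤ → Submodule k A)
  [GradedAlgebra 𝒜]

theorem linearMap_ext_homogeneous {M : Type*} [AddCommGroup M] [Module k M] {f g : A →ₗ[k] M}
    (h : ∀ (i : ℤ) (a : A), a ∈ 𝒜 i → f a = g a) : f = g := by
  ext a
  induction a using DirectSum.Decomposition.inductionOn 𝒜 with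
  | zero => simp
  | homogeneous a => exact h _ a a.2
  | add a b ha hb => simp [ha, hb]

theorem tensor_ext_homogeneous {M : Type*} [AddCommGroup M] [Module k M] {f g : A ⊗[k] A →ₗ[k] M}
    (h : ∀ (i j : ℤ) (a b : A), a ∈ 𝒜 i → b ∈ 𝒜 j → f (a ⊗ₜ b) = g (a ⊗ₜ b)) : f = g := by
  apply TensorProduct.ext
  refine linearMap_ext_homogeneous 𝒜 fun i a ha => linearMap_ext_homogeneous 𝒜 fun j b hb => ?_
  exact h i j a b ha hb

/-- The elements of degree `n` in the tensor square are generated by the tensors of homogeneous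
elements of total degree `n`. -/
theorem mem_span_of_mem_homogeneousPart {n : ℤ} {x : A ⊗[k] A}
    (hx : x ∈ homogeneousPart (tensorComponents (components 𝒜) (components 𝒜)) n) :
    x ∈ Submodule.span k {y | ∃ (i : ℤ) (a b : A), a ∈ 𝒜 i ∧ b ∈ 𝒜 (n - i) ∧ y = a ⊗ₜ[k] b} := by
  have h : Finsupp.lapply (R := k) n (tensorComponents (components 𝒜) (components 𝒜) x) = x := by
    rw [mem_homogeneousPart.1 hx]; simp
  rw [← h]
  generalize hS : Submodule.span k {y | ∃ (i : ℤ) (a b : A), a ∈ 𝒜 i ∧ b ∈ 𝒜 (n - i) ∧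
    y = a ⊗ₜ[k] b} = S
  have key : (S.mkQ ∘ₗ Finsupp.lapply n ∘ₗ tensorComponents (components 𝒜) (components 𝒜)) = 0 := by
    refine tensor_ext_homogeneous 𝒜 fun i j a b ha hb => ?_
    have := mem_homogeneousPart.1 (tmul_mem_homogeneousPart (mem_homogeneousPart_components 𝒜 ha)
      (mem_homogeneousPart_components 𝒜 hb))
    simp only [LinearMap.comp_apply, this, Finsupp.lapply_apply, LinearMap.zero_apply,
      Submodule.mkQ_apply, Submodule.Quotient.mk_eq_zero, Finsupp.single_apply]
    split_ifs with hij
    · rw [← hS]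
      exact Submodule.subset_span ⟨i, a, b, ha, by rwa [← hij, add_sub_cancel_left], rfl⟩
    · exact zero_mem _
  have := LinearMap.congr_fun key x
  simpa using this

/-- Reduces identities about `δ 1` and `δ a` to pure tensors. Knowing the total degree matters: it
expresses the degree of the second factor by that of the first, and then all signs can be compared.
-/
theorem map_tensor_of_mem_homogeneousPart {M : Type*} [AddCommGroup M] [Module k M] {n : ℤ}
    {x : A ⊗[k] A} (hx : x ∈ homogeneousPart (tensorComponents (components 𝒜) (components 𝒜)) n)
    {f g : A ⊗[k] A →ₗ[k] M}
    (h : ∀ (i : ℤ) (a b : A), a ∈ 𝒜 i → b ∈ 𝒜 (n - i) → f (a ⊗ₜ b) = g (a ⊗ₜ b)) : f x = g x := by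
  have := mem_span_of_mem_homogeneousPart 𝒜 hx
  clear hx
  induction this using Submodule.span_induction with
  | mem x hx => obtain ⟨i, a, b, ha, hb, rfl⟩ := hx; exact h i a b ha hb
  | zero => simp
  | add x y _ _ hx hy => simp [hx, hy]
  | smul c x _ hx => simp [hx]

theorem map_tensor_mem_of_mem_homogeneousPart {M : Type*} [AddCommGroup M] [Module k M] {n : ℤ}
    {x : A ⊗[k] A} (hx : x ∈ homogeneousPart (tensorComponents (components 𝒜) (components 𝒜)) n)
    {f : A ⊗[k] A →ₗ[k] M} {S : Submodule k M}
    (h : ∀ (i : ℤ) (a b : A), a ∈ 𝒜 i → b ∈ 𝒜 (n - i) → f (a ⊗ₜ b) ∈ S) : f x ∈ S := by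
  have := mem_span_of_mem_homogeneousPart 𝒜 hx
  clear hx
  induction this using Submodule.span_induction with
  | mem x hx => obtain ⟨i, a, b, ha, hb, rfl⟩ := hx; exact h i a b ha hb
  | zero => simp
  | add x y _ _ hx hy => simpa using add_mem hx hy
  | smul c x _ hx => simpa using S.smul_mem c hx

theorem exists_homogeneous_tensor (x : A ⊗[k] A) : ∃ (n : ℕ) (c c' : Fin n → A) (p q : Fin n → ℤ),
    (∀ r, c r ∈ 𝒜 (p r)) ∧ (∀ r, c' r ∈ 𝒜 (q r)) ∧ x = ∑ r, c r ⊗ₜ[k] c' r := by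
  have hx : x ∈ Submodule.span k {y | ∃ (i j : ℤ) (a b : A), a ∈ 𝒜 i ∧ b ∈ 𝒜 j ∧ y = a ⊗ₜ[k] b} := by
    generalize hS : Submodule.span k {y | ∃ (i j : ℤ) (a b : A), a ∈ 𝒜 i ∧ b ∈ 𝒜 j ∧
      y = a ⊗ₜ[k] b} = S
    have key : S.mkQ = 0 := tensor_ext_homogeneous 𝒜 fun i j a b ha hb => by
      simp only [Submodule.mkQ_apply, LinearMap.zero_apply, Submodule.Quotient.mk_eq_zero, ← hS]
      exact Submodule.subset_span ⟨i, j, a, b, ha, hb, rfl⟩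
    simpa using LinearMap.congr_fun key x
  obtain ⟨n, f, g, hg⟩ := Submodule.mem_span_set'.1 hx
  choose i j a b ha hb hab using fun r => (g r).2
  refine ⟨n, fun r => f r • a r, b, i, j, fun r => (𝒜 _).smul_mem _ (ha r), hb, ?_⟩
  rw [← hg]
  simp [hab, TensorProduct.smul_tmul']

/-- `a ↦ (-1)^{n|a|} a` as a morphism of algebras. -/
def signHom (n : ℤ) : A →ₐ[k] A :=
  AlgHom.ofLinearMap (signBy (components 𝒜) (fun i => n * i))
    (by rw [signBy_apply (mem_homogeneousPart_components 𝒜 (SetLike.GradedOne.one_mem))]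
        simp [sgn_zero])
    (fun x y => by
      suffices h : (LinearMap.mul k A).compr₂ (signBy (components 𝒜) (fun i => n * i)) =
          (LinearMap.mul k A).compl₁₂ (signBy (components 𝒜) (fun i => n * i))
            (signBy (components 𝒜) (fun i => n * i)) from
        LinearMap.congr_fun (LinearMap.congr_fun h x) y
      refine linearMap_ext_homogeneous 𝒜 fun i a ha => linearMap_ext_homogeneous 𝒜 fun j b hb => ?_
      have h1 := mem_homogeneousPart_components 𝒜 ha
      have h2 := mem_homogeneousPart_components 𝒜 hb
      have h3 := mem_homogeneousPart_components 𝒜 (SetLike.mul_mem_graded ha hb)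
      simp [signBy_apply h1, signBy_apply h2, signBy_apply h3, smul_smul, mul_add, sgn_add, mul_comm])

theorem signHom_apply (n : ℤ) {i : ℤ} {a : A} (ha : a ∈ 𝒜 i) :
    signHom 𝒜 n a = sgn k (n * i) • a :=
  signBy_apply (mem_homogeneousPart_components 𝒜 ha) _

end Homogeneous

end OpenFrobenius

namespace OpenFrobenius

/-! ### The algebra generated by `A` and a separator of square zero -/

section SepAlgebra

variable (k A : Type*) [CommRing k] [Ring A] [Algebra k A]

/-- The relations making the inclusion of `A` a morphism of algebras and the separator a generator
of square zero. -/
inductive SepRel : TensorAlgebra k (A × k) → TensorAlgebra k (A × k) → Prop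
  | mul (a b : A) : SepRel (TensorAlgebra.ι k (a * b, 0))
      (TensorAlgebra.ι k (a, 0) * TensorAlgebra.ι k (b, 0))
  | one : SepRel (TensorAlgebra.ι k (1, 0)) 1
  | sep : SepRel (TensorAlgebra.ι k (0, 1) * TensorAlgebra.ι k (0, 1)) 0

/-- The free product of `A` with the algebra `k[t]/(t²)`. The chain `a₀[a₁, …, aₙ]` is represented
by the element `a₀ t a₁ t ⋯ t aₙ t`. -/
def SepAlgebra : Type _ := RingQuot (SepRel k A)

instance : Ring (SepAlgebra k A) := inferInstanceAs (Ring (RingQuot (SepRel k A)))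

instance : Algebra k (SepAlgebra k A) := inferInstanceAs (Algebra k (RingQuot (SepRel k A)))

namespace SepAlgebra

/-- The projection from the tensor algebra. -/
def mk : TensorAlgebra k (A × k) →ₐ[k] SepAlgebra k A := RingQuot.mkAlgHom k (SepRel k A)

theorem mk_rel {x y : TensorAlgebra k (A × k)} (h : SepRel k A x y) : mk k A x = mk k A y :=
  RingQuot.mkAlgHom_rel k h

/-- The separator `t`. -/
def sep : SepAlgebra k A := mk k A (TensorAlgebra.ι k (0, 1))

/-- The inclusion of `A`. -/
def of : A →ₐ[k] SepAlgebra k A :=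
  AlgHom.ofLinearMap ((mk k A).toLinearMap ∘ₗ TensorAlgebra.ι k ∘ₗ LinearMap.inl k A k)
    (by simpa using mk_rel k A SepRel.one)
    (fun a b => by simpa using mk_rel k A (SepRel.mul a b))

theorem sep_mul_sep : sep k A * sep k A = 0 := by
  simpa [sep] using mk_rel k A SepRel.sep

variable {k A}

theorem sep_mul_sep_mul (r : SepAlgebra k A) : sep k A * (sep k A * r) = 0 := by
  rw [← mul_assoc, sep_mul_sep, zero_mul]

theorem mk_ι (a : A) (c : k) : mk k A (TensorAlgebra.ι k (a, c)) = of k A a + c • sep k A := by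
  have : ((a, c) : A × k) = (a, 0) + c • (0, 1) := by simp
  rw [this, map_add, map_smul, map_add, map_smul]
  rfl

-- There is no separate case for scalars, since c · 1 is the image of an element of A.
@[elab_as_elim]
theorem induction {p : SepAlgebra k A → Prop} (of : ∀ a, p (of k A a)) (sep : p (sep k A))
    (mul : ∀ r s, p r → p s → p (r * s)) (add : ∀ r s, p r → p s → p (r + s)) (r) : p r := by
  obtain ⟨x, rfl⟩ := RingQuot.mkAlgHom_surjective k (SepRel k A) r
  change p (mk k A x)
  have hc : ∀ c : k, p (algebraMap k _ c) := fun c => by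
    rw [← (SepAlgebra.of k A).commutes]; exact of _
  induction x using TensorAlgebra.induction with
  | algebraMap c => rw [AlgHom.commutes]; exact hc c
  | ι x =>
    rw [← Prod.mk.eta (p := x), mk_ι, Algebra.smul_def]
    exact add _ _ (of _) (mul _ _ (hc _) sep)
  | mul x y hx hy => rw [map_mul]; exact mul _ _ hx hy
  | add x y hx hy => rw [map_add]; exact add _ _ hx hy

section Lift

variable {S : Type*} [Ring S] [Algebra k S]

/-- The morphism of algebras with given restriction to `A` and given value at the separator. -/
def lift (f : A →ₐ[k] S) (τ : S) (hτ : τ * τ = 0) : SepAlgebra k A →ₐ[k] S :=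
  RingQuot.liftAlgHom k ⟨TensorAlgebra.lift k (f.toLinearMap.coprod (LinearMap.toSpanSingleton k S τ)),
    fun x y h => by
      induction h with
      | mul a b => simp
      | one => simp
      | sep => simp [hτ]⟩

theorem lift_mk (f : A →ₐ[k] S) (τ : S) (hτ : τ * τ = 0) (x : TensorAlgebra k (A × k)) :
    lift f τ hτ (mk k A x) =
      TensorAlgebra.lift k (f.toLinearMap.coprod (LinearMap.toSpanSingleton k S τ)) x :=
  RingQuot.liftAlgHom_mkAlgHom_apply _ _ _ _

@[simp]
theorem lift_of (f : A →ₐ[k] S) (τ : S) (hτ : τ * τ = 0) (a : A) :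
    lift f τ hτ (of k A a) = f a := by
  have : of k A a = mk k A (TensorAlgebra.ι k (a, 0)) := by simp [mk_ι]
  rw [this, lift_mk]
  simp

@[simp]
theorem lift_sep (f : A →ₐ[k] S) (τ : S) (hτ : τ * τ = 0) :
    lift f τ hτ (sep k A) = τ := by
  rw [sep, lift_mk]
  simp

/-- The morphism `r ↦ !![f r, D r; 0, g r]` that defines a twisted derivation `D`. -/
def twistedHom (f g : SepAlgebra k A →ₐ[k] S) (D : A →ₗ[k] S)
    (hD : ∀ a b, D (a * b) = D a * g (of k A b) + f (of k A a) * D b) (τ : S)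
    (hτ : f (sep k A) * τ + τ * g (sep k A) = 0) :
    SepAlgebra k A →ₐ[k] Matrix (Fin 2) (Fin 2) S :=
  lift
    (AlgHom.ofLinearMap
      { toFun := fun a => !![f (of k A a), D a; 0, g (of k A a)]
        map_add' := fun a b => by ext i j; fin_cases i <;> fin_cases j <;> simp
        map_smul' := fun c a => by ext i j; fin_cases i <;> fin_cases j <;> simp }
      (by
        have h1 : D 1 = 0 := by simpa using hD 1 1
        ext i j; fin_cases i <;> fin_cases j <;> simp [h1])
      (fun a b => by
        ext i j; fin_cases i <;> fin_cases j <;> simp [hD, add_comm]))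
    -- Multiplicativity of upper triangular matrices is the twisted Leibniz rule for the corner
    -- entry. The square of this matrix vanishes by `hτ`, as the relation t² = 0 demands.
    !![f (sep k A), τ; 0, g (sep k A)]
    (by
      ext i j
      fin_cases i <;> fin_cases j <;> simp [hτ, ← map_mul, sep_mul_sep])

/-- The linear map `D` with `D (r s) = D r * g s + f r * D s` that has given values on `A` and at the
separator. -/
def twistedDer (f g : SepAlgebra k A →ₐ[k] S) (D : A →ₗ[k] S)
    (hD : ∀ a b, D (a * b) = D a * g (of k A b) + f (of k A a) * D b) (τ : S)
    (hτ : f (sep k A) * τ + τ * g (sep k A) = 0) : SepAlgebra k A →ₗ[k] S :=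
  Matrix.entryLinearMap k S 0 1 ∘ₗ (twistedHom f g D hD τ hτ).toLinearMap

variable (f g : SepAlgebra k A →ₐ[k] S) (D : A →ₗ[k] S)
    (hD : ∀ a b, D (a * b) = D a * g (of k A b) + f (of k A a) * D b) (τ : S)
    (hτ : f (sep k A) * τ + τ * g (sep k A) = 0)

theorem twistedDer_of (a : A) : twistedDer f g D hD τ hτ (of k A a) = D a := by
  simp [twistedDer, twistedHom]

theorem twistedDer_sep : twistedDer f g D hD τ hτ (sep k A) = τ := by
  simp [twistedDer, twistedHom]

theorem twistedHom_apply (r : SepAlgebra k A) : twistedHom f g D hD τ hτ r 0 0 = f r ∧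
    twistedHom f g D hD τ hτ r 1 0 = 0 ∧ twistedHom f g D hD τ hτ r 1 1 = g r := by
  induction r using induction with
  | of a => simp [twistedHom]
  | sep => simp [twistedHom]
  | mul r s hr hs => simp [Matrix.mul_apply, hr, hs]
  | add r s hr hs => simp [hr, hs]

theorem twistedDer_mul (r s : SepAlgebra k A) : twistedDer f g D hD τ hτ (r * s) =
    twistedDer f g D hD τ hτ r * g s + f r * twistedDer f g D hD τ hτ s := by
  simp [twistedDer, Matrix.mul_apply, twistedHom_apply f g D hD τ hτ, add_comm]

end Lift

/-! ### The grading by degree and the filtration by the number of separators -/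

section Grading

variable (𝒜 : ℤ → Submodule k A)

/-- The products of homogeneous elements of `A` and separators, of total degree `i` and with at least
`n` separators. The separator has degree `-1`. -/
inductive IsMonomial : ℕ → ℤ → SepAlgebra k A → Prop
  | of {i : ℤ} {a : A} (ha : a ∈ 𝒜 i) : IsMonomial 0 i (of k A a)
  | sep : IsMonomial 1 (-1) (sep k A)
  | mul {n n' : ℕ} {i i' : ℤ} {r r' : SepAlgebra k A} (h : IsMonomial n i r)
      (h' : IsMonomial n' i' r') : IsMonomial (n + n') (i + i') (r * r')
  | weaken {n n' : ℕ} {i : ℤ} {r : SepAlgebra k A} (hn : n' ≤ n) (h : IsMonomial n i r) :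
      IsMonomial n' i r

/-- The elements of degree `i` with at least `n` separators. -/
def sepPart (n : ℕ) (i : ℤ) : Submodule k (SepAlgebra k A) :=
  Submodule.span k {r | IsMonomial 𝒜 n i r}

variable {𝒜}

theorem sepPart_antitone {n n' : ℕ} (hn : n' ≤ n) {i : ℤ} {r : SepAlgebra k A}
    (hr : r ∈ sepPart 𝒜 n i) : r ∈ sepPart 𝒜 n' i :=
  Submodule.span_mono (fun _ h => IsMonomial.weaken hn h) hr

theorem of_mem {i : ℤ} {a : A} (ha : a ∈ 𝒜 i) : of k A a ∈ sepPart 𝒜 0 i :=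
  Submodule.subset_span (IsMonomial.of ha)

theorem sep_mem : sep k A ∈ sepPart 𝒜 1 (-1) :=
  Submodule.subset_span IsMonomial.sep

theorem mul_mem {n n' : ℕ} {i i' : ℤ} {r r' : SepAlgebra k A} (h : r ∈ sepPart 𝒜 n i)
    (h' : r' ∈ sepPart 𝒜 n' i') : r * r' ∈ sepPart 𝒜 (n + n') (i + i') := by
  have := Submodule.mul_mem_mul h h'
  rw [sepPart, sepPart, Submodule.span_mul_span] at this
  refine Submodule.span_mono ?_ this
  rintro _ ⟨r, hr, s, hs, rfl⟩
  exact IsMonomial.mul hr hs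

theorem mul_mem' {i i' : ℤ} {r r' : SepAlgebra k A} (h : r ∈ sepPart 𝒜 0 i)
    (h' : r' ∈ sepPart 𝒜 0 i') : r * r' ∈ sepPart 𝒜 0 (i + i') := by
  have := mul_mem h h'
  rwa [add_zero] at this

section

variable [GradedAlgebra 𝒜]

theorem one_mem : (1 : SepAlgebra k A) ∈ sepPart 𝒜 0 0 := by
  have := of_mem (𝒜 := 𝒜) (SetLike.GradedOne.one_mem (A := 𝒜))
  rwa [map_one] at this

end

/-- Linear conditions on homogeneous elements can be checked on products of generators. -/
theorem sepPart_induction {p : ℤ → SepAlgebra k A → Prop} (zero : ∀ i, p i 0)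
    (add : ∀ i r s, p i r → p i s → p i (r + s)) (smul : ∀ i (c : k) r, p i r → p i (c • r))
    (of : ∀ i a, a ∈ 𝒜 i → p i (of k A a)) (sep : p (-1) (sep k A))
    (mul : ∀ i j r s, r ∈ sepPart 𝒜 0 i → s ∈ sepPart 𝒜 0 j → p i r → p j s → p (i + j) (r * s))
    {n : ℕ} {i : ℤ} {r : SepAlgebra k A} (hr : r ∈ sepPart 𝒜 n i) : p i r := by
  induction hr using Submodule.span_induction with
  | mem r hr =>
    induction hr with
    | of ha => exact of _ _ ha
    | sep => exact sep
    | mul hr hs h1 h2 =>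
      exact mul _ _ _ _ (sepPart_antitone (Nat.zero_le _) (Submodule.subset_span hr))
        (sepPart_antitone (Nat.zero_le _) (Submodule.subset_span hs)) h1 h2
    | weaken _ _ h => exact h
  | zero => exact zero _
  | add r s _ _ hr hs => exact add _ _ _ hr hs
  | smul c r _ hr => exact smul _ _ _ hr

variable [GradedAlgebra 𝒜]

theorem iSup_sepPart : ⨆ i, sepPart 𝒜 0 i = ⊤ := by
  rw [eq_top_iff]
  rintro r -
  induction r using induction with
  | of a =>
    induction a using DirectSum.Decomposition.inductionOn 𝒜 with
    | zero => simp
    | homogeneous a => exact Submodule.mem_iSup_of_mem _ (of_mem a.2)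
    | add a b ha hb => simpa using add_mem ha hb
  | sep => exact Submodule.mem_iSup_of_mem _ (sepPart_antitone (Nat.zero_le 1) sep_mem)
  | mul r s hr hs =>
    have h1 : ∀ i, ∀ r ∈ sepPart 𝒜 0 i, ⨆ j, sepPart 𝒜 0 j ≤
        (⨆ j, sepPart 𝒜 0 j).comap (LinearMap.mulLeft k r) := fun i r hr =>
      iSup_le fun j s hs => by
        rw [Submodule.mem_comap, LinearMap.mulLeft_apply]
        exact Submodule.mem_iSup_of_mem (i + j) (mul_mem' hr hs)
    have h2 : ⨆ j, sepPart 𝒜 0 j ≤ (⨆ j, sepPart 𝒜 0 j).comap (LinearMap.mulRight k s) :=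
      iSup_le fun i r hr => by
        rw [Submodule.mem_comap, LinearMap.mulRight_apply]
        exact h1 i r hr hs
    have := h2 hr
    rwa [Submodule.mem_comap, LinearMap.mulRight_apply] at this
  | add r s hr hs => exact add_mem hr hs

/-- A linear map that vanishes on homogeneous elements is zero. -/
theorem linearMap_ext_sepPart {M : Type*} [AddCommGroup M] [Module k M]
    {f g : SepAlgebra k A →ₗ[k] M} (h : ∀ i, ∀ r ∈ sepPart 𝒜 0 i, f r = g r) : f = g := by
  ext r
  have : r ∈ ⨆ i, sepPart 𝒜 0 i := by rw [iSup_sepPart]; trivial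
  induction this using Submodule.iSup_induction' with
  | mem i r hr => exact h i r hr
  | zero => simp
  | add r s _ _ hr hs => simp [hr, hs]

/-- `r ↦ (-1)^{n|r|} r`. -/
def sign (𝒜 : ℤ → Submodule k A) [GradedAlgebra 𝒜] (n : ℤ) : SepAlgebra k A →ₐ[k] SepAlgebra k A :=
  lift ((of k A).comp (signHom 𝒜 n)) (sgn k n • sep k A)
    (by simp [sep_mul_sep])

/-- Both sides are multiplicative, so generators suffice; the separator has degree -1. -/
theorem sign_apply (n : ℤ) {l : ℕ} {i : ℤ} {r : SepAlgebra k A} (hr : r ∈ sepPart 𝒜 l i) :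
    sign 𝒜 n r = sgn k (n * i) • r := by
  refine sepPart_induction (p := fun i r => sign 𝒜 n r = sgn k (n * i) • r) ?_ ?_ ?_ ?_ ?_ ?_ hr
  · simp
  · intro i r s hr hs; simp [hr, hs]
  · intro i c r hr; simp [hr, smul_comm c]
  · intro i a ha; simp [sign, signHom_apply 𝒜 n ha]
  · rw [sign, lift_sep]
    exact congrArg (· • _) (sgn_congr (by ring_nf; simp))
  · intro i j r s _ _ hr hs
    rw [map_mul, hr, hs, smul_mul_smul_comm, ← sgn_add, mul_add]

end Grading

end SepAlgebra

end SepAlgebra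

end OpenFrobenius

namespace OpenFrobenius

namespace SepAlgebra

variable {k A : Type*} [CommRing k] [Ring A] [Algebra k A] {𝒜 : ℤ → Submodule k A}
  [GradedAlgebra 𝒜]

/-! ### The differential -/

section Differential

variable {d : A →ₗ[k] A} {ε : A →ₐ[k] k} (hA : IsAugmentedCDGA 𝒜 d ε)

include hA in
theorem d_mul_signHom (a b : A) : d (a * b) = d a * b + signHom 𝒜 1 a * d b := by
  suffices h : (LinearMap.mul k A).compr₂ d =
      (LinearMap.mul k A).comp d + (LinearMap.mul k A).compl₁₂ (signHom 𝒜 1).toLinearMap d from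
    LinearMap.congr_fun (LinearMap.congr_fun h a) b
  refine linearMap_ext_homogeneous 𝒜 fun i a ha => ?_
  ext b
  simp [hA.d_mul i a b ha, signHom_apply 𝒜 1 ha]

/-- The odd derivation that extends `d` and maps the separator to `1`. -/
def diff : SepAlgebra k A →ₗ[k] SepAlgebra k A :=
  twistedDer (sign 𝒜 1) (AlgHom.id k _) ((of k A).toLinearMap ∘ₗ d)
    (fun a b => by simp [d_mul_signHom hA, sign]) 1
    -- Compatibility with t² = 0 of an odd derivation with t ↦ 1: the two terms are -t and t.
    (by simp [sign, sgn])

@[simp]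
theorem diff_of (a : A) : diff hA (of k A a) = of k A (d a) := by
  simp [diff, twistedDer_of]

@[simp]
theorem diff_sep : diff hA (sep k A) = 1 := by
  simp [diff, twistedDer_sep]

theorem diff_mul' (r s : SepAlgebra k A) :
    diff hA (r * s) = diff hA r * s + sign 𝒜 1 r * diff hA s := by
  simp [diff, twistedDer_mul]

theorem diff_mul {n : ℕ} {i : ℤ} {r : SepAlgebra k A} (hr : r ∈ sepPart 𝒜 n i)
    (s : SepAlgebra k A) : diff hA (r * s) = diff hA r * s + sgn k i • (r * diff hA s) := by
  rw [diff_mul', sign_apply 1 hr, one_mul, smul_mul_assoc]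

theorem diff_sep_mul (r : SepAlgebra k A) : diff hA (sep k A * r) = r - sep k A * diff hA r := by
  rw [diff_mul hA (sep_mem (𝒜 := 𝒜))]
  simp [sgn, sub_eq_add_neg]

theorem diff_one : diff hA 1 = 0 := by
  have := diff_sep_mul hA (sep k A)
  rw [sep_mul_sep, diff_sep, mul_one, sub_self] at this
  have h := diff_mul' hA 1 1
  simpa using h

/-- By the Leibniz rule each term loses at most one separator. The truncated subtraction covers
elements with no guaranteed separator. -/
theorem diff_mem' {n : ℕ} {i : ℤ} {r : SepAlgebra k A} (hr : r ∈ sepPart 𝒜 n i) :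
    diff hA r ∈ sepPart 𝒜 (n - 1) (i + 1) := by
  induction hr using Submodule.span_induction with
  | mem r hr =>
    induction hr with
    | of ha => simpa using of_mem (hA.d_mem _ _ ha)
    | sep => simpa using one_mem (𝒜 := 𝒜)
    | @mul n n' i i' r s hr hs h1 h2 =>
      rw [diff_mul hA (Submodule.subset_span hr)]
      refine add_mem ?_ (Submodule.smul_mem _ _ ?_)
      · have := mul_mem h1 (Submodule.subset_span hs)
        rw [add_right_comm] at this
        exact sepPart_antitone (by omega) this
      · have := mul_mem (Submodule.subset_span hr) h2
        rw [← add_assoc] at this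
        exact sepPart_antitone (by omega) this
    | weaken hn _ h => exact sepPart_antitone (by omega) h
  | zero => simp
  | add r s _ _ hr hs => simpa using add_mem hr hs
  | smul c r _ hr => simpa using Submodule.smul_mem _ c hr

theorem diff_mem {n : ℕ} {i : ℤ} {r : SepAlgebra k A} (hr : r ∈ sepPart 𝒜 (n + 1) i) :
    diff hA r ∈ sepPart 𝒜 n (i + 1) := by
  have := diff_mem' hA hr
  rwa [Nat.add_sub_cancel] at this

theorem diff_mem_zero {i : ℤ} {r : SepAlgebra k A} (hr : r ∈ sepPart 𝒜 0 i) :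
    diff hA r ∈ sepPart 𝒜 0 (i + 1) := by
  have := diff_mem' hA hr
  rwa [Nat.zero_sub] at this

/-- The square of an odd derivation is a derivation, and this one vanishes on generators: d² = 0 on
A, and t ↦ 1 ↦ 0. -/
theorem diff_diff (r : SepAlgebra k A) : diff hA (diff hA r) = 0 := by
  suffices h : diff hA ∘ₗ diff hA = 0 from LinearMap.congr_fun h r
  refine linearMap_ext_sepPart (𝒜 := 𝒜) fun i r hr => ?_
  refine sepPart_induction (p := fun i r => diff hA (diff hA r) = 0) ?_ ?_ ?_ ?_ ?_ ?_ hr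
  · simp
  · intro i r s hr hs; simp [hr, hs]
  · intro i c r hr; simp [hr]
  · intro i a ha; simp [hA.d_d]
  · simp [diff_one]
  · intro i j r s hr hs h1 h2
    rw [diff_mul hA hr, map_add, map_smul, diff_mul hA hr, diff_mul hA (diff_mem_zero hA hr), h1, h2]
    simp [sgn_add, sgn_one]

end Differential

/-! ### Operators defined by cutting at the separators -/

section Cut

/-- The sum of `P t ⊗ t Q` over all factorizations `r = P t Q` at a separator. -/
def cutSep : SepAlgebra k A →ₗ[k] SepAlgebra k A ⊗[k] SepAlgebra k A :=
  twistedDer (Algebra.TensorProduct.includeLeft) (Algebra.TensorProduct.includeRight) 0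
    -- The derivation over A into the bimodule R ⊗ R with t ↦ t ⊗ t. It respects t² = 0 because t² ⊗
    -- t and t ⊗ t² both vanish.
    (by simp) (sep k A ⊗ₜ sep k A) (by simp [sep_mul_sep])

@[simp]
theorem cutSep_of (a : A) : cutSep (of k A a) = 0 := by
  simp [cutSep, twistedDer_of]

@[simp]
theorem cutSep_sep : cutSep (sep k A) = sep k A ⊗ₜ sep k A := by
  simp [cutSep, twistedDer_sep]

theorem cutSep_mul (r s : SepAlgebra k A) :
    cutSep (r * s) = LinearMap.lTensor _ (LinearMap.mulRight k s) (cutSep r) +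
      LinearMap.rTensor _ (LinearMap.mulLeft k r) (cutSep s) := by
  have h1 : ∀ x : SepAlgebra k A ⊗[k] SepAlgebra k A,
      x * (1 ⊗ₜ s) = LinearMap.lTensor _ (LinearMap.mulRight k s) x := fun x => by
    induction x with
    | zero => simp
    | tmul x y => simp
    | add x y hx hy => simp [add_mul, hx, hy]
  have h2 : ∀ x : SepAlgebra k A ⊗[k] SepAlgebra k A,
      (r ⊗ₜ 1) * x = LinearMap.rTensor _ (LinearMap.mulLeft k r) x := fun x => by
    induction x with
    | zero => simp
    | tmul x y => simp
    | add x y hx hy => simp [mul_add, hx, hy]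
  rw [← h1, ← h2]
  exact twistedDer_mul _ _ _ _ _ _ r s

/-- `(f, c) ↦ (P ⊗ Q ↦ f P * c * Q)`. -/
def sandwich : (SepAlgebra k A →ₗ[k] SepAlgebra k A) →ₗ[k]
    SepAlgebra k A →ₗ[k] SepAlgebra k A ⊗[k] SepAlgebra k A →ₗ[k] SepAlgebra k A :=
  LinearMap.mk₂ k (fun f c => LinearMap.mul' k _ ∘ₗ TensorProduct.map f (LinearMap.mulLeft k c))
    (fun f f' c => by ext; simp [add_mul]) (fun a f c => by ext; simp)
    (fun f c c' => by ext; simp [mul_add, add_mul]) (fun a f c => by ext; simp)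

@[simp]
theorem sandwich_tmul (f : SepAlgebra k A →ₗ[k] SepAlgebra k A) (c x y : SepAlgebra k A) :
    sandwich f c (x ⊗ₜ y) = f x * (c * y) := rfl

/-- `(f, c) ↦ (P ⊗ Q ↦ Q * c * f P)`. -/
def cosandwich : (SepAlgebra k A →ₗ[k] SepAlgebra k A) →ₗ[k]
    SepAlgebra k A →ₗ[k] SepAlgebra k A ⊗[k] SepAlgebra k A →ₗ[k] SepAlgebra k A :=
  LinearMap.mk₂ k (fun f c => LinearMap.mul' k _ ∘ₗ
      TensorProduct.map LinearMap.id (LinearMap.mulLeft k c ∘ₗ f) ∘ₗ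
      (TensorProduct.comm k _ _).toLinearMap)
    (fun f f' c => by ext; simp [mul_add]) (fun a f c => by ext; simp)
    (fun f c c' => by ext; simp [mul_add, add_mul]) (fun a f c => by ext; simp)

@[simp]
theorem cosandwich_tmul (f : SepAlgebra k A →ₗ[k] SepAlgebra k A) (c x y : SepAlgebra k A) :
    cosandwich f c (x ⊗ₜ y) = y * (c * f x) := rfl

variable (𝒜)

/-- The insertion `∑ ± P t c t Q` of `c` at the separators: the derivation over `A` of degree `n`
with `t ↦ t c t`. -/
def ins (n : ℤ) : SepAlgebra k A →ₗ[k] SepAlgebra k A →ₗ[k] SepAlgebra k A :=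
  -- The left half of a cut is P t, so the sign operator contributes (-1)^{n(|P| - 1)}; the scalar
  -- restores the Koszul sign (-1)^{n|P|}.
  sgn k n • (sandwich (sign 𝒜 n).toLinearMap).compl₂ cutSep

/-- The rotation `∑ ± t Q z P t` of `r = P t Q`, around `z`. -/
def cyc (n : ℤ) : SepAlgebra k A →ₗ[k] SepAlgebra k A →ₗ[k] SepAlgebra k A :=
  (cosandwich (sign 𝒜 n).toLinearMap).compl₂ cutSep

/-- The rotation of `r = P t Q` around `z` combined with the insertion of `c` in `P t`. -/
def cycIns (n j : ℤ) : SepAlgebra k A →ₗ[k] SepAlgebra k A →ₗ[k] SepAlgebra k A →ₗ[k] SepAlgebra k A :=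
  LinearMap.mk₂ k (fun c z => cosandwich ((sign 𝒜 n).toLinearMap ∘ₗ ins 𝒜 j c) z ∘ₗ cutSep)
    (fun f f' c => by ext; simp [LinearMap.comp_add]) (fun a f c => by ext; simp [LinearMap.comp_smul])
    (fun f c c' => by ext; simp) (fun a f c => by ext; simp)

/-- The insertion of `c` and `c'`, in this order, at the separators. -/
def insTwo (a b : ℤ) : SepAlgebra k A →ₗ[k] SepAlgebra k A →ₗ[k] SepAlgebra k A →ₗ[k] SepAlgebra k A :=
  LinearMap.mk₂ k (fun c c' => sgn k b • sandwich (ins 𝒜 a c ∘ₗ (sign 𝒜 b).toLinearMap) c' ∘ₗ cutSep)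
    (fun f f' c => by ext; simp [LinearMap.add_comp]) (fun a f c => by ext; simp [LinearMap.smul_comp, smul_comm a])
    (fun f c c' => by ext; simp) (fun a f c => by ext; simp [smul_comm a])

variable {𝒜}

theorem sandwich_lTensor (f : SepAlgebra k A →ₗ[k] SepAlgebra k A) (c s : SepAlgebra k A) (x) :
    sandwich f c (LinearMap.lTensor _ (LinearMap.mulRight k s) x) = sandwich f c x * s := by
  induction x with
  | zero => simp
  | tmul x y => simp [mul_assoc]
  | add x y hx hy => simp [hx, hy, add_mul]

theorem cosandwich_lTensor (f : SepAlgebra k A →ₗ[k] SepAlgebra k A) (c s : SepAlgebra k A) (x) :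
    cosandwich f c (LinearMap.lTensor _ (LinearMap.mulRight k s) x) = cosandwich f (s * c) x := by
  induction x with
  | zero => simp
  | tmul x y => simp [mul_assoc]
  | add x y hx hy => simp [hx, hy]

theorem sandwich_rTensor {f g : SepAlgebra k A →ₗ[k] SepAlgebra k A} {r r' u : SepAlgebra k A}
    (h : ∀ s, f (r * s) = u * s + r' * g s) (c : SepAlgebra k A) (x) :
    sandwich f c (LinearMap.rTensor _ (LinearMap.mulLeft k r) x) =
      u * sandwich LinearMap.id c x + r' * sandwich g c x := by
  induction x with
  | zero => simp
  | tmul x y => simp [h, mul_assoc, add_mul]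
  | add x y hx hy => simp only [map_add, hx, hy, mul_add]; abel

theorem cosandwich_rTensor {f g g' : SepAlgebra k A →ₗ[k] SepAlgebra k A} {r r' u : SepAlgebra k A}
    (h : ∀ s, f (r * s) = u * g' s + r' * g s) (c : SepAlgebra k A) (x) :
    cosandwich f c (LinearMap.rTensor _ (LinearMap.mulLeft k r) x) =
      cosandwich g' (c * u) x + cosandwich g (c * r') x := by
  induction x with
  | zero => simp
  | tmul x y => simp [h, mul_assoc, mul_add]
  | add x y hx hy => simp only [map_add, hx, hy]; abel

@[simp]
theorem ins_of (n : ℤ) (c : SepAlgebra k A) (a : A) : ins 𝒜 n c (of k A a) = 0 := by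
  simp [ins]

@[simp]
theorem ins_sep (n : ℤ) (c : SepAlgebra k A) : ins 𝒜 n c (sep k A) = sep k A * (c * sep k A) := by
  simp [ins, sign_apply n (sep_mem (𝒜 := 𝒜)), smul_smul, sgn_neg, sgn_mul_self]

/-- The insertion happens either in r or in s; in the second case the operator has passed r. -/
theorem ins_mul' (n : ℤ) (c r s : SepAlgebra k A) :
    ins 𝒜 n c (r * s) = ins 𝒜 n c r * s + sign 𝒜 n r * ins 𝒜 n c s := by
  simp only [ins, LinearMap.smul_apply, LinearMap.compl₂_apply, cutSep_mul, map_add,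
    sandwich_lTensor, smul_add, smul_mul_assoc, mul_smul_comm]
  rw [sandwich_rTensor (g := (sign 𝒜 n).toLinearMap) (u := 0) (r' := sign 𝒜 n r) (by simp)]
  simp

@[simp]
theorem cyc_of (n : ℤ) (z : SepAlgebra k A) (a : A) : cyc 𝒜 n z (of k A a) = 0 := by
  simp [cyc]

theorem cyc_sep (n : ℤ) (z : SepAlgebra k A) :
    cyc 𝒜 n z (sep k A) = sgn k n • (sep k A * (z * sep k A)) := by
  simp [cyc, sign_apply n (sep_mem (𝒜 := 𝒜)), sgn_neg]

/-- If the cut is in r, then s belongs to the right half and ends up just before z. If it is in s,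
then r belongs to the left half and ends up just after z. This rule is the reason for carrying the
parameter z: an induction on products must be able to change it. -/
theorem cyc_mul' (n : ℤ) (z r s : SepAlgebra k A) :
    cyc 𝒜 n z (r * s) = cyc 𝒜 n (s * z) r + cyc 𝒜 n (z * sign 𝒜 n r) s := by
  simp only [cyc, LinearMap.compl₂_apply, cutSep_mul, map_add, cosandwich_lTensor]
  rw [cosandwich_rTensor (g := (sign 𝒜 n).toLinearMap) (g' := 0) (u := 0) (r' := sign 𝒜 n r) (by simp)]
  simp

@[simp]
theorem cycIns_of (n j : ℤ) (c z : SepAlgebra k A) (a : A) : cycIns 𝒜 n j c z (of k A a) = 0 := by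
  simp [cycIns]

theorem cycIns_sep (n j : ℤ) (c z : SepAlgebra k A) :
    cycIns 𝒜 n j c z (sep k A) =
      sep k A * (z * sign 𝒜 n (sep k A * (c * sep k A))) := by
  simp [cycIns]

/-- Three positions of insertion and cut, the insertion always preceding the cut: both in r,
insertion in r and cut in s, both in s. In the middle case only a plain rotation of s remains. -/
theorem cycIns_mul' (n j : ℤ) (c z r s : SepAlgebra k A) :
    cycIns 𝒜 n j c z (r * s) = cycIns 𝒜 n j c (s * z) r +
      cyc 𝒜 n (z * sign 𝒜 n (ins 𝒜 j c r)) s +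
      cycIns 𝒜 n j c (z * sign 𝒜 n (sign 𝒜 j r)) s := by
  simp only [cyc, cycIns, LinearMap.mk₂_apply, LinearMap.comp_apply, LinearMap.compl₂_apply,
    cutSep_mul, map_add, cosandwich_lTensor, add_assoc]
  rw [cosandwich_rTensor (g' := (sign 𝒜 n).toLinearMap)
    (g := (sign 𝒜 n).toLinearMap ∘ₗ ins 𝒜 j c) (u := sign 𝒜 n (ins 𝒜 j c r))
    (r' := sign 𝒜 n (sign 𝒜 j r)) (by simp [ins_mul'])]

@[simp]
theorem insTwo_of (n m : ℤ) (c c' : SepAlgebra k A) (a : A) :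
    insTwo 𝒜 n m c c' (of k A a) = 0 := by
  simp [insTwo]

@[simp]
theorem insTwo_sep (n m : ℤ) (c c' : SepAlgebra k A) :
    insTwo 𝒜 n m c c' (sep k A) = sep k A * (c * (sep k A * (c' * sep k A))) := by
  simp [insTwo, sign_apply m (sep_mem (𝒜 := 𝒜)), smul_smul, sgn_neg, sgn_mul_self, mul_assoc]

/-- Both insertions in r, one in each factor, or both in s; the order of c and c' excludes a fourth
case. -/
theorem insTwo_mul' (n m : ℤ) (c c' r s : SepAlgebra k A) :
    insTwo 𝒜 n m c c' (r * s) = insTwo 𝒜 n m c c' r * s +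
      ins 𝒜 n c (sign 𝒜 m r) * ins 𝒜 m c' s +
      sign 𝒜 n (sign 𝒜 m r) * insTwo 𝒜 n m c c' s := by
  have key : ∀ x, sandwich (ins 𝒜 n c ∘ₗ (sign 𝒜 m).toLinearMap) c'
      (LinearMap.rTensor _ (LinearMap.mulLeft k r) x) =
      ins 𝒜 n c (sign 𝒜 m r) * sandwich (sign 𝒜 m).toLinearMap c' x +
        sign 𝒜 n (sign 𝒜 m r) * sandwich (ins 𝒜 n c ∘ₗ (sign 𝒜 m).toLinearMap) c' x := fun x => by
    induction x with
    | zero => simp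
    | tmul x y => simp [ins_mul', mul_assoc, add_mul]
    | add x y hx hy => simp only [map_add, hx, hy, mul_add]; abel
  simp only [ins, insTwo, LinearMap.mk₂_apply, LinearMap.smul_apply, LinearMap.comp_apply,
      LinearMap.compl₂_apply,
    cutSep_mul, map_add, sandwich_lTensor] at key ⊢
  rw [key]
  simp only [smul_add, mul_smul_comm, smul_mul_assoc]
  abel

end Cut

end SepAlgebra

end OpenFrobenius

/-! ### Degrees and separator counts of the cut operators, and their boundary formulas -/

namespace OpenFrobenius

namespace SepAlgebra

variable {k A : Type*} [CommRing k] [Ring A] [Algebra k A] {𝒜 : ℤ → Submodule k A}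
  [GradedAlgebra 𝒜]

/-- The span of the tensors of degree `i - 1` with at least `n + 1` separators, at least one in each
factor. -/
def cutPart (𝒜 : ℤ → Submodule k A) (n : ℕ) (i : ℤ) :
    Submodule k (SepAlgebra k A ⊗[k] SepAlgebra k A) :=
  Submodule.span k {w | ∃ (n₁ n₂ : ℕ) (i₁ i₂ : ℤ) (x y : SepAlgebra k A), n + 1 ≤ n₁ + n₂ ∧ 1 ≤ n₁ ∧
    1 ≤ n₂ ∧ i₁ + i₂ = i - 1 ∧ x ∈ sepPart 𝒜 n₁ i₁ ∧ y ∈ sepPart 𝒜 n₂ i₂ ∧ w = x ⊗ₜ[k] y}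

/-- The separator at the cut is doubled, which adds one separator and lowers the degree by one. -/
theorem cutSep_mem {n : ℕ} {i : ℤ} {r : SepAlgebra k A} (hr : r ∈ sepPart 𝒜 n i) :
    cutSep r ∈ cutPart 𝒜 n i := by
  induction hr using Submodule.span_induction with
  | mem r hr =>
    induction hr with
    | of ha => simp
    | sep =>
      rw [cutSep_sep]
      exact Submodule.subset_span ⟨1, 1, -1, -1, _, _, by norm_num, le_rfl, le_rfl, by norm_num,
        sep_mem, sep_mem, rfl⟩
    | @mul n n' i i' r s hr hs h1 h2 =>
      rw [cutSep_mul]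
      have hr := Submodule.subset_span (R := k) hr
      have hs := Submodule.subset_span (R := k) hs
      refine add_mem ?_ ?_
      · have : cutPart 𝒜 n i ≤ (cutPart 𝒜 (n + n') (i + i')).comap
            (LinearMap.lTensor _ (LinearMap.mulRight k s)) := by
          refine Submodule.span_le.2 ?_
          rintro _ ⟨n₁, n₂, i₁, i₂, x, y, hn, hn₁, hn₂, hi, hx, hy, rfl⟩
          refine Submodule.subset_span ⟨n₁, n₂ + n', i₁, i₂ + i', x, y * s, by omega, hn₁, by omega,
            by omega, hx, mul_mem hy hs, ?_⟩
          simp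
        exact this h1
      · have : cutPart 𝒜 n' i' ≤ (cutPart 𝒜 (n + n') (i + i')).comap
            (LinearMap.rTensor _ (LinearMap.mulLeft k r)) := by
          refine Submodule.span_le.2 ?_
          rintro _ ⟨n₁, n₂, i₁, i₂, x, y, hn, hn₁, hn₂, hi, hx, hy, rfl⟩
          refine Submodule.subset_span ⟨n + n₁, n₂, i + i₁, i₂, r * x, y, by omega, by omega, hn₂,
            by omega, mul_mem hr hx, hy, ?_⟩
          simp
        exact this h2
    | weaken hn _ h =>
      refine Submodule.span_mono ?_ h
      rintro _ ⟨n₁, n₂, i₁, i₂, x, y, h1, h2⟩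
      exact ⟨n₁, n₂, i₁, i₂, x, y, by omega, h2⟩
  | zero => simp
  | add r s _ _ hr hs => simpa using add_mem hr hs
  | smul c r _ hr => simpa using Submodule.smul_mem _ c hr

theorem map_cutSep_mem {M : Type*} [AddCommGroup M] [Module k M] {S : Submodule k M}
    {f : SepAlgebra k A ⊗[k] SepAlgebra k A →ₗ[k] M} {n : ℕ} {i : ℤ} {r : SepAlgebra k A}
    (hr : r ∈ sepPart 𝒜 n i)
    (h : ∀ (n₁ n₂ : ℕ) (i₁ i₂ : ℤ) (x y : SepAlgebra k A), n + 1 ≤ n₁ + n₂ → 1 ≤ n₁ → 1 ≤ n₂ →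
      i₁ + i₂ = i - 1 → x ∈ sepPart 𝒜 n₁ i₁ → y ∈ sepPart 𝒜 n₂ i₂ → f (x ⊗ₜ y) ∈ S) :
    f (cutSep r) ∈ S := by
  have : cutPart 𝒜 n i ≤ S.comap f := by
    refine Submodule.span_le.2 ?_
    rintro _ ⟨n₁, n₂, i₁, i₂, x, y, hn, hn₁, hn₂, hi, hx, hy, rfl⟩
    exact h n₁ n₂ i₁ i₂ x y hn hn₁ hn₂ hi hx hy
  exact this (cutSep_mem hr)

theorem sign_mem (p : ℤ) {n : ℕ} {i : ℤ} {r : SepAlgebra k A} (hr : r ∈ sepPart 𝒜 n i) :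
    sign 𝒜 p r ∈ sepPart 𝒜 n i := by
  rw [sign_apply p hr]; exact Submodule.smul_mem _ _ hr

theorem mem_of_le_of_eq {n n' : ℕ} {i i' : ℤ} {r : SepAlgebra k A} (hr : r ∈ sepPart 𝒜 n' i')
    (hn : n ≤ n') (hi : i' = i) : r ∈ sepPart 𝒜 n i := by
  rw [← hi]; exact sepPart_antitone hn hr

theorem ins_mem (p : ℤ) {n l : ℕ} {i j : ℤ} {c r : SepAlgebra k A} (hc : c ∈ sepPart 𝒜 l j)
    (hr : r ∈ sepPart 𝒜 n i) : ins 𝒜 p c r ∈ sepPart 𝒜 n (i + (j - 1)) := by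
  refine Submodule.smul_mem _ _ (map_cutSep_mem (f := sandwich (sign 𝒜 p).toLinearMap c) hr ?_)
  intro n₁ n₂ i₁ i₂ x y hn h1 h2 hi hx hy
  exact mem_of_le_of_eq (mul_mem (sign_mem p hx) (mul_mem hc hy)) (by omega) (by omega)

/-- A rotation t Q z P t keeps both copies of the cut separator. The additional separator is why the
Connes operator takes values in relative chains. -/
theorem cyc_mem (p : ℤ) {n l : ℕ} {i j : ℤ} {z r : SepAlgebra k A} (hz : z ∈ sepPart 𝒜 l j)
    (hr : r ∈ sepPart 𝒜 n i) : cyc 𝒜 p z r ∈ sepPart 𝒜 (n + l + 1) (i + (j - 1)) := by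
  refine map_cutSep_mem (f := cosandwich (sign 𝒜 p).toLinearMap z) hr ?_
  intro n₁ n₂ i₁ i₂ x y hn h1 h2 hi hx hy
  exact mem_of_le_of_eq (mul_mem hy (mul_mem hz (sign_mem p hx))) (by omega) (by omega)

theorem cycIns_mem (p q : ℤ) {n l : ℕ} {i j h : ℤ} {c z r : SepAlgebra k A} (hc : c ∈ sepPart 𝒜 0 h)
    (hz : z ∈ sepPart 𝒜 l j) (hr : r ∈ sepPart 𝒜 n i) :
    cycIns 𝒜 p q c z r ∈ sepPart 𝒜 (n + l + 1) (i + (j - 1) + (h - 1)) := by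
  refine map_cutSep_mem (f := cosandwich ((sign 𝒜 p).toLinearMap ∘ₗ ins 𝒜 q c) z) hr ?_
  intro n₁ n₂ i₁ i₂ x y hn h1 h2 hi hx hy
  exact mem_of_le_of_eq (mul_mem hy (mul_mem hz (sign_mem p (ins_mem q hc hx)))) (by omega) (by omega)

theorem insTwo_mem (p q : ℤ) {n : ℕ} {i j j' : ℤ} {c c' r : SepAlgebra k A}
    (hc : c ∈ sepPart 𝒜 0 j) (hc' : c' ∈ sepPart 𝒜 0 j') (hr : r ∈ sepPart 𝒜 n i) :
    insTwo 𝒜 p q c c' r ∈ sepPart 𝒜 n (i + (j - 1) + (j' - 1)) := by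
  refine Submodule.smul_mem _ _ (map_cutSep_mem
    (f := sandwich (ins 𝒜 p c ∘ₗ (sign 𝒜 q).toLinearMap) c') hr ?_)
  intro n₁ n₂ i₁ i₂ x y hn h1 h2 hi hx hy
  exact mem_of_le_of_eq (mul_mem (ins_mem p hc (sign_mem q hx)) (mul_mem hc' hy)) (by omega) (by omega)

section Homogeneous

variable {n : ℕ} {i : ℤ} {r : SepAlgebra k A}

theorem ins_mul (p : ℤ) (c : SepAlgebra k A) (hr : r ∈ sepPart 𝒜 n i) (s : SepAlgebra k A) :
    ins 𝒜 p c (r * s) = ins 𝒜 p c r * s + sgn k (p * i) • (r * ins 𝒜 p c s) := by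
  rw [ins_mul', sign_apply p hr, smul_mul_assoc]

theorem cyc_mul (p : ℤ) (z : SepAlgebra k A) (hr : r ∈ sepPart 𝒜 n i) (s : SepAlgebra k A) :
    cyc 𝒜 p z (r * s) = cyc 𝒜 p (s * z) r + sgn k (p * i) • cyc 𝒜 p (z * r) s := by
  rw [cyc_mul', sign_apply p hr, mul_smul_comm, map_smul, LinearMap.smul_apply]

theorem cycIns_mul (p j h : ℤ) {c : SepAlgebra k A} (hc : c ∈ sepPart 𝒜 0 h) (z : SepAlgebra k A)
    (hr : r ∈ sepPart 𝒜 n i) (s : SepAlgebra k A) :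
    cycIns 𝒜 p j c z (r * s) = cycIns 𝒜 p j c (s * z) r +
      sgn k (p * (i + (h - 1))) • cyc 𝒜 p (z * ins 𝒜 j c r) s +
      sgn k ((p + j) * i) • cycIns 𝒜 p j c (z * r) s := by
  rw [cycIns_mul', sign_apply j hr, map_smul, sign_apply p hr, sign_apply p (ins_mem j hc hr)]
  simp [mul_smul_comm, add_mul, mul_add, sgn_add, smul_smul, mul_comm]

theorem insTwo_mul (p p' : ℤ) (c c' : SepAlgebra k A) (hr : r ∈ sepPart 𝒜 n i) (s : SepAlgebra k A) :
    insTwo 𝒜 p p' c c' (r * s) = insTwo 𝒜 p p' c c' r * s +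
      sgn k (p' * i) • (ins 𝒜 p c r * ins 𝒜 p' c' s) +
      sgn k ((p + p') * i) • (r * insTwo 𝒜 p p' c c' s) := by
  rw [insTwo_mul', sign_apply p' hr, map_smul, map_smul, sign_apply p hr]
  simp [add_mul, mul_add, sgn_add, smul_smul, mul_comm]

end Homogeneous

/-- The element `c` of degree `j` commutes with `A`, in the graded sense. -/
structure IsCentralizing (𝒜 : ℤ → Submodule k A) (j : ℤ) (c : SepAlgebra k A) : Prop where
  mem : c ∈ sepPart 𝒜 0 j
  comm : ∀ (i : ℤ) (a : A), a ∈ 𝒜 i → c * of k A a = sgn k (i * j) • (of k A a * c)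

/-! ### The differential of insertions and rotations -/

section Identities

variable {d : A →ₗ[k] A} {ε : A →ₐ[k] k} (hA : IsAugmentedCDGA 𝒜 d ε)

/-- The differential of t c t is c t - t (dc) t - (-1)^j t c. The outer terms are the graded
commutator of c with t, and both sides obey the same twisted Leibniz rule, so only generators have
to be compared. On A the insertion vanishes and so must the commutator: this is where c has to
commute with A. -/
theorem diff_ins {j : ℤ} {c : SepAlgebra k A} (hc : IsCentralizing 𝒜 j c)
    {n : ℕ} {i : ℤ} {r : SepAlgebra k A} (hr : r ∈ sepPart 𝒜 n i) :
    diff hA (ins 𝒜 (j - 1) c r) = sgn k (j - 1) • ins 𝒜 (j - 1) c (diff hA r) -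
      ins 𝒜 j (diff hA c) r + (c * r - sgn k (i * j) • (r * c)) := by
  refine sepPart_induction (𝒜 := 𝒜) (p := fun i r => diff hA (ins 𝒜 (j - 1) c r) = sgn k (j - 1) • ins 𝒜 (j - 1) c (diff hA r) -
      ins 𝒜 j (diff hA c) r + (c * r - sgn k (i * j) • (r * c))) ?_ ?_ ?_ ?_ ?_ ?_ hr
  · simp
  · intro i r s hr hs
    simp only [map_add, hr, hs, mul_add, add_mul, smul_add]
    abel
  · intro i a r hr
    simp only [map_smul, hr, mul_smul_comm, smul_mul_assoc]
    module
  · intro i a ha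
    simp [hc.comm i a ha]
  · have h1 := ins_of (𝒜 := 𝒜) (j - 1) c (1 : A)
    rw [map_one] at h1
    rw [ins_sep, diff_sep_mul, diff_mul hA hc.mem, diff_sep, h1, ins_sep, mul_add, mul_smul_comm, mul_one]
    simp [sgn_neg]
    abel
  · intro i l r s hr hs h1 h2
    have h3 := ins_mem (j - 1) hc.mem hr
    rw [ins_mul _ _ hr, ins_mul _ _ hr, map_add, map_smul, diff_mul hA h3, diff_mul hA hr,
      diff_mul hA hr, map_add, map_smul, ins_mul _ _ hr, ins_mul _ _ (diff_mem_zero hA hr), h1, h2]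
    simp only [mul_add, add_mul, mul_sub, sub_mul, smul_add, smul_sub, mul_smul_comm,
        smul_mul_assoc,
      mul_assoc, smul_smul]
    by_cases hi : Even i <;> by_cases hj : Even j <;> by_cases hl : Even l <;>
      simp only [sgn_eq_ite, Int.even_add, Int.even_sub, Int.even_mul, even_neg,
          Int.not_even_one, even_two, Even.zero, hi, hj, hl, iff_true, iff_false, true_iff,
          false_iff, not_true_eq_false, not_false_eq_true, or_true, or_false, true_or, false_or,
          or_self, iff_self, if_true, if_false, ite_true, ite_false, one_smul, neg_smul, smul_neg,
          neg_neg, one_mul, mul_one, neg_mul, mul_neg] <;> abel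

/-- The linear map `q` vanishes on the graded commutators with elements of `A`. -/
def IsRelTrace (𝒜 : ℤ → Submodule k A) {M : Type*} [AddCommGroup M] [Module k M]
    (q : SepAlgebra k A →ₗ[k] M) : Prop :=
  ∀ (i j : ℤ) (a : A) (r : SepAlgebra k A), a ∈ 𝒜 i → r ∈ sepPart 𝒜 0 j →
    q (of k A a * r) = sgn k (i * j) • q (r * of k A a)

variable {M : Type*} [AddCommGroup M] [Module k M] {q : SepAlgebra k A →ₗ[k] M}
  (hq : IsRelTrace 𝒜 q)

include hq in
-- In t Q z P t the differential can delete one of the two outer separators. By the rule for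
-- products these terms telescope along r, leaving the two extreme positions z r and r z. With p = i
-- + l + 1 the sign (-1)^{p|Pt|} is the Koszul sign for moving P t past Q z. The trace enters only
-- for r in A, where z r and r z must cancel.
theorem trace_diff_cyc {n : ℕ} {i l p : ℤ} {r z : SepAlgebra k A} (hr : r ∈ sepPart 𝒜 n i)
    (hz : z ∈ sepPart 𝒜 0 l) (hp : p = i + l + 1) :
    q (diff hA (cyc 𝒜 p z r)) = sgn k (i * l) • q (z * r) - q (r * z) -
      sgn k i • q (cyc 𝒜 (p + 1) (diff hA z) r) - q (cyc 𝒜 (p + 1) z (diff hA r)) := by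
  refine sepPart_induction (𝒜 := 𝒜) (p := fun i r => ∀ (l p : ℤ) (z : SepAlgebra k A),
    z ∈ sepPart 𝒜 0 l → p = i + l + 1 →
      q (diff hA (cyc 𝒜 p z r)) = sgn k (i * l) • q (z * r) - q (r * z) -
      sgn k i • q (cyc 𝒜 (p + 1) (diff hA z) r) - q (cyc 𝒜 (p + 1) z (diff hA r)))
    ?_ ?_ ?_ ?_ ?_ ?_ hr l p z hz hp
  · intro i l p z hz hp
    simp
  · intro i r s hr hs l p z hz hp
    simp only [map_add, mul_add, add_mul, smul_add, hr l p z hz hp, hs l p z hz hp]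
    abel
  · intro i c r hr l p z hz hp
    simp only [map_smul, hr l p z hz hp, mul_smul_comm, smul_mul_assoc]
    module
  · intro i a ha l p z hz hp
    simp [hq i l a z ha hz]
  · intro l p z hz hp
    have h1 := cyc_of (𝒜 := 𝒜) (p + 1) z (1 : A)
    rw [map_one] at h1
    rw [cyc_sep, cyc_sep, diff_sep, h1, map_smul, diff_sep_mul, diff_mul hA hz, diff_sep, hp]
    simp only [map_smul, map_sub, map_add, mul_add, mul_one, map_zero, mul_smul_comm,
        smul_add, smul_sub, smul_smul]
    by_cases hl : Even l <;> simp only [sgn_eq_ite, Int.even_add, Int.even_sub, Int.even_mul,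
        even_neg, Int.not_even_one, even_two, Even.zero, hl, iff_true, iff_false, true_iff,
        false_iff, not_true_eq_false, not_false_eq_true, or_true, or_false, true_or, false_or,
        or_self, iff_self, if_true, if_false, ite_true, ite_false, one_smul, neg_smul, smul_neg,
        neg_neg, one_mul, mul_one, neg_mul, mul_neg] <;> abel
  · intro i j r s hr hs h1 h2 l p z hz hp
    have hsz := mul_mem' hs hz
    have hzr := mul_mem' hz hr
    simp only [cyc_mul _ _ hr, cyc_mul _ _ (diff_mem_zero hA hr), diff_mul hA hr, map_add, map_smul,
      h1 _ p _ hsz (by rw [hp]; ring), h2 _ p _ hzr (by rw [hp]; ring), diff_mul hA hs,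
      diff_mul hA hz]
    simp only [map_smul, map_sub, map_add, smul_add, smul_sub, smul_smul, LinearMap.add_apply,
      LinearMap.smul_apply, mul_assoc, hp]
    by_cases hi : Even i <;> by_cases hj : Even j <;> by_cases hl : Even l <;>
      simp only [sgn_eq_ite, Int.even_add, Int.even_sub, Int.even_mul, even_neg,
          Int.not_even_one, even_two, Even.zero, hi, hj, hl, iff_true, iff_false, true_iff,
          false_iff, not_true_eq_false, not_false_eq_true, or_true, or_false, true_or, false_or,
          or_self, iff_self, if_true, if_false, ite_true, ite_false, one_smul, neg_smul, smul_neg,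
          neg_neg, one_mul, mul_one, neg_mul, mul_neg] <;> abel

/-- Besides the terms with dc, dc' and dr, the differential deletes a separator next to an inserted
element. What survives is c leaving r on the left, c' leaving it on the right, and c meeting c' at a
single separator. -/
theorem diff_insTwo {j j' : ℤ} {c c' : SepAlgebra k A} (hc : IsCentralizing 𝒜 j c)
    (hc' : IsCentralizing 𝒜 j' c') {n : ℕ} {i : ℤ} {r : SepAlgebra k A} (hr : r ∈ sepPart 𝒜 n i) :
    diff hA (insTwo 𝒜 (j - 1) (j' - 1) c c' r) =
      sgn k (j + j') • insTwo 𝒜 (j - 1) (j' - 1) c c' (diff hA r) -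
      insTwo 𝒜 j (j' - 1) (diff hA c) c' r + sgn k j • insTwo 𝒜 (j - 1) j' c (diff hA c') r +
      (c * ins 𝒜 (j' - 1) c' r - sgn k j • ins 𝒜 (j + j' - 1) (c * c') r +
        sgn k (j + j' * i) • (ins 𝒜 (j - 1) c r * c')) := by
  refine sepPart_induction (𝒜 := 𝒜) (p := fun i r => diff hA (insTwo 𝒜 (j - 1) (j' - 1) c c' r) =
      sgn k (j + j') • insTwo 𝒜 (j - 1) (j' - 1) c c' (diff hA r) -
      insTwo 𝒜 j (j' - 1) (diff hA c) c' r + sgn k j • insTwo 𝒜 (j - 1) j' c (diff hA c') r +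
      (c * ins 𝒜 (j' - 1) c' r - sgn k j • ins 𝒜 (j + j' - 1) (c * c') r +
        sgn k (j + j' * i) • (ins 𝒜 (j - 1) c r * c'))) ?_ ?_ ?_ ?_ ?_ ?_ hr
  · simp
  · intro i r s hr hs
    simp only [map_add, hr, hs, mul_add, add_mul, smul_add]
    abel
  · intro i a r hr
    simp only [map_smul, hr, mul_smul_comm, smul_mul_assoc]
    module
  · intro i a ha
    simp
  · have h1 := insTwo_of (𝒜 := 𝒜) (j - 1) (j' - 1) c c' (1 : A)
    rw [map_one] at h1
    rw [insTwo_sep, diff_sep_mul, diff_mul hA hc.mem, diff_sep_mul, diff_mul hA hc'.mem, diff_sep, h1,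
      insTwo_sep, insTwo_sep, ins_sep, ins_sep, ins_sep]
    simp only [mul_add, mul_sub, smul_add, smul_sub, mul_smul_comm, smul_mul_assoc, mul_one,
        mul_assoc, smul_smul, smul_zero]
    by_cases hi : Even j <;> by_cases hj : Even j' <;>
      simp only [sgn_eq_ite, Int.even_add, Int.even_sub, Int.even_mul, even_neg,
          Int.not_even_one, even_two, Even.zero, hi, hj, iff_true, iff_false, true_iff, false_iff,
          not_true_eq_false, not_false_eq_true, or_true, or_false, true_or, false_or, or_self,
          iff_self, if_true, if_false, ite_true, ite_false, one_smul, neg_smul, smul_neg, neg_neg,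
          one_mul, mul_one, neg_mul, mul_neg] <;> abel
  · intro i l r s hr hs h1 h2
    have h3 := ins_mem (j - 1) hc.mem hr
    have h4 := insTwo_mem (j - 1) (j' - 1) hc.mem hc'.mem hr
    have h5 := diff_mem_zero hA hr
    simp only [insTwo_mul _ _ _ _ hr, diff_mul hA hr, map_add, map_smul, insTwo_mul _ _ _ _ h5,
      diff_mul hA h4, diff_mul hA h3, ins_mul _ _ hr, h1, h2, diff_ins hA hc hr, diff_ins hA hc' hs]
    simp only [mul_add, add_mul, mul_sub, sub_mul, smul_add, smul_sub, mul_smul_comm,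
        smul_mul_assoc,
      mul_assoc, smul_smul]
    by_cases hi : Even i <;> by_cases hj : Even j <;> by_cases hl : Even l <;> by_cases hj' : Even j' <;>
      simp only [sgn_eq_ite, Int.even_add, Int.even_sub, Int.even_mul, even_neg,
          Int.not_even_one, even_two, Even.zero, hi, hj, hl, hj', iff_true, iff_false, true_iff,
          false_iff, not_true_eq_false, not_false_eq_true, or_true, or_false, true_or, false_or,
          or_self, iff_self, if_true, if_false, ite_true, ite_false, one_smul, neg_smul, smul_neg,
          neg_neg, one_mul, mul_one, neg_mul, mul_neg] <;> abel

end Identities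

end SepAlgebra

end OpenFrobenius

/-! ### The differential of a rotation combined with an insertion -/

namespace OpenFrobenius

namespace SepAlgebra

variable {k A : Type*} [CommRing k] [Ring A] [Algebra k A] {𝒜 : ℤ → Submodule k A}
  [GradedAlgebra 𝒜]

section CycIns

variable {d : A →ₗ[k] A} {ε : A →ₐ[k] k} (hA : IsAugmentedCDGA 𝒜 d ε)
variable {M : Type*} [AddCommGroup M] [Module k M] {q : SepAlgebra k A →ₗ[k] M}
  (hq : IsRelTrace 𝒜 q)

set_option maxHeartbeats 2000000 in
include hq in
-- The boundary of the configurations t Q z P t with c inserted in P t has three faces: the cut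
-- reaches the end of r, leaving an insertion into r after z; c reaches the beginning of P t and
-- joins z; c reaches the end of P t and leaves on the right. The value of p makes the sign the
-- Koszul sign for moving P t, with c inserted, past Q z.
theorem trace_diff_cycIns {j : ℤ} {c : SepAlgebra k A} (hc : IsCentralizing 𝒜 j c)
    {n : ℕ} {i l p p' : ℤ} {r z : SepAlgebra k A} (hr : r ∈ sepPart 𝒜 n i)
    (hz : z ∈ sepPart 𝒜 0 l) (hp : p = i + l + j) (hp' : p' = i + l + 1) :
    q (diff hA (cycIns 𝒜 p (j - 1) c z r)) =
      sgn k (l * (i + j - 1)) • q (z * ins 𝒜 (j - 1) c r) -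
      sgn k ((i + l) * j) • q (cyc 𝒜 (p + 1) (z * c) r) +
      sgn k ((i + l) * j) • q (cyc 𝒜 p' z r * c) -
      sgn k (i + j - 1) • q (cycIns 𝒜 (p + 1) (j - 1) c (diff hA z) r) -
      sgn k (j - 1) • q (cycIns 𝒜 (p + 1) (j - 1) c z (diff hA r)) +
      q (cycIns 𝒜 (p + 1) j (diff hA c) z r) := by
  refine sepPart_induction (𝒜 := 𝒜) (p := fun i r => ∀ (l p p' : ℤ) (z : SepAlgebra k A),
    z ∈ sepPart 𝒜 0 l → p = i + l + j → p' = i + l + 1 → q (diff hA (cycIns 𝒜 p (j - 1) c z r)) =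
      sgn k (l * (i + j - 1)) • q (z * ins 𝒜 (j - 1) c r) -
      sgn k ((i + l) * j) • q (cyc 𝒜 (p + 1) (z * c) r) +
      sgn k ((i + l) * j) • q (cyc 𝒜 p' z r * c) -
      sgn k (i + j - 1) • q (cycIns 𝒜 (p + 1) (j - 1) c (diff hA z) r) -
      sgn k (j - 1) • q (cycIns 𝒜 (p + 1) (j - 1) c z (diff hA r)) +
      q (cycIns 𝒜 (p + 1) j (diff hA c) z r))
    ?_ ?_ ?_ ?_ ?_ ?_ hr l p p' z hz hp hp'
  · intro i l p p' z hz hp hp'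
    simp
  · intro i r s hr hs l p p' z hz hp hp'
    simp only [map_add, mul_add, add_mul, smul_add, hr l p p' z hz hp hp', hs l p p' z hz hp hp']
    abel
  · intro i c r hr l p p' z hz hp hp'
    simp only [map_smul, hr l p p' z hz hp hp', mul_smul_comm, smul_mul_assoc]
    module
  · intro i a ha l p p' z hz hp hp'
    simp
  · intro l p p' z hz hp hp'
    have h1 := cycIns_of (𝒜 := 𝒜) (p + 1) (j - 1) c z (1 : A)
    rw [map_one] at h1
    have h2 : ∀ p, ∀ {l : ℤ} {c : SepAlgebra k A}, c ∈ sepPart 𝒜 0 l →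
        sign 𝒜 p (sep k A * (c * sep k A)) = sgn k (p * (-1 + (l + -1))) • (sep k A * (c * sep k A)) :=
      fun p l c hc => sign_apply p (mul_mem sep_mem (mul_mem hc sep_mem))
    rw [cycIns_sep, cycIns_sep, cycIns_sep, diff_sep, h1, h2 _ hc.mem, h2 _ (diff_mem_zero hA hc.mem), h2 _ hc.mem,
      cyc_sep, cyc_sep, ins_sep]
    simp only [mul_smul_comm, map_smul, diff_sep_mul hA, diff_mul hA hz, diff_mul hA hc.mem,
        diff_sep, hp, hp']
    simp only [map_smul, map_sub, map_add, mul_add, mul_sub, mul_one, map_zero, mul_smul_comm,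
        smul_mul_assoc, smul_add, smul_sub, smul_smul, mul_assoc]
    by_cases hl : Even l <;> by_cases hj : Even j <;> simp only [sgn_eq_ite, Int.even_add,
        Int.even_sub, Int.even_mul, even_neg, Int.not_even_one, even_two, Even.zero, hl, hj,
        iff_true, iff_false, true_iff, false_iff, not_true_eq_false, not_false_eq_true, or_true,
        or_false, true_or, false_or, or_self, iff_self, if_true, if_false, ite_true, ite_false,
        one_smul, neg_smul, smul_neg, neg_neg, one_mul, mul_one, neg_mul, mul_neg] <;> abel
  · intro i i' r s hr hs h1 h2 l p p' z hz hp hp'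
    have hsz := mul_mem' hs hz
    have hzr := mul_mem' hz hr
    have hI := ins_mem (j - 1) hc.mem hr
    have hzI := mul_mem' hz hI
    have hdc := diff_mem_zero hA hc.mem
    simp only [cycIns_mul _ _ _ hc.mem _ hr, cycIns_mul _ _ _ hdc _ hr,
      cycIns_mul _ _ _ hc.mem _ (diff_mem_zero hA hr), diff_mul hA hr, map_add, map_smul,
      cyc_mul _ _ hr, cyc_mul _ _ (diff_mem_zero hA hr), ins_mul _ _ hr,
      h1 _ p p' _ hsz (by rw [hp]; ring) (by rw [hp']; ring),
      h2 _ p p' _ hzr (by rw [hp]; ring) (by rw [hp']; ring),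
      -- The terms with the insertion in r and the cut in s are rotations of s around z times the
      -- insertion into r, so their boundary is already known.
      trace_diff_cyc hA hq hs hzI (show p = i' + (l + (i + (j - 1))) + 1 by rw [hp]; ring), diff_mul hA hs,
      diff_mul hA hz, diff_ins hA hc hr]
    simp only [map_smul, map_sub, map_add, smul_add, smul_sub, smul_smul, LinearMap.add_apply,
        LinearMap.sub_apply,
      LinearMap.smul_apply, mul_assoc, mul_add, mul_sub, add_mul, sub_mul, mul_smul_comm, smul_mul_assoc, hp, hp']
    by_cases hi : Even i <;> by_cases hj : Even j <;> by_cases hl : Even l <;> by_cases hi' : Even i' <;>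
      simp only [sgn_eq_ite, Int.even_add, Int.even_sub, Int.even_mul, even_neg,
          Int.not_even_one, even_two, Even.zero, hi, hj, hl, hi', iff_true, iff_false, true_iff,
          false_iff, not_true_eq_false, not_false_eq_true, or_true, or_false, true_or, false_or,
          or_self, iff_self, if_true, if_false, ite_true, ite_false, one_smul, neg_smul, smul_neg,
          neg_neg, one_mul, mul_one, neg_mul, mul_neg] <;> abel

end CycIns

end SepAlgebra

end OpenFrobenius

namespace OpenFrobenius

namespace SepAlgebra

variable {k A : Type*} [CommRing k] [Ring A] [Algebra k A] {𝒜 : ℤ → Submodule k A}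
  [GradedAlgebra 𝒜]

/-! ### The map `x ↦ ∑ ± 1' x 1''` -/

section Conj

variable (𝒜) in
/-- `(b ⊗ c) ↦ (x ↦ (-1)^{i|b|} b x c)`. -/
def conj (i : ℤ) : A ⊗[k] A →ₗ[k] SepAlgebra k A →ₗ[k] SepAlgebra k A :=
  (sandwich (sign 𝒜 i).toLinearMap).flip ∘ₗ
    TensorProduct.map (of k A).toLinearMap (of k A).toLinearMap

theorem conj_tmul (i : ℤ) {j : ℤ} {b : A} (hb : b ∈ 𝒜 j) (c : A) (x : SepAlgebra k A) :
    conj 𝒜 i (b ⊗ₜ c) x = sgn k (i * j) • (of k A b * (x * of k A c)) := by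
  simp [conj, sign_apply i (of_mem hb)]

variable {d : A →ₗ[k] A} {ε : A →ₐ[k] k} (hA : IsAugmentedCDGA 𝒜 d ε) {m : ℤ}
  {δ : A →ₗ[k] A ⊗[k] A} (hδ : IsSymmetricOpenFrobenius 𝒜 d m δ)

include hA in
-- This is graded commutativity of A. It allows elements of A to be pulled out of ∑ ± 1' x 1''.
theorem isCentralizing_of {i : ℤ} {a : A} (ha : a ∈ 𝒜 i) : IsCentralizing 𝒜 i (of k A a) where
  mem := of_mem ha
  comm j b hb := by
    rw [← map_mul, ← map_mul, ← map_smul, hA.mul_comm i j a b ha hb, mul_comm i j]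

include hδ in
theorem unit_mem : δ 1 ∈ homogeneousPart (tensorComponents (components 𝒜) (components 𝒜)) m := by
  simpa using hδ.coprod_mem 0 1 SetLike.GradedOne.one_mem

include hδ in
theorem conj_mem (p : ℤ) {n : ℕ} {i : ℤ} {x : SepAlgebra k A} (hx : x ∈ sepPart 𝒜 n i) :
    conj 𝒜 p (δ 1) x ∈ sepPart 𝒜 n (i + m) := by
  refine map_tensor_mem_of_mem_homogeneousPart 𝒜 (unit_mem hδ) (f := (conj 𝒜 p).flip x) ?_
  intro j b c hb hc
  rw [LinearMap.flip_apply, conj_tmul p hb]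
  exact Submodule.smul_mem _ _ (mem_of_le_of_eq (mul_mem (of_mem hb) (mul_mem hx (of_mem hc)))
    (by omega) (by ring))

theorem conj_lTensor (i : ℤ) (a : A) (w : A ⊗[k] A) (x : SepAlgebra k A) :
    conj 𝒜 i (LinearMap.lTensor A (LinearMap.mulRight k a) w) x = conj 𝒜 i w x * of k A a := by
  induction w with
  | zero => simp
  | tmul b c => simp [conj, mul_assoc]
  | add v w hv hw => simp [hv, hw, add_mul]

theorem conj_rTensor (i : ℤ) {j : ℤ} {a : A} (ha : a ∈ 𝒜 j) (w : A ⊗[k] A) (x : SepAlgebra k A) :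
    conj 𝒜 i (LinearMap.rTensor A (LinearMap.mulLeft k a) w) x =
      sgn k (i * j) • (of k A a * conj 𝒜 i w x) := by
  induction w with
  | zero => simp
  | tmul b c => simp [conj, mul_assoc, sign_apply i (of_mem ha)]
  | add v w hv hw => simp [hv, hw, mul_add]

include hδ in
-- Computing δ a as δ(a · 1) and as δ(1 · a) gives ∑ ± a 1' ⊗ 1'' = ∑ 1' ⊗ 1'' a; now place x
-- between the factors.
theorem isCentralizing_conj {n : ℕ} {i : ℤ} {x : SepAlgebra k A} (hx : x ∈ sepPart 𝒜 n i) :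
    IsCentralizing 𝒜 (i + m) (conj 𝒜 i (δ 1) x) where
  mem := sepPart_antitone (Nat.zero_le n) (conj_mem hδ i hx)
  comm j a ha := by
    have h1 := hδ.coprod_mul_left j a 1 ha
    rw [mul_one, ← one_mul a, hδ.coprod_mul_right 1 a, one_mul] at h1
    rw [← conj_lTensor, h1, map_smul, LinearMap.smul_apply, conj_rTensor i ha, smul_smul]
    exact congrArg (· • _) (by rw [← sgn_add]; congr 1; ring)

include hδ in
-- Since d 1 = 0, compatibility of δ with d shows that δ 1 is a cycle. So in the Leibniz expansion
-- of ∑ ± 1' x 1'' only the terms that differentiate x survive.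
theorem diff_conj {n : ℕ} {i : ℤ} {x : SepAlgebra k A} (hx : x ∈ sepPart 𝒜 n i) :
    diff hA (conj 𝒜 i (δ 1) x) = conj 𝒜 (i + 1) (δ 1) (diff hA x) := by
  have h1 : d 1 = 0 := by
    have := hA.d_mul 0 1 1 SetLike.GradedOne.one_mem
    simpa [sgn_zero] using this
  have h2 := hδ.coprod_d 1
  rw [h1, map_zero] at h2
  have h3 := congrArg (fun w => sgn k m • conj 𝒜 i w x) h2
  simp only [map_zero, LinearMap.zero_apply, smul_zero, map_smul, LinearMap.smul_apply,
      sgn_smul_sgn_smul] at h3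
  suffices h : diff hA (conj 𝒜 i (δ 1) x) = conj 𝒜 (i + 1) (δ 1) (diff hA x) +
      sgn k i • conj 𝒜 i (LinearMap.rTensor A d (δ 1) +
        TensorProduct.map (signBy (components 𝒜) (fun i => i)) d (δ 1)) x by
    rw [h, ← h3, smul_zero, add_zero]
  have key : diff hA ∘ₗ (conj 𝒜 i).flip x = (conj 𝒜 (i + 1)).flip (diff hA x) +
      sgn k i • (conj 𝒜 i).flip x ∘ₗ (LinearMap.rTensor A d +
        TensorProduct.map (signBy (components 𝒜) (fun i => i)) d) := by
    refine tensor_ext_homogeneous 𝒜 fun p q b c hb hc => ?_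
    have hs := signBy_apply (mem_homogeneousPart_components 𝒜 hb) (fun i => i)
    simp only [LinearMap.comp_apply, LinearMap.flip_apply, LinearMap.add_apply,
        LinearMap.smul_apply,
      LinearMap.rTensor_tmul, TensorProduct.map_tmul, map_add, hs, ← TensorProduct.smul_tmul',
      map_smul, conj_tmul _ hb, conj_tmul _ (hA.d_mem p b hb), diff_mul hA (of_mem hb),
      diff_mul hA hx, diff_of]
    simp only [smul_add, mul_add, add_mul, mul_smul_comm, smul_smul]
    by_cases hi : Even i <;> by_cases hp : Even p <;> simp only [sgn_eq_ite, Int.even_add,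
        Int.even_sub, Int.even_mul, even_neg, Int.not_even_one, even_two, Even.zero, hi, hp,
        iff_true, iff_false, true_iff, false_iff, not_true_eq_false, not_false_eq_true, or_true,
        or_false, true_or, false_or, or_self, iff_self, if_true, if_false, ite_true, ite_false,
        one_smul, neg_smul, smul_neg, neg_neg, one_mul, mul_one, neg_mul, mul_neg] <;> abel
  exact LinearMap.congr_fun key (δ 1)

include hδ in
-- An element that commutes with A can be moved out past 1'. Applied to u = c_x this is the source
-- of strict associativity. The degrees i and j enter only through signs, hence only modulo 2.
theorem conj_mul_left {p : ℤ} {u : SepAlgebra k A} (hu : IsCentralizing 𝒜 p u) {i j : ℤ}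
    (hj : Even (i + p - j)) (x : SepAlgebra k A) :
    conj 𝒜 j (δ 1) (u * x) = u * conj 𝒜 i (δ 1) x := by
  refine map_tensor_of_mem_homogeneousPart 𝒜 (unit_mem hδ) (f := (conj 𝒜 j).flip (u * x))
    (g := LinearMap.mulLeft k u ∘ₗ (conj 𝒜 i).flip x) ?_
  intro q b c hb hc
  simp only [LinearMap.comp_apply, LinearMap.flip_apply, conj_tmul _ hb, LinearMap.mulLeft_apply,
    mul_smul_comm, ← mul_assoc, hu.comm q b hb, smul_mul_assoc, smul_smul, ← sgn_add]
  exact congrArg (· • _) (sgn_congr (by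
    have : j * q - (i * q + q * p) = -(i + p - j) * q := by ring
    rw [this]; exact hj.neg.mul_right q))

include hδ in
theorem conj_mul_right {p : ℤ} {u : SepAlgebra k A} (hu : IsCentralizing 𝒜 p u) {i j : ℤ}
    (hj : Even (i + p - j)) (x : SepAlgebra k A) :
    conj 𝒜 j (δ 1) (x * u) = sgn k (m * p) • (conj 𝒜 i (δ 1) x * u) := by
  refine map_tensor_of_mem_homogeneousPart 𝒜 (unit_mem hδ) (f := (conj 𝒜 j).flip (x * u))
    (g := sgn k (m * p) • (LinearMap.mulRight k u ∘ₗ (conj 𝒜 i).flip x)) ?_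
  intro q b c hb hc
  simp only [LinearMap.comp_apply, LinearMap.flip_apply, conj_tmul _ hb, LinearMap.mulRight_apply,
    LinearMap.smul_apply, mul_smul_comm, mul_assoc, hu.comm _ c hc, smul_mul_assoc, smul_smul]
  simp only [← sgn_add]
  refine congrArg (· • _) (sgn_congr ?_)
  have : j * q + (m - q) * p - (m * p + i * q) = -(i + p - j) * q := by ring
  rw [this]; exact hj.neg.mul_right q

/-- Insertion is linear over A on both sides, up to sign. -/
theorem ins_conj (p i : ℤ) (c x : SepAlgebra k A) (w : A ⊗[k] A) :
    ins 𝒜 p c (conj 𝒜 i w x) = conj 𝒜 (i + p) w (ins 𝒜 p c x) := by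
  suffices h : ins 𝒜 p c ∘ₗ (conj 𝒜 i).flip x = (conj 𝒜 (i + p)).flip (ins 𝒜 p c x) from
    LinearMap.congr_fun h w
  refine tensor_ext_homogeneous 𝒜 fun q l b c hb hc => ?_
  simp only [LinearMap.comp_apply, LinearMap.flip_apply, conj_tmul _ hb, map_smul,
    ins_mul _ _ (of_mem hb), ins_mul', ins_of, zero_mul, mul_zero, add_zero, zero_add, smul_smul,
    ← sgn_add]
  exact congrArg (fun n => sgn k n • _) (by ring)

variable {M : Type*} [AddCommGroup M] [Module k M] {q : SepAlgebra k A →ₗ[k] M}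
  (hq : IsRelTrace 𝒜 q)

include hδ hq in
-- Exchange 1' and 1'' by the symmetry of δ 1, obtaining r 1'' x 1'; then rotate the last factor, an
-- element of A, to the front, obtaining 1' r 1'' x. This is the only symmetry available, since the
-- trace is not invariant under rotation of separators.
theorem trace_mul_conj {i j : ℤ} {r x : SepAlgebra k A} (hr : r ∈ sepPart 𝒜 0 j)
    (hx : x ∈ sepPart 𝒜 0 i) :
    q (r * conj 𝒜 i (δ 1) x) = sgn k (m * (i + 1)) • q (conj 𝒜 j (δ 1) r * x) := by
  have h1 : q (r * conj 𝒜 i (δ 1) x) = (q ∘ₗ LinearMap.mulLeft k r ∘ₗ (conj 𝒜 i).flip x ∘ₗ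
      (sgn k m • koszulFlip (components 𝒜) (components 𝒜))) (δ 1) := by
    conv_lhs => rw [hδ.symm]
    simp
  have h2 : sgn k (m * (i + 1)) • q (conj 𝒜 j (δ 1) r * x) = (sgn k (m * (i + 1)) •
      (q ∘ₗ LinearMap.mulRight k x ∘ₗ (conj 𝒜 j).flip r)) (δ 1) := by
    simp
  rw [h1, h2]
  refine map_tensor_of_mem_homogeneousPart 𝒜 (unit_mem hδ) ?_
  intro l b c hb hc
  have h3 : koszulFlip (components 𝒜) (components 𝒜) (b ⊗ₜ c) = sgn k (l * (m - l)) • (c ⊗ₜ b) := by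
    rw [koszulFlip, LinearMap.comp_apply, tensorSign_apply (mem_homogeneousPart_components 𝒜 hb)
      (mem_homogeneousPart_components 𝒜 hc)]
    simp
  have h4 := hq l _ b _ hb (mul_mem' hr (mul_mem' (of_mem hc) hx))
  simp only [LinearMap.comp_apply, LinearMap.flip_apply, LinearMap.smul_apply,
      LinearMap.mulLeft_apply,
    LinearMap.mulRight_apply, conj_tmul _ hb, h3, map_smul, conj_tmul _ hc, mul_smul_comm,
    smul_mul_assoc, mul_assoc] at h4 ⊢
  rw [h4]
  simp only [smul_smul]
  by_cases hi : Even i <;> by_cases hj : Even j <;> by_cases hl : Even l <;> by_cases hm : Even m <;>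
    simp only [sgn_eq_ite, Int.even_add, Int.even_sub, Int.even_mul, even_neg,
        Int.not_even_one, even_two, Even.zero, hi, hj, hl, hm, iff_true, iff_false, true_iff,
        false_iff, not_true_eq_false, not_false_eq_true, or_true, or_false, true_or, false_or,
        or_self, iff_self, if_true, if_false, ite_true, ite_false, one_smul, neg_smul, smul_neg,
        neg_neg, one_mul, mul_one, neg_mul, mul_neg]

end Conj

end SepAlgebra

end OpenFrobenius

namespace OpenFrobenius

/-! ### Words of homogeneous letters -/

section Words

variable {k A : Type*} [CommRing k] [Ring A] [Algebra k A] {𝒜 : ℤ → Submodule k A}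
  [GradedAlgebra 𝒜] {d : A →ₗ[k] A} {ε : A →ₐ[k] k}

variable (𝒜) in
/-- The letters of `L` are homogeneous of the degrees listed in `e`. -/
abbrev HasDegrees (L : List (Bar ε)) (e : List ℤ) : Prop :=
  List.Forall₂ (fun (v : Bar ε) (i : ℤ) => (v : A) ∈ 𝒜 i) L e

/-- The degree of a word whose letters have the degrees listed in `e`. -/
abbrev wordDegree (e : List ℤ) : ℤ := (e.map (· - 1)).sum

theorem word_cons (v : Bar ε) (L : List (Bar ε)) :
    word ε (v :: L) = TensorAlgebra.ι k v * word ε L := by simp [word]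

theorem word_append (L L' : List (Bar ε)) : word ε (L ++ L') = word ε L * word ε L' := by
  simp [word]

theorem word_nil : word ε [] = 1 := rfl

theorem barProj_one : barProj ε (1 : A) = 0 := by
  ext; change (1 : A) - algebraMap k A (ε 1) = 0; simp

theorem coe_barProj (a : A) : (barProj ε a : A) = a - algebraMap k A (ε a) := rfl

theorem letter_one : letter ε (1 : A) = 0 := by
  simp [letter, barProj_one]

theorem letter_eq_ι (a : A) : letter ε a = TensorAlgebra.ι k (barProj ε a) := rfl

/-- The correction by ε(a) · 1 is nonzero only in degree 0, where the unit lives. -/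
theorem barProj_mem (hA : IsAugmentedCDGA 𝒜 d ε) {i : ℤ} {a : A} (ha : a ∈ 𝒜 i) :
    (barProj ε a : A) ∈ 𝒜 i := by
  rw [coe_barProj]
  by_cases hi : i = 0
  · subst hi
    exact sub_mem ha (SetLike.algebraMap_mem_graded 𝒜 _)
  · rw [hA.aug_eq_zero i a ha hi, map_zero, sub_zero]; exact ha

theorem span_words (hA : IsAugmentedCDGA 𝒜 d ε) :
    Submodule.span k {w : Words ε | ∃ L e, HasDegrees 𝒜 L e ∧ w = word ε L} = ⊤ := by
  set S := Submodule.span k {w : Words ε | ∃ L e, HasDegrees 𝒜 L e ∧ w = word ε L} with hS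
  have hmul : ∀ w ∈ S, ∀ w' ∈ S, w * w' ∈ S := fun w hw w' hw' => by
    have := Submodule.mul_mem_mul hw hw'
    rw [hS, Submodule.span_mul_span] at this
    refine Submodule.span_mono ?_ this
    rintro _ ⟨_, ⟨L, e, h, rfl⟩, _, ⟨L', e', h', rfl⟩, rfl⟩
    exact ⟨L ++ L', e ++ e', List.rel_append h h', (word_append L L').symm⟩
  have h1 : (1 : Words ε) ∈ S := Submodule.subset_span ⟨[], [], List.Forall₂.nil, rfl⟩
  have hl : ∀ a : A, letter ε a ∈ S := by
    have key : S.mkQ ∘ₗ letter ε = 0 := linearMap_ext_homogeneous 𝒜 fun i a ha => by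
      simp only [LinearMap.comp_apply, Submodule.mkQ_apply, LinearMap.zero_apply,
        Submodule.Quotient.mk_eq_zero]
      exact Submodule.subset_span ⟨[barProj ε a], [i], List.Forall₂.cons (barProj_mem hA ha) .nil,
        by simp [word, letter]⟩
    intro a
    simpa using LinearMap.congr_fun key a
  rw [eq_top_iff]
  rintro w -
  induction w using TensorAlgebra.induction with
  | algebraMap c => rw [Algebra.algebraMap_eq_smul_one]; exact S.smul_mem c h1
  | ι v => rw [← letter_coe]; exact hl v
  | mul a b ha hb => exact hmul a ha b hb
  | add a b ha hb => exact add_mem ha hb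

theorem words_ext (hA : IsAugmentedCDGA 𝒜 d ε) {M : Type*} [AddCommGroup M] [Module k M]
    {f g : Words ε →ₗ[k] M} (h : ∀ L e, HasDegrees 𝒜 L e → f (word ε L) = g (word ε L)) : f = g := by
  refine LinearMap.ext_on (span_words hA) ?_
  rintro _ ⟨L, e, hL, rfl⟩
  exact h L e hL

theorem chains_ext (hA : IsAugmentedCDGA 𝒜 d ε) {M : Type*} [AddCommGroup M] [Module k M]
    {f g : Chains ε →ₗ[k] M} (h : ∀ i a L e, a ∈ 𝒜 i → HasDegrees 𝒜 L e →
      f (a ⊗ₜ word ε L) = g (a ⊗ₜ word ε L)) : f = g := by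
  apply TensorProduct.ext
  refine linearMap_ext_homogeneous 𝒜 fun i a ha => words_ext hA fun L e hL => ?_
  exact h i a L e ha hL

theorem chain_mem {i : ℤ} {a : A} {L : List (Bar ε)} {e : List ℤ} (ha : a ∈ 𝒜 i)
    (hL : HasDegrees 𝒜 L e) :
    a ⊗ₜ word ε L ∈ homogeneousPart (chainComponents 𝒜 ε) (i + wordDegree e) :=
  tmul_mem_homogeneousPart (mem_homogeneousPart_components 𝒜 ha) (word_mem 𝒜 ε hL)

end Words

namespace SepAlgebra

variable {k A : Type*} [CommRing k] [Ring A] [Algebra k A] {𝒜 : ℤ → Submodule k A}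
  [GradedAlgebra 𝒜] {d : A →ₗ[k] A} {ε : A →ₐ[k] k}

/-! ### Normal forms in the algebra with a separator -/

section NormalForm

variable (ε) in
/-- `[a₁, …, aₙ] ↦ t a₁ ⋯ t aₙ`. -/
def ofWord : Words ε →ₐ[k] SepAlgebra k A :=
  TensorAlgebra.lift k (LinearMap.mulLeft k (sep k A) ∘ₗ (of k A).toLinearMap ∘ₗ (Bar ε).subtype)

@[simp]
theorem ofWord_ι (v : Bar ε) : ofWord ε (TensorAlgebra.ι k v) = sep k A * of k A v := by
  simp [ofWord]

theorem ofWord_mem {L : List (Bar ε)} {e : List ℤ} (hL : HasDegrees 𝒜 L e) :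
    ofWord ε (word ε L) ∈ sepPart 𝒜 L.length (wordDegree e) := by
  induction hL with
  | nil => simpa [word_nil, wordDegree] using one_mem (𝒜 := 𝒜)
  | cons h _ ih =>
    rw [word_cons, map_mul, ofWord_ι]
    refine mem_of_le_of_eq (mul_mem (mul_mem (sep_mem (𝒜 := 𝒜)) (of_mem h)) ih) ?_ ?_
    · simp
    · simp only [wordDegree, List.map_cons, List.sum_cons]; ring

/-- Each letter brings a separator on its left, and t² = 0, so only the empty word survives. -/
theorem sep_mul_ofWord (w : Words ε) :
    sep k A * ofWord ε w = TensorAlgebra.algebraMapInv w • sep k A := by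
  induction w using TensorAlgebra.induction with
  | algebraMap c => simp [Algebra.algebraMap_eq_smul_one]
  | ι v => simp [sep_mul_sep_mul, TensorAlgebra.algebraMapInv]
  | mul a b ha hb => rw [map_mul, ← mul_assoc, ha, smul_mul_assoc, hb, map_mul, mul_smul]
  | add a b ha hb => rw [map_add, mul_add, ha, hb, map_add, add_smul]

theorem sep_mul_ofWord_mul_sep (w : Words ε) (r : SepAlgebra k A) :
    sep k A * (ofWord ε w * (sep k A * r)) = 0 := by
  rw [← mul_assoc, sep_mul_ofWord, smul_mul_assoc, sep_mul_sep_mul, smul_zero]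

/-- Replacing a by its image in Ā changes the product by a multiple of t w t r, which is zero. This
is the normalization of chains, and it needs a separator on both sides. -/
theorem sep_mul_of_mul_ofWord (a : A) (w : Words ε) (r : SepAlgebra k A) :
    sep k A * (of k A a * (ofWord ε w * (sep k A * r))) =
      ofWord ε (letter ε a * w) * (sep k A * r) := by
  rw [letter_eq_ι, map_mul, ofWord_ι, coe_barProj, map_sub, AlgHom.commutes, mul_sub, sub_mul,
    ← Algebra.commutes, ← Algebra.smul_def, sub_mul, smul_mul_assoc, smul_mul_assoc,
    mul_assoc (sep k A) (ofWord ε w), sep_mul_ofWord_mul_sep, smul_zero, sub_zero]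
  simp only [mul_assoc]

/-- The span of the normal forms of degree `j` with at least `n` separators. -/
def normalSpan (𝒜 : ℤ → Submodule k A) (ε : A →ₐ[k] k) (n : ℕ) (j : ℤ) :
    Submodule k (SepAlgebra k A) :=
  Submodule.span k ({r | n = 0 ∧ ∃ a ∈ 𝒜 j, r = of k A a} ∪
    {r | ∃ (i l : ℤ) (a b : A) (L : List (Bar ε)) (e : List ℤ), a ∈ 𝒜 i ∧ b ∈ 𝒜 l ∧
      HasDegrees 𝒜 L e ∧ n ≤ L.length + 1 ∧ i + wordDegree e - 1 + l = j ∧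
      r = of k A a * (ofWord ε (word ε L) * (sep k A * of k A b))})

theorem normalSpan_antitone {n n' : ℕ} (hn : n' ≤ n) {j : ℤ} {r : SepAlgebra k A}
    (hr : r ∈ normalSpan 𝒜 ε n j) : r ∈ normalSpan 𝒜 ε n' j := by
  refine Submodule.span_mono (Set.union_subset_union ?_ ?_) hr
  · rintro _ ⟨h, h'⟩
    exact ⟨by omega, h'⟩
  · rintro _ ⟨i, l, a, b, L, e, ha, hb, hL, h, h'⟩
    exact ⟨i, l, a, b, L, e, ha, hb, hL, by omega, h'⟩

theorem of_mul_mem_normalSpan {n : ℕ} {i j : ℤ} {a : A} (ha : a ∈ 𝒜 i) {r : SepAlgebra k A}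
    (hr : r ∈ normalSpan 𝒜 ε n j) : of k A a * r ∈ normalSpan 𝒜 ε n (i + j) := by
  induction hr using Submodule.span_induction with
  | mem r hr =>
    refine Submodule.subset_span ?_
    rcases hr with ⟨h, b, hb, rfl⟩ | ⟨i', l, b, c, L, e, hb, hc, hL, h, h', rfl⟩
    · exact Or.inl ⟨h, a * b, SetLike.mul_mem_graded ha hb, by simp⟩
    · exact Or.inr ⟨i + i', l, a * b, c, L, e, SetLike.mul_mem_graded ha hb, hc, hL, h, by omega,
        by simp [mul_assoc]⟩
  | zero => simp
  | add r s _ _ hr hs => rw [mul_add]; exact add_mem hr hs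
  | smul c r _ hr => rw [mul_smul_comm]; exact Submodule.smul_mem _ _ hr

theorem sep_mul_mem_normalSpan (hA : IsAugmentedCDGA 𝒜 d ε) {n : ℕ} {j : ℤ} {r : SepAlgebra k A}
    (hr : r ∈ normalSpan 𝒜 ε n j) : sep k A * r ∈ normalSpan 𝒜 ε (n + 1) (-1 + j) := by
  induction hr using Submodule.span_induction with
  | mem r hr =>
    refine Submodule.subset_span (Or.inr ?_)
    rcases hr with ⟨h, b, hb, rfl⟩ | ⟨i', l, b, c, L, e, hb, hc, hL, h, h', rfl⟩
    · exact ⟨0, j, 1, b, [], [], SetLike.GradedOne.one_mem, hb, List.Forall₂.nil, by simp [h],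
        by simp [wordDegree], by simp [word_nil]⟩
    · refine ⟨0, l, 1, c, barProj ε b :: L, i' :: e, SetLike.GradedOne.one_mem, hc,
        List.Forall₂.cons (barProj_mem hA hb) hL, by simp; omega, ?_, ?_⟩
      · simp only [wordDegree, List.map_cons, List.sum_cons] at h' ⊢; omega
      · rw [sep_mul_of_mul_ofWord, map_one, one_mul, word_cons, letter_eq_ι]
  | zero => simp
  | add r s _ _ hr hs => rw [mul_add]; exact add_mem hr hs
  | smul c r _ hr => rw [mul_smul_comm]; exact Submodule.smul_mem _ _ hr

/-- Left multiplication by each generator preserves the span of normal forms, with control of degree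
and separators; apply r to 1. -/
theorem sepPart_le_normalSpan (hA : IsAugmentedCDGA 𝒜 d ε) {n : ℕ} {j : ℤ} {r : SepAlgebra k A}
    (hr : r ∈ sepPart 𝒜 n j) : r ∈ normalSpan 𝒜 ε n j := by
  have key : ∀ (n' : ℕ) (j' : ℤ) (s : SepAlgebra k A), s ∈ normalSpan 𝒜 ε n' j' →
      r * s ∈ normalSpan 𝒜 ε (n + n') (j + j') := by
    induction hr using Submodule.span_induction with
    | mem r hr =>
      induction hr with
      | of ha => intro n' j' s hs; rw [zero_add]; exact of_mul_mem_normalSpan ha hs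
      | sep => intro n' j' s hs; rw [add_comm 1]; exact sep_mul_mem_normalSpan hA hs
      | mul _ _ h1 h2 =>
        intro n' j' s hs
        rw [mul_assoc, add_assoc, add_assoc]
        exact h1 _ _ _ (h2 _ _ _ hs)
      | weaken hn _ h =>
        intro n' j' s hs
        exact normalSpan_antitone (by omega) (h _ _ _ hs)
    | zero => simp
    | add r s _ _ hr hs =>
      intro n' j' x hx
      rw [add_mul]; exact add_mem (hr _ _ _ hx) (hs _ _ _ hx)
    | smul c r _ hr =>
      intro n' j' x hx
      rw [smul_mul_assoc]; exact Submodule.smul_mem _ _ (hr _ _ _ hx)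
  have h1 : (1 : SepAlgebra k A) ∈ normalSpan 𝒜 ε 0 0 :=
    Submodule.subset_span (Or.inl ⟨rfl, 1, SetLike.GradedOne.one_mem, by simp⟩)
  simpa using key 0 0 1 h1

/-- Linear conditions on homogeneous elements can be checked on normal forms. -/
theorem normal_induction (hA : IsAugmentedCDGA 𝒜 d ε) {n : ℕ} {p : ℤ → SepAlgebra k A → Prop}
    (zero : ∀ i, p i 0) (add : ∀ i r s, p i r → p i s → p i (r + s))
    (smul : ∀ i (c : k) r, p i r → p i (c • r)) (of : n = 0 → ∀ i a, a ∈ 𝒜 i → p i (of k A a))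
    (monomial : ∀ i l a b (L : List (Bar ε)) e, a ∈ 𝒜 i → b ∈ 𝒜 l → HasDegrees 𝒜 L e →
      n ≤ L.length + 1 → p (i + wordDegree e - 1 + l)
        (SepAlgebra.of k A a * (ofWord ε (word ε L) * (sep k A * SepAlgebra.of k A b))))
    {i : ℤ} {r : SepAlgebra k A} (hr : r ∈ sepPart 𝒜 n i) : p i r := by
  have := sepPart_le_normalSpan hA hr
  clear hr
  induction this using Submodule.span_induction with
  | mem r hr =>
    rcases hr with ⟨h, b, hb, rfl⟩ | ⟨i', l, b, c, L, e, hb, hc, hL, h, h', rfl⟩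
    · exact of h _ _ hb
    · rw [← h']; exact monomial _ _ _ _ _ _ hb hc hL h
  | zero => exact zero _
  | add r s _ _ hr hs => exact add _ _ _ hr hs
  | smul c r _ hr => exact smul _ _ _ hr

variable (ε) in
/-- `a[a₁, …, aₙ] ↦ a t a₁ ⋯ t aₙ t`. -/
def ofChain : Chains ε →ₗ[k] SepAlgebra k A :=
  LinearMap.mul' k _ ∘ₗ TensorProduct.map (of k A).toLinearMap
    (LinearMap.mulRight k (sep k A) ∘ₗ (ofWord ε).toLinearMap)

@[simp]
theorem ofChain_tmul (a : A) (w : Words ε) :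
    ofChain ε (a ⊗ₜ w) = of k A a * (ofWord ε w * sep k A) := by
  simp [ofChain]

theorem ofChain_mem' {i : ℤ} {a : A} (ha : a ∈ 𝒜 i) {L : List (Bar ε)} {e : List ℤ}
    (hL : HasDegrees 𝒜 L e) : ofChain ε (a ⊗ₜ word ε L) ∈ sepPart 𝒜 (L.length + 1) (i + wordDegree e - 1) := by
  rw [ofChain_tmul]
  exact mem_of_le_of_eq (mul_mem (of_mem ha) (mul_mem (ofWord_mem hL) (sep_mem (𝒜 := 𝒜))))
    (by omega) (by omega)

/-- Conditions that are linear and invariant under graded cyclic rotation of elements of `A` can be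
checked on the images of chains. -/
theorem cyclic_induction (hA : IsAugmentedCDGA 𝒜 d ε) {n : ℕ} {p : ℤ → SepAlgebra k A → Prop}
    (zero : ∀ i, p i 0) (add : ∀ i r s, p i r → p i s → p i (r + s))
    (smul : ∀ i (c : k) r, p i r → p i (c • r)) (of : n = 0 → ∀ i a, a ∈ 𝒜 i → p i (of k A a))
    (rotate : ∀ i j r b, r ∈ sepPart 𝒜 1 i → b ∈ 𝒜 j → p (j + i) (SepAlgebra.of k A b * r) →
      p (i + j) (r * SepAlgebra.of k A b))
    (chain : ∀ i a (L : List (Bar ε)) e, a ∈ 𝒜 i → HasDegrees 𝒜 L e →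
      n ≤ L.length + 1 → p (i + wordDegree e - 1) (ofChain ε (a ⊗ₜ word ε L)))
    {i : ℤ} {r : SepAlgebra k A} (hr : r ∈ sepPart 𝒜 n i) : p i r := by
  refine normal_induction hA zero add smul of ?_ hr
  intro i l a b L e ha hb hL hn
  -- A normal form a w t b is a rotation of (b a) w t, which encodes a chain.
  have h1 := rotate _ _ _ b (sepPart_antitone (by omega) (ofChain_mem' ha hL)) hb ?_
  · simpa [mul_assoc] using h1
  · have := chain (l + i) (b * a) L e (SetLike.mul_mem_graded hb ha) hL hn
    simpa [mul_assoc, add_assoc, add_sub_assoc] using this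

/-! ### The trace onto the Hochschild chains -/

section Trace

variable (ε) in
/-- `a ⊗ (w ⊗ b) ↦ [a] w ⊗ b`. -/
def absorb : A ⊗[k] (Words ε ⊗[k] A) →ₗ[k] Words ε ⊗[k] A :=
  LinearMap.rTensor A (LinearMap.mul' k (Words ε) ∘ₗ LinearMap.rTensor (Words ε) (letter ε)) ∘ₗ
    (TensorProduct.assoc k A (Words ε) A).symm.toLinearMap

@[simp]
theorem absorb_tmul (a b : A) (w : Words ε) :
    absorb ε (a ⊗ₜ (w ⊗ₜ b)) = (letter ε a * w) ⊗ₜ b := by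
  simp [absorb]

theorem absorb_one (x : Words ε ⊗[k] A) : absorb ε (1 ⊗ₜ x) = 0 := by
  induction x with
  | zero => simp
  | tmul w b => simp [letter_one]
  | add x y hx hy => simp [TensorProduct.tmul_add, hx, hy]

variable (ε) in
/-- The action of the separator on normal forms. -/
def sepAction : Module.End k (A × (A ⊗[k] (Words ε ⊗[k] A))) :=
  LinearMap.inr k A _ ∘ₗ TensorProduct.mk k A (Words ε ⊗[k] A) 1 ∘ₗ
    (TensorProduct.mk k (Words ε) A 1).coprod (absorb ε)

theorem sepAction_apply (x : A × (A ⊗[k] (Words ε ⊗[k] A))) :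
    sepAction ε x = (0, 1 ⊗ₜ (1 ⊗ₜ x.1 + absorb ε x.2)) := by
  simp [sepAction]

variable (ε) in
/-- The action of the algebra on normal forms. -/
def normalAction : SepAlgebra k A →ₐ[k] Module.End k (A × (A ⊗[k] (Words ε ⊗[k] A))) :=
  lift (Algebra.lsmul k k (A × (A ⊗[k] (Words ε ⊗[k] A)))) (sepAction ε) (by
    -- A tensor a ⊗ (w ⊗ b) stands for a w t b. After one action of the separator the head is 1, and
    -- a second action would create the letter [1] = 0.
    refine LinearMap.ext fun x => ?_
    simp [sepAction_apply, absorb_one])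

theorem normalAction_of (a : A) (x : A × (A ⊗[k] (Words ε ⊗[k] A))) :
    normalAction ε (of k A a) x = (a * x.1, LinearMap.rTensor _ (LinearMap.mulLeft k a) x.2) := by
  have h : ∀ y : A ⊗[k] (Words ε ⊗[k] A), a • y = LinearMap.rTensor _ (LinearMap.mulLeft k a) y :=
    fun y => by
      induction y with
      | zero => simp
      | tmul b y => simp [TensorProduct.smul_tmul']
      | add x y hx hy => simp [hx, hy]
  ext
  · simp [normalAction]
  · simp [normalAction, h]

theorem normalAction_sep (x : A × (A ⊗[k] (Words ε ⊗[k] A))) :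
    normalAction ε (sep k A) x = (0, 1 ⊗ₜ (1 ⊗ₜ x.1 + absorb ε x.2)) := by
  simp [normalAction, sepAction_apply]

/-- Acting on the vector that represents 1 reproduces the normal form. Hence normal forms are unique
and the trace can be read off from them. -/
theorem normalAction_ofWord (L : List (Bar ε)) (b : A) :
    normalAction ε (ofWord ε (word ε L) * (sep k A * of k A b)) (1, 0) =
      (0, 1 ⊗ₜ (word ε L ⊗ₜ b)) := by
  induction L with
  | nil => simp [word_nil, normalAction_of, normalAction_sep]
  | cons v L ih =>
    rw [word_cons, map_mul (ofWord ε), ofWord_ι, mul_assoc, mul_assoc, map_mul _ (sep k A),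
      map_mul _ (of k A v), Module.End.mul_apply, Module.End.mul_apply, ih]
    simp [normalAction_of, normalAction_sep, letter_coe]

variable (𝒜 ε) in
/-- `a ⊗ (w ⊗ b) ↦ (-1)^{|b|(|a| + |w| - 1)} b a ⊗ w`. -/
def rotateTail : A ⊗[k] (Words ε ⊗[k] A) →ₗ[k] Chains ε :=
  LinearMap.rTensor (Words ε) (LinearMap.mul' k A) ∘ₗ
    (TensorProduct.assoc k A A (Words ε)).symm.toLinearMap ∘ₗ
    (TensorProduct.comm k (Chains ε) A).toLinearMap ∘ₗ
    tensorSign (chainComponents 𝒜 ε) (components 𝒜) (fun i j => j * (i - 1)) ∘ₗ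
    (TensorProduct.assoc k A (Words ε) A).symm.toLinearMap

theorem rotateTail_tmul {i j : ℤ} {a b : A} (ha : a ∈ 𝒜 i) (hb : b ∈ 𝒜 j) {L : List (Bar ε)}
    {e : List ℤ} (hL : HasDegrees 𝒜 L e) : rotateTail 𝒜 ε (a ⊗ₜ (word ε L ⊗ₜ b)) =
      sgn k (j * (i + wordDegree e - 1)) • ((b * a) ⊗ₜ word ε L) := by
  simp [rotateTail, tensorSign_apply (chain_mem ha hL) (mem_homogeneousPart_components 𝒜 hb)]

variable (𝒜 ε) in
/-- The trace `a t a₁ ⋯ t aₙ t b ↦ ± (b a)[a₁, …, aₙ]`, which vanishes on `A`. -/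
def trace : SepAlgebra k A →ₗ[k] Chains ε :=
  rotateTail 𝒜 ε ∘ₗ LinearMap.snd k _ _ ∘ₗ LinearMap.applyₗ ((1, 0) : A × (A ⊗[k] (Words ε ⊗[k] A))) ∘ₗ
    (normalAction ε).toLinearMap

theorem trace_of (a : A) : trace 𝒜 ε (of k A a) = 0 := by
  simp [trace, normalAction_of]

theorem trace_monomial {i j : ℤ} {a b : A} (ha : a ∈ 𝒜 i) (hb : b ∈ 𝒜 j) {L : List (Bar ε)}
    {e : List ℤ} (hL : HasDegrees 𝒜 L e) :
    trace 𝒜 ε (of k A a * (ofWord ε (word ε L) * (sep k A * of k A b))) =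
      sgn k (j * (i + wordDegree e - 1)) • ((b * a) ⊗ₜ word ε L) := by
  rw [← rotateTail_tmul ha hb hL]
  simp only [trace, LinearMap.comp_apply, AlgHom.toLinearMap_apply, LinearMap.applyₗ_apply_apply]
  rw [map_mul, Module.End.mul_apply, normalAction_ofWord, normalAction_of]
  simp

theorem trace_ofChain (hA : IsAugmentedCDGA 𝒜 d ε) (x : Chains ε) : trace 𝒜 ε (ofChain ε x) = x := by
  suffices h : trace 𝒜 ε ∘ₗ ofChain ε = LinearMap.id from LinearMap.congr_fun h x
  refine chains_ext hA fun i a L e ha hL => ?_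
  have := trace_monomial ha (SetLike.GradedOne.one_mem (A := 𝒜)) hL
  simpa [sgn_zero] using this

/-- For a normal form a w t c, multiplication by b on either side leads to the head c b a, as c (b
a) or as (c b) a; only the signs remain. -/
theorem isRelTrace_trace (hA : IsAugmentedCDGA 𝒜 d ε) : IsRelTrace 𝒜 (trace 𝒜 ε) := by
  intro i j b r hb hr
  refine normal_induction hA (n := 0) (p := fun j r => trace 𝒜 ε (of k A b * r) =
    sgn k (i * j) • trace 𝒜 ε (r * of k A b)) ?_ ?_ ?_ ?_ ?_ hr
  · simp
  · intro j r s hr hs; simp [mul_add, add_mul, hr, hs]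
  · intro j c r hr; simp [hr, smul_comm c]
  · intro _ j a ha; rw [← map_mul, ← map_mul, trace_of, trace_of, smul_zero]
  · intro j l a c L e ha hc hL _
    rw [← mul_assoc (of k A b), ← map_mul, trace_monomial (SetLike.mul_mem_graded hb ha) hc hL]
    simp only [mul_assoc]
    rw [← map_mul, trace_monomial ha (SetLike.mul_mem_graded hc hb) hL, smul_smul, ← sgn_add,
      mul_assoc]
    congr 1
    generalize wordDegree e = p
    by_cases hi : Even i <;> by_cases hj : Even j <;> by_cases hl : Even l <;> by_cases hp : Even p <;>
      simp only [sgn_eq_ite, Int.even_add, Int.even_sub, Int.even_mul, even_neg,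
          Int.not_even_one, even_two, Even.zero, hi, hj, hl, hp, iff_true, iff_false, true_iff,
          false_iff, not_true_eq_false, not_false_eq_true, or_true, or_false, true_or, false_or,
          or_self, iff_self, if_true, if_false, ite_true, ite_false, one_smul, neg_smul, smul_neg,
          neg_neg, one_mul, mul_one, neg_mul, mul_neg]

theorem trace_mem {n : ℕ} {i : ℤ} {r : SepAlgebra k A} (hA : IsAugmentedCDGA 𝒜 d ε)
    (hr : r ∈ sepPart 𝒜 n i) : trace 𝒜 ε r ∈ homogeneousPart (chainComponents 𝒜 ε) (i + 1) := by
  refine normal_induction hA (p := fun i r => trace 𝒜 ε r ∈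
    homogeneousPart (chainComponents 𝒜 ε) (i + 1)) ?_ ?_ ?_ ?_ ?_ hr
  · simp
  · intro j r s hr hs; rw [map_add]; exact add_mem hr hs
  · intro j c r hr; rw [map_smul]; exact Submodule.smul_mem _ _ hr
  · intro _ j a ha; rw [trace_of]; exact zero_mem _
  · intro j l a c L e ha hc hL _
    rw [trace_monomial ha hc hL]
    refine Submodule.smul_mem _ _ ?_
    convert chain_mem (SetLike.mul_mem_graded hc ha) hL using 2
    ring

/-- A normal form with n letters has n + 1 separators, so two separators force a letter. -/
theorem trace_mem_relChains {i : ℤ} {r : SepAlgebra k A} (hA : IsAugmentedCDGA 𝒜 d ε)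
    (hr : r ∈ sepPart 𝒜 2 i) : trace 𝒜 ε r ∈ relChains ε := by
  refine normal_induction hA (p := fun i r => trace 𝒜 ε r ∈ relChains ε) ?_ ?_ ?_ ?_ ?_ hr
  · simp
  · intro j r s hr hs; rw [map_add]; exact add_mem hr hs
  · intro j c r hr; rw [map_smul]; exact Submodule.smul_mem _ _ hr
  · intro _ j a ha; rw [trace_of]; exact zero_mem _
  · intro j l a c L e ha hc hL h
    rw [trace_monomial ha hc hL]
    refine Submodule.smul_mem _ _ ?_
    match L with
    | [] => simp at h
    | v :: L => rw [word_cons]; exact Submodule.subset_span ⟨_, _, _, rfl⟩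

end Trace

end NormalForm

end SepAlgebra

end OpenFrobenius

namespace OpenFrobenius

variable {k A : Type*} [CommRing k] [Ring A] [Algebra k A] {𝒜 : ℤ → Submodule k A}
  [GradedAlgebra 𝒜] {d : A →ₗ[k] A} {ε : A →ₐ[k] k}

/-! ### The grading of the chains -/

section ChainGrading

theorem map_mem_of_chains (hA : IsAugmentedCDGA 𝒜 d ε) {M : Type*} [AddCommGroup M] [Module k M]
    {S : Submodule k M} {f : Chains ε →ₗ[k] M}
    (h : ∀ i a L e, a ∈ 𝒜 i → HasDegrees 𝒜 L e → f (a ⊗ₜ word ε L) ∈ S) (x : Chains ε) :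
    f x ∈ S := by
  have key : S.mkQ ∘ₗ f = 0 := chains_ext hA fun i a L e ha hL => by
    simpa using h i a L e ha hL
  simpa using LinearMap.congr_fun key x

theorem map_mem_of_relChains (hA : IsAugmentedCDGA 𝒜 d ε) {M : Type*} [AddCommGroup M] [Module k M]
    {S : Submodule k M} {f : Chains ε →ₗ[k] M}
    (h : ∀ i a v L e, a ∈ 𝒜 i → HasDegrees 𝒜 (v :: L) e → f (a ⊗ₜ word ε (v :: L)) ∈ S)
    {x : Chains ε} (hx : x ∈ relChains ε) : f x ∈ S := by
  -- The first letter is written as the image of b in Ā. The condition is linear in b, which may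
  -- thus be taken homogeneous in A.
  have key : ∀ b : A, (S.mkQ ∘ₗ f) ∘ₗ
      LinearMap.lTensor A (LinearMap.mulLeft k (letter ε b)) = 0 := by
    intro b
    suffices h : (LinearMap.llcomp k (Chains ε) (Chains ε) (M ⧸ S) (S.mkQ ∘ₗ f)) ∘ₗ
        (LinearMap.lTensorHom A) ∘ₗ LinearMap.mul k (Words ε) ∘ₗ letter ε = 0 from
      LinearMap.congr_fun h b
    refine linearMap_ext_homogeneous 𝒜 fun j b hb => chains_ext hA fun i a L e ha hL => ?_
    simpa [letter_eq_ι, word_cons] using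
      h i a (barProj ε b) L (j :: e) ha (List.Forall₂.cons (barProj_mem hA hb) hL)
  induction hx using Submodule.span_induction with
  | mem x hx =>
    obtain ⟨a, v, u, rfl⟩ := hx
    simpa [letter_coe] using LinearMap.congr_fun (key v) (a ⊗ₜ u)
  | zero => simp
  | add x y _ _ hx hy => rw [map_add]; exact add_mem hx hy
  | smul c x _ hx => rw [map_smul]; exact S.smul_mem c hx

theorem word_cons_mem_relChains (a : A) (v : Bar ε) (L : List (Bar ε)) :
    a ⊗ₜ word ε (v :: L) ∈ relChains ε := by
  rw [word_cons]; exact Submodule.subset_span ⟨_, _, _, rfl⟩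

variable (𝒜 ε) in
/-- The homogeneous component of degree `i`. -/
def component (i : ℤ) : Chains ε →ₗ[k] Chains ε := Finsupp.lapply i ∘ₗ chainComponents 𝒜 ε

theorem component_of_mem {i : ℤ} {x : Chains ε} (hx : x ∈ homogeneousPart (chainComponents 𝒜 ε) i)
    (j : ℤ) : component 𝒜 ε j x = if i = j then x else 0 := by
  simp [component, mem_homogeneousPart.1 hx, Finsupp.single_apply]

theorem component_self {i : ℤ} {x : Chains ε} (hx : x ∈ homogeneousPart (chainComponents 𝒜 ε) i) :
    component 𝒜 ε i x = x := by
  simp [component_of_mem hx]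

theorem component_mem (hA : IsAugmentedCDGA 𝒜 d ε) (i : ℤ) (x : Chains ε) :
    component 𝒜 ε i x ∈ homogeneousPart (chainComponents 𝒜 ε) i := by
  refine map_mem_of_chains hA (fun j a L e ha hL => ?_) x
  have := chain_mem ha hL
  rw [component_of_mem this]
  split_ifs with h
  · rwa [← h]
  · exact zero_mem _

theorem component_mem_relChains (hA : IsAugmentedCDGA 𝒜 d ε) (i : ℤ) {x : Chains ε}
    (hx : x ∈ relChains ε) : component 𝒜 ε i x ∈ relChains ε := by
  refine map_mem_of_relChains hA (fun j a v L e ha hL => ?_) hx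
  rw [component_of_mem (chain_mem ha hL)]
  split_ifs with h
  · exact word_cons_mem_relChains _ _ _
  · exact zero_mem _

theorem sum_chainComponents (hA : IsAugmentedCDGA 𝒜 d ε) (x : Chains ε) :
    (chainComponents 𝒜 ε x).sum (fun _ y => y) = x := by
  have : Finsupp.lsum k (fun _ => LinearMap.id) ∘ₗ chainComponents 𝒜 ε = LinearMap.id :=
    chains_ext hA fun i a L e ha hL => by
      simp [mem_homogeneousPart.1 (chain_mem ha hL)]
  exact LinearMap.congr_fun this x

theorem sum_component (hA : IsAugmentedCDGA 𝒜 d ε) (x : Chains ε) :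
    ∑ i ∈ (chainComponents 𝒜 ε x).support, component 𝒜 ε i x = x :=
  sum_chainComponents hA x

/-- Linear conditions on relative chains can be checked on homogeneous ones. -/
theorem relChains_induction (hA : IsAugmentedCDGA 𝒜 d ε) {p : Chains ε → Prop} (zero : p 0)
    (add : ∀ x y, p x → p y → p (x + y))
    (mem : ∀ i, ∀ x ∈ relChains ε ⊓ homogeneousPart (chainComponents 𝒜 ε) i, p x)
    {x : Chains ε} (hx : x ∈ relChains ε) : p x := by
  rw [← sum_component hA x]
  exact Finset.sum_induction _ p add zero
    fun i _ => mem i _ ⟨component_mem_relChains hA i hx, component_mem hA i x⟩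

theorem chains_induction (hA : IsAugmentedCDGA 𝒜 d ε) {p : Chains ε → Prop} (zero : p 0)
    (add : ∀ x y, p x → p y → p (x + y))
    (mem : ∀ i, ∀ x ∈ homogeneousPart (chainComponents 𝒜 ε) i, p x) (x : Chains ε) : p x := by
  rw [← sum_component hA x]
  exact Finset.sum_induction _ p add zero fun i _ => mem i _ (component_mem hA i x)

variable {M : Type*} [AddCommGroup M] [Module k M]

variable (𝒜 ε) in
/-- The linear map that is given by `f i` in degree `i`. -/
def byDegree : (ℤ → Chains ε →ₗ[k] M) →ₗ[k] Chains ε →ₗ[k] M :=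
  LinearMap.lcomp k M (chainComponents 𝒜 ε) ∘ₗ (Finsupp.lsum k).toLinearMap

theorem byDegree_apply {i : ℤ} {x : Chains ε} (hx : x ∈ homogeneousPart (chainComponents 𝒜 ε) i)
    (f : ℤ → Chains ε →ₗ[k] M) : byDegree 𝒜 ε f x = f i x := by
  simp [byDegree, mem_homogeneousPart.1 hx]

end ChainGrading

namespace SepAlgebra

/-! ### The encoding as a section of the trace -/

section Section

theorem ofChain_mem (hA : IsAugmentedCDGA 𝒜 d ε) {i : ℤ} {x : Chains ε}
    (hx : x ∈ homogeneousPart (chainComponents 𝒜 ε) i) : ofChain ε x ∈ sepPart 𝒜 1 (i - 1) := by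
  rw [← component_self hx]
  refine map_mem_of_chains (f := ofChain ε ∘ₗ component 𝒜 ε i) hA (fun j a L e ha hL => ?_) x
  rw [LinearMap.comp_apply, component_of_mem (chain_mem ha hL)]
  split_ifs with h
  · rw [← h]; exact sepPart_antitone (by omega) (ofChain_mem' ha hL)
  · simp

theorem ofChain_mem_of_relChains (hA : IsAugmentedCDGA 𝒜 d ε) {i : ℤ} {x : Chains ε}
    (hx : x ∈ relChains ε ⊓ homogeneousPart (chainComponents 𝒜 ε) i) :
    ofChain ε x ∈ sepPart 𝒜 2 (i - 1) := by
  rw [← component_self hx.2]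
  refine map_mem_of_relChains (f := ofChain ε ∘ₗ component 𝒜 ε i) hA (fun j a v L e ha hL => ?_) hx.1
  rw [LinearMap.comp_apply, component_of_mem (chain_mem ha hL)]
  split_ifs with h
  · rw [← h]; exact sepPart_antitone (by simp) (ofChain_mem' ha hL)
  · simp

/-- A linear map that is invariant under graded cyclic rotation of elements of `A` factors over the
trace. -/
theorem map_ofChain_trace (hA : IsAugmentedCDGA 𝒜 d ε) {M : Type*} [AddCommGroup M] [Module k M]
    {f : ℤ → SepAlgebra k A →ₗ[k] M}
    (hf : ∀ i j r b, r ∈ sepPart 𝒜 1 i → b ∈ 𝒜 j →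
      f (i + j) (r * of k A b) = sgn k (i * j) • f (i + j) (of k A b * r))
    {i : ℤ} {r : SepAlgebra k A} (hr : r ∈ sepPart 𝒜 1 i) :
    f i (ofChain ε (trace 𝒜 ε r)) = f i r := by
  refine cyclic_induction hA (p := fun i r => f i (ofChain ε (trace 𝒜 ε r)) = f i r)
    ?_ ?_ ?_ ?_ ?_ ?_ hr
  · simp
  · intro i r s hr hs; simp [hr, hs]
  · intro i c r hr; simp [hr]
  · intro h; simp at h
  · intro i j r b hr hb h
    have := isRelTrace_trace hA j i b r hb (sepPart_antitone (Nat.zero_le 1) hr)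
    rw [hf i j r b hr hb, add_comm i j, ← h, this, map_smul, map_smul, mul_comm i j,
      sgn_smul_sgn_smul]
  · intro i a L e ha hL _
    rw [trace_ofChain hA]

end Section

end SepAlgebra

end OpenFrobenius

namespace OpenFrobenius

variable {k A : Type*} [CommRing k] [Ring A] [Algebra k A] {𝒜 : ℤ → Submodule k A}
  [GradedAlgebra 𝒜] {d : A →ₗ[k] A} {ε : A →ₐ[k] k}

/-! ### The Hochschild differential as a trace -/

section BarDiff

theorem barLocal_cons_cons_cons (u v w : Bar ε) (L : List (Bar ε))
    {e : List ℤ} (hL : HasDegrees 𝒜 (u :: v :: w :: L) e) :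
    barLocal 𝒜 ε d (word ε (u :: v :: w :: L)) = 0 := by
  have hs : ∀ i, unletter ε (signBy (wordComponents 𝒜 ε) (fun j => j)
      (word ε ((u :: v :: w :: L).take i))) = sgn k (wordDegree (e.take i)) •
      unletter ε (word ε ((u :: v :: w :: L).take i)) := fun i => by
    have hm : HasDegrees 𝒜 ((u :: v :: w :: L).take i) (e.take i) := List.forall₂_take i hL
    rw [signBy_apply (word_mem 𝒜 ε hm), map_smul]
  simp only [barLocal, LinearMap.sub_apply, LinearMap.comp_apply, deconc_word, map_sum,
    TensorProduct.map_tmul, hs]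
  rw [unletter_word ε (L := u :: v :: w :: L) (by simp), map_zero, map_zero, sub_zero]
  refine Finset.sum_eq_zero fun i hi => ?_
  -- A product of two letters needs a one-letter word on both sides of the split, and here a
  -- one-letter left half leaves at least two letters on the right.
  by_cases h : i = 1
  · subst h
    rw [unletter_word ε (L := (u :: v :: w :: L).drop 1) (by simp)]
    simp
  · rw [unletter_word ε (L := (u :: v :: w :: L).take i)]
    · simp
    · simp at hi ⊢; omega

theorem barDiff_one : barDiff 𝒜 ε d 1 = 0 := by
  simp [barDiff, deconc_one, barLocal_one]

/-- The part of the differential of words that concerns a prefix. -/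
def prefixDiff (𝒜 : ℤ → Submodule k A) [GradedAlgebra 𝒜] (ε : A →ₐ[k] k) (d : A →ₗ[k] A) :
    Words ε →ₗ[k] Words ε :=
  LinearMap.mul' k (Words ε) ∘ₗ LinearMap.rTensor (Words ε) (barLocal 𝒜 ε d) ∘ₗ deconc ε

theorem prefixDiff_singleton (v : Bar ε) :
    prefixDiff 𝒜 ε d (word ε [v]) = - letter ε (d v) := by
  rw [prefixDiff, LinearMap.comp_apply, LinearMap.comp_apply, deconc_word]
  simp [Finset.sum_range_succ, word_nil, barLocal_one, word_cons, barLocal_ι]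

theorem prefixDiff_cons_cons {i : ℤ} (v w : Bar ε) (L : List (Bar ε))
    {e : List ℤ} (hL : HasDegrees 𝒜 (v :: w :: L) (i :: e)) :
    prefixDiff 𝒜 ε d (word ε (v :: w :: L)) = - (letter ε (d v) * word ε (w :: L)) +
      sgn k (i - 1) • (letter ε (v * w) * word ε L) := by
  obtain ⟨hv, hL'⟩ := List.forall₂_cons.1 hL
  simp only [prefixDiff, LinearMap.comp_apply, deconc_word, map_sum, LinearMap.rTensor_tmul,
    LinearMap.mul'_apply, List.length_cons]
  -- The prefixes of length 0, 1 and 2 are split off; longer ones contribute nothing.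
  rw [Finset.sum_range_succ', Finset.sum_range_succ', Finset.sum_range_succ', Finset.sum_eq_zero]
  · simp [word_nil, barLocal_one, word_cons, barLocal_ι, barLocal_ι_mul_ι 𝒜 ε d v w hv]
    abel
  · intro r hr
    match L with
    | [] => simp at hr
    | u :: L =>
      have := List.forall₂_take (r + 1 + 1 + 1) hL
      simp only [List.take_succ_cons] at this ⊢
      rw [barLocal_cons_cons_cons _ _ _ _ this, zero_mul]

/-- Either the differential acts on a prefix, or the first letter is skipped at the cost of its
sign. This recursion matches the Leibniz rule in the algebra with a separator. -/
theorem barDiff_cons {i : ℤ} (v : Bar ε) (L : List (Bar ε))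
    {e : List ℤ} (hL : HasDegrees 𝒜 (v :: L) (i :: e)) :
    barDiff 𝒜 ε d (word ε (v :: L)) = prefixDiff 𝒜 ε d (word ε (v :: L)) +
      sgn k (i - 1) • (TensorAlgebra.ι k v * barDiff 𝒜 ε d (word ε L)) := by
  obtain ⟨hv, hL'⟩ := List.forall₂_cons.1 hL
  have hs : ∀ r, signBy (wordComponents 𝒜 ε) (fun j => j) (word ε ((v :: L).take r)) =
      sgn k (wordDegree ((i :: e).take r)) • word ε ((v :: L).take r) := fun r =>
    signBy_apply (word_mem 𝒜 ε (List.forall₂_take r hL)) _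
  have hs' : ∀ r, signBy (wordComponents 𝒜 ε) (fun j => j) (word ε (L.take r)) =
      sgn k (wordDegree (e.take r)) • word ε (L.take r) := fun r =>
    signBy_apply (word_mem 𝒜 ε (List.forall₂_take r hL')) _
  have key : ∀ u x, concat3 ε (u ⊗ₜ LinearMap.rTensor (Words ε) (barLocal 𝒜 ε d) x) =
      u * LinearMap.mul' k (Words ε) (LinearMap.rTensor (Words ε) (barLocal 𝒜 ε d) x) := fun u x => by
    simp [concat3]
  have hb : ∀ L e, HasDegrees 𝒜 L e → barDiff 𝒜 ε d (word ε L) = ∑ r ∈ Finset.range (L.length + 1),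
      sgn k (wordDegree (e.take r)) • (word ε (L.take r) * prefixDiff 𝒜 ε d (word ε (L.drop r))) := by
    intro L e hL
    have hs : ∀ r, signBy (wordComponents 𝒜 ε) (fun j => j) (word ε (L.take r)) =
        sgn k (wordDegree (e.take r)) • word ε (L.take r) := fun r =>
      signBy_apply (word_mem 𝒜 ε (List.forall₂_take r hL)) _
    conv_lhs => simp only [barDiff, LinearMap.comp_apply]
    rw [deconc_word, map_sum, map_sum, map_sum]
    refine Finset.sum_congr rfl fun r _ => ?_
    rw [LinearMap.lTensor_tmul, TensorProduct.map_tmul, hs, key, smul_mul_assoc]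
    rfl
  rw [hb _ _ hL, hb _ _ hL', List.length_cons, Finset.sum_range_succ', add_comm]
  congr 1
  · simp [word_nil, sgn_zero, wordDegree]
  · rw [Finset.mul_sum, Finset.smul_sum]
    refine Finset.sum_congr rfl fun r _ => ?_
    simp only [List.take_succ_cons, List.drop_succ_cons, word_cons, mul_smul_comm, smul_smul,
        mul_assoc,
      List.map_cons, List.sum_cons, sgn_add, wordDegree]

end BarDiff

namespace SepAlgebra

theorem sgn_smul_congr {M : Type*} [AddCommGroup M] [Module k M] {a b : ℤ} (h : Even (a - b)) (x : M) :
    sgn k a • x = sgn k b • x := by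
  rw [sgn_congr h]

theorem sgn_sub_one (i : ℤ) : sgn k (i - 1) = - sgn k i := by
  rw [sgn_congr (b := i + 1) (⟨-1, by ring⟩), sgn_add, sgn_one, mul_neg_one]

theorem ofWord_letter_mul (a : A) (w : Words ε) (r : SepAlgebra k A) :
    ofWord ε (letter ε a * w) * (sep k A * r) =
      sep k A * (of k A a * (ofWord ε w * (sep k A * r))) :=
  (sep_mul_of_mul_ofWord a w r).symm

/-- The product of the first letter and the remaining word. -/
def headSplit : List (Bar ε) → SepAlgebra k A
  | [] => 0
  | v :: L => of k A v * ofWord ε (word ε L) * sep k A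

/-- Deleting an inner separator merges two letters as in the bar differential, and deleting the
first one exposes the first letter, which prepares the first face. The closing separator on the
right ensures that the new letters d aᵢ and aᵢaᵢ₊₁ are projected to Ā. -/
theorem diff_ofWord (hA : IsAugmentedCDGA 𝒜 d ε) (L : List (Bar ε)) {e : List ℤ} (hL : HasDegrees 𝒜 L e) :
    diff hA (ofWord ε (word ε L)) * sep k A =
      headSplit L + ofWord ε (barDiff 𝒜 ε d (word ε L)) * sep k A := by
  induction hL with
  | nil => simp [word_nil, diff_one, headSplit, barDiff_one]
  | @cons v i L e hv hL ih =>
    have h1 : diff hA (ofWord ε (word ε (v :: L))) * sep k A =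
        of k A v * (ofWord ε (word ε L) * sep k A) -
          sep k A * (of k A (d v) * (ofWord ε (word ε L) * (sep k A * 1))) -
          sgn k i • (sep k A * (of k A v * (diff hA (ofWord ε (word ε L)) * sep k A))) := by
      rw [word_cons, map_mul, ofWord_ι, mul_assoc, diff_sep_mul, diff_mul hA (of_mem hv), diff_of]
      simp only [sub_mul, mul_add, add_mul, mul_smul_comm, smul_mul_assoc, mul_assoc, mul_one]
      abel
    have h2 : sep k A * (of k A v * (ofWord ε (barDiff 𝒜 ε d (word ε L)) * sep k A)) =
        ofWord ε (TensorAlgebra.ι k v * barDiff 𝒜 ε d (word ε L)) * sep k A := by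
      rw [map_mul, ofWord_ι]; simp only [mul_assoc]
    rw [h1, ih, mul_add, mul_add, h2, ← ofWord_letter_mul,
      barDiff_cons v L (List.Forall₂.cons hv hL), headSplit, map_add, map_smul, add_mul, smul_mul_assoc,
      sgn_sub_one, neg_smul, mul_one]
    match L, hL with
    | [], _ =>
      rw [prefixDiff_singleton]
      simp [word_nil, barDiff_one, headSplit]
      abel
    | w :: L, hL =>
      rw [prefixDiff_cons_cons v w L (List.Forall₂.cons hv hL)]
      have h3 := ofWord_letter_mul ((v : A) * w) (word ε L) 1
      rw [mul_one, map_mul (of k A)] at h3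
      simp only [map_add, map_smul, map_neg, add_mul, neg_mul, smul_mul_assoc, h3, headSplit,
          mul_assoc]
      rw [sgn_sub_one, neg_smul, smul_add]
      abel

/-- Deleting the first separator of a₀ t a₁ ⋯ t aₙ t multiplies a₀ by a₁. Deleting the last one
leaves aₙ at the end, and the trace rotates it to the front, giving the last face. Without letters
the only deletion lands in A, which the trace kills, so there are no external faces. -/
theorem hochschildD_trace_ofChain (hA : IsAugmentedCDGA 𝒜 d ε) {i : ℤ} {a : A} {L : List (Bar ε)}
    {e : List ℤ} (ha : a ∈ 𝒜 i) (hL : HasDegrees 𝒜 L e) :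
    hochschildD 𝒜 ε d (a ⊗ₜ word ε L) = trace 𝒜 ε (diff hA (ofChain ε (a ⊗ₜ word ε L))) := by
  have hq := isRelTrace_trace hA
  have h1 : diff hA (ofChain ε (a ⊗ₜ word ε L)) = ofChain ε (d a ⊗ₜ word ε L) +
      sgn k i • (of k A a * headSplit L + ofChain ε (a ⊗ₜ barDiff 𝒜 ε d (word ε L))) +
      sgn k (i + wordDegree e) • (of k A a * ofWord ε (word ε L)) := by
    simp only [ofChain_tmul]
    rw [diff_mul hA (of_mem ha), diff_mul hA (ofWord_mem hL), diff_ofWord hA L hL, diff_of, diff_sep,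
      mul_one, sgn_add]
    simp only [mul_add, smul_add, mul_smul_comm, smul_smul, add_assoc]
  have h2 : firstFace 𝒜 ε (a ⊗ₜ word ε L) = sgn k i • trace 𝒜 ε (of k A a * headSplit L) := by
    match L, hL with
    | [], _ => simp [headSplit, word_nil, firstFace_nil]
    | v :: L, hL =>
      have := trace_ofChain (𝒜 := 𝒜) hA ((a * v) ⊗ₜ word ε L)
      rw [ofChain_tmul, map_mul (of k A)] at this
      rw [firstFace_cons 𝒜 ε ha, headSplit, ← this]
      simp only [mul_assoc]
  have h3 : lastFace 𝒜 ε (a ⊗ₜ word ε L) =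
      - (sgn k (i + wordDegree e) • trace 𝒜 ε (of k A a * ofWord ε (word ε L))) := by
    rcases List.eq_nil_or_concat L with rfl | ⟨L, v, rfl⟩
    · rw [word_nil, lastFace_nil 𝒜 ε ha, map_one, mul_one, trace_of, smul_zero, neg_zero]
    · rw [List.concat_eq_append] at hL ⊢
      have hl := List.forall₂_take L.length hL
      have hr := List.forall₂_drop L.length hL
      rw [List.take_left] at hl
      rw [List.drop_left, List.forall₂_cons_left_iff] at hr
      obtain ⟨j, e', hv, h, he⟩ := hr
      rw [List.forall₂_nil_left_iff] at h
      rw [← List.take_append_drop L.length e, he, h]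
      generalize e.take L.length = e at hl
      have hX := mul_mem' (of_mem ha) (sepPart_antitone (Nat.zero_le _)
        (mul_mem (ofWord_mem hl) (sep_mem (𝒜 := 𝒜))))
      have := hq j _ v _ hv hX
      rw [lastFace_append 𝒜 ε ha v hv hl, word_append, map_mul (ofWord ε), word_cons, word_nil, mul_one,
        ofWord_ι]
      simp only [mul_assoc] at this ⊢
      rw [← sgn_smul_sgn_smul (k := k) _ (trace 𝒜 ε _), ← this, ← mul_assoc (of k A (v : A)), ← map_mul,
        ← ofChain_tmul, trace_ofChain hA, smul_smul, ← neg_smul, ← neg_one_mul, ← sgn_one, ← sgn_add,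
        ← sgn_add]
      refine sgn_smul_congr ?_ _
      simp only [wordDegree, List.map_append, List.sum_append, List.map_cons, List.map_nil,
        List.sum_cons, List.sum_nil]
      generalize (e.map (· - 1)).sum = p
      by_cases hi : Even i <;> by_cases hj : Even j <;> by_cases hp : Even p <;>
        simp only [sgn_eq_ite, Int.even_add, Int.even_sub, Int.even_mul, even_neg,
            Int.not_even_one, even_two, Even.zero, hi, hj, hp, iff_true, iff_false, true_iff,
            false_iff, not_true_eq_false, not_false_eq_true, or_true, or_false, true_or, false_or,
            or_self, iff_self, if_true, if_false, ite_true, ite_false, one_smul, neg_smul,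
            smul_neg, neg_neg, one_mul, mul_one, neg_mul, mul_neg]
  simp only [hochschildD, LinearMap.add_apply, LinearMap.sub_apply, LinearMap.rTensor_tmul,
    TensorProduct.map_tmul, signBy_apply (mem_homogeneousPart_components 𝒜 ha), h1, map_add, map_smul,
    trace_ofChain hA, h2, h3, ← TensorProduct.smul_tmul', smul_add]
  abel

/-- Both sides are invariant under rotation of an element of A, so encoded chains suffice. -/
theorem hochschildD_trace (hA : IsAugmentedCDGA 𝒜 d ε) (r : SepAlgebra k A) :
    hochschildD 𝒜 ε d (trace 𝒜 ε r) = trace 𝒜 ε (diff hA r) := by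
  have hq := isRelTrace_trace hA
  suffices h : hochschildD 𝒜 ε d ∘ₗ trace 𝒜 ε = trace 𝒜 ε ∘ₗ diff hA from LinearMap.congr_fun h r
  refine linearMap_ext_sepPart (𝒜 := 𝒜) fun i r hr => ?_
  refine cyclic_induction hA (p := fun i r => hochschildD 𝒜 ε d (trace 𝒜 ε r) =
    trace 𝒜 ε (diff hA r)) ?_ ?_ ?_ ?_ ?_ ?_ hr
  · simp
  · intro i r s hr hs; simp [hr, hs]
  · intro i c r hr; simp [hr]
  · intro _ i a ha; simp [trace_of]
  · intro i j r b hr hb h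
    have h0 := sepPart_antitone (Nat.zero_le 1) hr
    have h1 := hq j i b r hb h0
    have h2 := hq j (i + 1) b _ hb (diff_mem_zero hA h0)
    have h3 := hq (j + 1) i (d b) r (hA.d_mem j b hb) h0
    rw [diff_mul hA (of_mem hb), diff_of, map_add, map_smul, h2, h3, h1, map_smul] at h
    rw [← sgn_smul_sgn_smul (k := k) (j * i) (hochschildD _ _ _ _), h, diff_mul hA hr, diff_of, map_add,
      map_smul]
    simp only [smul_add, smul_smul, ← sgn_add]
    rw [add_comm]
    congr 1
    · rw [sgn_smul_congr (b := 0), sgn_zero, one_smul]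
      by_cases hi : Even i <;> by_cases hj : Even j <;> simp only [sgn_eq_ite, Int.even_add,
          Int.even_sub, Int.even_mul, even_neg, Int.not_even_one, even_two, Even.zero, hi, hj,
          iff_true, iff_false, true_iff, false_iff, not_true_eq_false, not_false_eq_true, or_true,
          or_false, true_or, false_or, or_self, iff_self, if_true, if_false, ite_true, ite_false,
          one_smul, neg_smul, smul_neg, neg_neg, one_mul, mul_one, neg_mul, mul_neg]
    · refine sgn_smul_congr ?_ _
      by_cases hi : Even i <;> by_cases hj : Even j <;> simp only [sgn_eq_ite, Int.even_add,
          Int.even_sub, Int.even_mul, even_neg, Int.not_even_one, even_two, Even.zero, hi, hj,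
          iff_true, iff_false, true_iff, false_iff, not_true_eq_false, not_false_eq_true, or_true,
          or_false, true_or, false_or, or_self, iff_self, if_true, if_false, ite_true, ite_false,
          one_smul, neg_smul, smul_neg, neg_neg, one_mul, mul_one, neg_mul, mul_neg]
  · intro i a L e ha hL _
    rw [trace_ofChain hA, hochschildD_trace_ofChain hA ha hL]

end SepAlgebra

end OpenFrobenius

namespace OpenFrobenius

variable {k A : Type*} [CommRing k] [Ring A] [Algebra k A] {𝒜 : ℤ → Submodule k A}
  [GradedAlgebra 𝒜] {d : A →ₗ[k] A} {ε : A →ₐ[k] k}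

namespace SepAlgebra

/-! ### The Connes operator as a trace -/

section Connes

/-- A word with its closing separator has one cut for each position, including the end; cutting
after r letters brings the remaining ones to the front. -/
theorem cyc_ofWord (n : ℤ) {L : List (Bar ε)} {e : List ℤ} (hL : HasDegrees 𝒜 L e)
    (z : SepAlgebra k A) : cyc 𝒜 n z (ofWord ε (word ε L) * sep k A) =
      ∑ r ∈ Finset.range (L.length + 1), sgn k (n * (1 + wordDegree (e.take r))) •
        (ofWord ε (word ε (L.drop r)) * (sep k A * (z * (ofWord ε (word ε (L.take r)) * sep k A)))) := by
  induction hL generalizing z with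
  | nil => simp [word_nil, cyc_sep, wordDegree]
  | @cons v i L e hv hL ih =>
    rw [List.length_cons, Finset.sum_range_succ', word_cons, map_mul (ofWord ε), ofWord_ι, mul_assoc, mul_assoc,
      cyc_mul n z (sep_mem (𝒜 := 𝒜)), cyc_mul n _ (of_mem hv), ih, cyc_of, cyc_sep, zero_add, smul_smul,
      add_comm, Finset.smul_sum]
    congr 1
    · refine Finset.sum_congr rfl fun r _ => ?_
      simp only [List.take_succ_cons, List.drop_succ_cons, word_cons, map_mul, ofWord_ι, smul_smul,
        mul_assoc, List.map_cons, List.sum_cons, ← sgn_add, wordDegree]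
      exact congrArg (fun n => sgn k n • _) (by ring)
    · simp [word_nil, wordDegree, word_cons, mul_assoc]

theorem cyc_rotate {i j : ℤ} {r : SepAlgebra k A} {b : A} 
    (hr : r ∈ sepPart 𝒜 1 i) (hb : b ∈ 𝒜 j) :
    cyc 𝒜 (i + j + 1) 1 (r * of k A b) = sgn k (i * j) • cyc 𝒜 (i + j + 1) 1 (of k A b * r) := by
  rw [cyc_mul _ _ hr, cyc_mul _ _ (of_mem hb), cyc_of, cyc_of, smul_zero, add_zero, zero_add, smul_smul,
    mul_one, one_mul]
  by_cases hi : Even i <;> by_cases hj : Even j <;> simp only [sgn_eq_ite, Int.even_add,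
      Int.even_sub, Int.even_mul, even_neg, Int.not_even_one, even_two, Even.zero, hi, hj,
      iff_true, iff_false, true_iff, false_iff, not_true_eq_false, not_false_eq_true, or_true,
      or_false, true_or, false_or, or_self, iff_self, if_true, if_false, ite_true, ite_false,
      one_smul, neg_smul, smul_neg, neg_neg, one_mul, mul_one, neg_mul, mul_neg]

/-- A rotation around 1 is insensitive to moving an element of A from one end to the other, so
encoded chains suffice. There the head a₀ stands between two separators after the rotation and turns
into a letter. -/
theorem connesB_trace (hA : IsAugmentedCDGA 𝒜 d ε) {i : ℤ} {r : SepAlgebra k A}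
    (hr : r ∈ sepPart 𝒜 0 i) :
    connesB 𝒜 ε (trace 𝒜 ε r) = trace 𝒜 ε (cyc 𝒜 (i + 1) 1 r) := by
  refine cyclic_induction hA (p := fun i r => connesB 𝒜 ε (trace 𝒜 ε r) =
    trace 𝒜 ε (cyc 𝒜 (i + 1) 1 r)) ?_ ?_ ?_ ?_ ?_ ?_ hr
  · simp
  · intro i r s hr hs; simp [hr, hs]
  · intro i c r hr; simp [hr]
  · intro _ i a ha; simp [trace_of]
  · intro i j r b hr hb h
    have := isRelTrace_trace hA j i b r hb (sepPart_antitone (Nat.zero_le 1) hr)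
    rw [cyc_rotate hr hb, map_smul, add_comm i j, ← h, this, map_smul, mul_comm i j,
      sgn_smul_sgn_smul]
  · intro i a L e ha hL _
    rw [trace_ofChain hA, connesB_apply 𝒜 ε ha hL, ofChain_tmul, cyc_mul _ _ (of_mem ha), cyc_of, zero_add,
      cyc_ofWord _ hL, Finset.smul_sum, map_sum]
    refine Finset.sum_congr rfl fun r _ => ?_
    rw [smul_smul, map_smul, ← sgn_add, one_mul]
    have h1 := sep_mul_of_mul_ofWord a (word ε (L.take r)) (1 : SepAlgebra k A)
    rw [mul_one] at h1
    have h2 := trace_ofChain (𝒜 := 𝒜) hA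
      ((1 : A) ⊗ₜ (word ε (L.drop r) * (letter ε a * word ε (L.take r))))
    rw [ofChain_tmul, map_one, one_mul, map_mul (ofWord ε), mul_assoc, ← h1] at h2
    rw [h2, mul_assoc (word ε (L.drop r))]
    have h3 : wordDegree e = wordDegree (e.take r) + wordDegree (e.drop r) := by
      rw [wordDegree, wordDegree, wordDegree, ← List.sum_append, ← List.map_append,
        List.take_append_drop]
    rw [h3]
    refine sgn_smul_congr ?_ _
    change Even ((i + wordDegree (e.take r) - 1) * wordDegree (e.drop r) - _)
    generalize wordDegree (e.take r) = s
    generalize wordDegree (e.drop r) = t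
    by_cases hi : Even i <;> by_cases hj : Even s <;> by_cases hp : Even t <;>
        simp only [sgn_eq_ite, Int.even_add, Int.even_sub, Int.even_mul, even_neg,
            Int.not_even_one, even_two, Even.zero, hi, hj, hp, iff_true, iff_false, true_iff,
            false_iff, not_true_eq_false, not_false_eq_true, or_true, or_false, true_or, false_or,
            or_self, iff_self, if_true, if_false, ite_true, ite_false, one_smul, neg_smul,
            smul_neg, neg_neg, one_mul, mul_one, neg_mul, mul_neg]

end Connes

/-! ### The product as a trace -/

section Product

variable (hA : IsAugmentedCDGA 𝒜 d ε) {m : ℤ} {δ : A →ₗ[k] A ⊗[k] A}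
  (hδ : IsSymmetricOpenFrobenius 𝒜 d m δ)

variable (𝒜 ε) in
/-- `c ⊗ c' ↦ (-1)^{|c| + l|c'|} c ⊗ u [c'] v`. -/
def headSplice (l : ℤ) (u v : Words ε) : A ⊗[k] A →ₗ[k] Chains ε :=
  TensorProduct.map (signHom 𝒜 1).toLinearMap
    (LinearMap.mulLeft k u ∘ₗ LinearMap.mulRight k v ∘ₗ letter ε ∘ₗ (signHom 𝒜 l).toLinearMap)

theorem headSplice_tmul (l : ℤ) (u v : Words ε) {p q : ℤ} {c c' : A} (hc : c ∈ 𝒜 p) (hc' : c' ∈ 𝒜 q) :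
    headSplice 𝒜 ε l u v (c ⊗ₜ c') = sgn k (p + q * l) • (c ⊗ₜ (u * letter ε c' * v)) := by
  simp [headSplice, signHom_apply 𝒜 _ hc, signHom_apply 𝒜 _ hc', sgn_add, smul_smul, mul_comm q,
    ← TensorProduct.smul_tmul', mul_assoc]
  rw [mul_comm]

theorem headSplice_rTensor (l : ℤ) (u v : Words ε) {i : ℤ} {a : A} (ha : a ∈ 𝒜 i) (w : A ⊗[k] A) :
    headSplice 𝒜 ε l u v (LinearMap.rTensor A (LinearMap.mulLeft k a) w) =
      sgn k i • LinearMap.rTensor (Words ε) (LinearMap.mulLeft k a) (headSplice 𝒜 ε l u v w) := by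
  induction w with
  | zero => simp
  | tmul b c => simp [headSplice, signHom_apply 𝒜 _ ha, TensorProduct.smul_tmul']
  | add v w hv hw => simp [hv, hw]

include hδ in
/-- The product in terms of the coproduct of the product of the heads. -/
theorem starMul_eq_headSplice {j l : ℤ} (a : A) {b : A}
    (hb : b ∈ 𝒜 j) {u : Words ε} (hu : u ∈ homogeneousPart (wordComponents 𝒜 ε) l) (v : Words ε) :
    starMul 𝒜 ε δ (a ⊗ₜ u) (b ⊗ₜ v) =
      sgn k ((j + 1) * l) • headSplice 𝒜 ε l u v (δ (a * b)) := by
  obtain ⟨n, c, c', p, q, hc, hc', h⟩ := exists_homogeneous_tensor 𝒜 (δ a)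
  rw [starMul_apply 𝒜 ε δ hu a b v c c' p q hc hc' h, hδ.coprod_mul_right, h, map_sum, map_sum,
    Finset.smul_sum]
  refine Finset.sum_congr rfl fun r _ => ?_
  rw [LinearMap.lTensor_tmul, LinearMap.mulRight_apply,
    headSplice_tmul l u v (hc r) (SetLike.mul_mem_graded (hc' r) hb), smul_smul, ← sgn_add]
  refine sgn_smul_congr ?_ _
  exact ⟨-(j * l), by ring⟩

include hA hδ in
-- Shows that c_x does not depend on the representative r of x: b can be pulled out on either side,
-- and then it commutes with c_x.
theorem conj_rotate {n : ℕ} {i j : ℤ} {r : SepAlgebra k A} {b : A} (hr : r ∈ sepPart 𝒜 n i)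
    (hb : b ∈ 𝒜 j) : conj 𝒜 (i + j) (δ 1) (r * of k A b) =
      sgn k (i * j) • conj 𝒜 (i + j) (δ 1) (of k A b * r) := by
  rw [conj_mul_right hδ (isCentralizing_of hA hb) (i := i) (by simp),
    conj_mul_left hδ (isCentralizing_of hA hb) (i := i) (by simp),
    (isCentralizing_conj hδ hr).comm j b hb, smul_smul, ← sgn_add]
  refine sgn_smul_congr ⟨m * j, by ring⟩ _

include hA hδ in
-- Pulling a out to the left and using δ a = ± a 1' ⊗ 1'' turns the coproduct of 1 into that of the
-- head, as in the explicit formulas.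
theorem conj_of_mul {i l : ℤ} {a : A} (ha : a ∈ 𝒜 i) (x : SepAlgebra k A) :
    conj 𝒜 (i + l) (δ 1) (of k A a * x) = sgn k (i * (m + l)) • conj 𝒜 l (δ a) x := by
  have h := hδ.coprod_mul_left i a 1 ha
  rw [mul_one] at h
  rw [conj_mul_left hδ (isCentralizing_of hA ha) (i := l) (by ring_nf; simp), h, map_smul,
    LinearMap.smul_apply, conj_rTensor l ha, smul_smul, smul_smul, ← sgn_add, ← sgn_add]
  rw [sgn_smul_congr (b := 0), sgn_zero, one_smul]
  exact ⟨i * (m + l), by ring⟩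

include hA hδ in
theorem trace_conj_mul {i j : ℤ} {a b : A} (ha : a ∈ 𝒜 i) (hb : b ∈ 𝒜 j) (l : ℤ) (u v : Words ε) :
    trace 𝒜 ε (conj 𝒜 (l - 1) (δ a) (ofWord ε u * sep k A) * ofChain ε (b ⊗ₜ v)) =
      sgn k ((i + m + j) * l) • headSplice 𝒜 ε l u v (δ (a * b)) := by
  rw [hδ.coprod_mul_right]
  refine map_tensor_of_mem_homogeneousPart 𝒜 (hδ.coprod_mem i a ha)
    (f := trace 𝒜 ε ∘ₗ LinearMap.mulRight k (ofChain ε (b ⊗ₜ v)) ∘ₗ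
      (conj 𝒜 (l - 1)).flip (ofWord ε u * sep k A))
    (g := sgn k ((i + m + j) * l) • headSplice 𝒜 ε l u v ∘ₗ
      LinearMap.lTensor A (LinearMap.mulRight k b)) ?_
  intro p c c' hc hc'
  have h1 := sep_mul_of_mul_ofWord (c' * b) v (1 : SepAlgebra k A)
  have h2 := trace_ofChain (𝒜 := 𝒜) hA (c ⊗ₜ (u * (letter ε (c' * b) * v)))
  rw [mul_one, map_mul (of k A), mul_assoc] at h1
  rw [ofChain_tmul, map_mul (ofWord ε), mul_assoc, ← h1] at h2
  simp only [LinearMap.comp_apply, LinearMap.smul_apply, LinearMap.flip_apply, conj_tmul _ hc,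
    LinearMap.mulRight_apply, LinearMap.lTensor_tmul, ofChain_tmul, map_smul, smul_mul_assoc, mul_assoc,
    h2, headSplice_tmul l u v hc (SetLike.mul_mem_graded hc' hb), smul_smul, ← sgn_add]
  refine sgn_smul_congr ?_ _
  by_cases hi : Even i <;> by_cases hj : Even j <;> by_cases hl : Even l <;> by_cases hm : Even m <;>
    by_cases hp : Even p <;> simp only [sgn_eq_ite, Int.even_add, Int.even_sub, Int.even_mul,
        even_neg, Int.not_even_one, even_two, Even.zero, hi, hj, hl, hm, hp, iff_true, iff_false,
        true_iff, false_iff, not_true_eq_false, not_false_eq_true, or_true, or_false, true_or,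
        false_or, or_self, iff_self, if_true, if_false, ite_true, ite_false, one_smul, neg_smul,
        smul_neg, neg_neg, one_mul, mul_one, neg_mul, mul_neg]

include hA hδ in
-- Both sides are invariant under rotation in r and in s, the latter because c_x commutes with A, so
-- chains suffice. For these, a₀' u t a₀'' b₀ v t encodes a₀'[u, a₀''b₀, v]. The sign is
-- (-1)^{(m-1)|x|}, where |x| = i + 1. Separators are required because the trace vanishes on A while
-- c_x s need not have trace zero when r or s lies in A.
theorem starMul_trace {i j : ℤ} {r s : SepAlgebra k A} (hr : r ∈ sepPart 𝒜 1 i)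
    (hs : s ∈ sepPart 𝒜 1 j) : starMul 𝒜 ε δ (trace 𝒜 ε r) (trace 𝒜 ε s) =
      sgn k ((m - 1) * (i + 1)) • trace 𝒜 ε (conj 𝒜 i (δ 1) r * s) := by
  have hq := isRelTrace_trace hA
  refine cyclic_induction hA (p := fun i r => ∀ j s, s ∈ sepPart 𝒜 1 j →
    starMul 𝒜 ε δ (trace 𝒜 ε r) (trace 𝒜 ε s) =
      sgn k ((m - 1) * (i + 1)) • trace 𝒜 ε (conj 𝒜 i (δ 1) r * s)) ?_ ?_ ?_ ?_ ?_ ?_ hr j s hs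
  · intros; simp
  · intro i r r' hr hr' j s hs; simp [hr j s hs, hr' j s hs, add_mul]
  · intro i c r hr j s hs; simp [hr j s hs, smul_comm c]
  · intro h; simp at h
  · intro i l r b hr hb h j s hs
    have h1 := hq l i b r hb (sepPart_antitone (Nat.zero_le 1) hr)
    rw [conj_rotate hA hδ hr hb, smul_mul_assoc, map_smul, smul_comm, add_comm i l, ← h j s hs, h1,
      map_smul, LinearMap.smul_apply, mul_comm i l, sgn_smul_sgn_smul]
  · intro i a L e ha hL _ j s hs
    have hr0 := ofChain_mem' ha hL
    refine cyclic_induction hA (p := fun j s => 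
      starMul 𝒜 ε δ (trace 𝒜 ε (ofChain ε (a ⊗ₜ word ε L))) (trace 𝒜 ε s) =
      sgn k ((m - 1) * (i + wordDegree e - 1 + 1)) •
        trace 𝒜 ε (conj 𝒜 (i + wordDegree e - 1) (δ 1) (ofChain ε (a ⊗ₜ word ε L)) * s))
        ?_ ?_ ?_ ?_ ?_ ?_ hs
    · intros; simp
    · intro j s s' hs hs'; rw [map_add, map_add, hs, hs', mul_add _ s s', map_add, smul_add]
    · intro j c s hs; rw [map_smul, map_smul, hs, mul_smul_comm, map_smul, smul_comm c]
    · intro h; simp at h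
    · intro j l s b hs hb h
      have h0 := sepPart_antitone (Nat.zero_le 1) hs
      have h1 := hq l j b s hb h0
      have hc := isCentralizing_conj hδ hr0
      have h2 := hq l _ b _ hb (mul_mem' hc.mem h0)
      rw [h1, map_smul, ← mul_assoc, hc.comm l b hb, smul_mul_assoc, map_smul, mul_assoc, h2, smul_smul,
        ← sgn_add] at h
      rw [← sgn_smul_sgn_smul (k := k) (l * j) (starMul _ _ _ _ _), h, ← mul_assoc]
      simp only [smul_smul, ← sgn_add]
      exact sgn_smul_congr ⟨l * j + (i + wordDegree e - 1 + m) * l, by ring⟩ _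
    · intro j b L' e' hb hL' _
      have hu : word ε L ∈ homogeneousPart (wordComponents 𝒜 ε) (wordDegree e) := word_mem 𝒜 ε hL
      rw [trace_ofChain hA, trace_ofChain hA, starMul_eq_headSplice hδ a hb hu,
        ofChain_tmul a, add_sub_assoc, conj_of_mul hA hδ ha, smul_mul_assoc, map_smul,
        trace_conj_mul hA hδ ha hb, smul_smul, smul_smul, ← sgn_add, ← sgn_add]
      refine sgn_smul_congr ?_ _
      generalize wordDegree e = l
      by_cases hi : Even i <;> by_cases hj : Even j <;> by_cases hl : Even l <;>
        by_cases hm : Even m <;> simp only [sgn_eq_ite, Int.even_add, Int.even_sub,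
            Int.even_mul, even_neg, Int.not_even_one, even_two, Even.zero, hi, hj, hl, hm,
            iff_true, iff_false, true_iff, false_iff, not_true_eq_false, not_false_eq_true,
            or_true, or_false, true_or, false_or, or_self, iff_self, if_true, if_false, ite_true,
            ite_false, one_smul, neg_smul, smul_neg, neg_neg, one_mul, mul_one, neg_mul, mul_neg]

end Product

end SepAlgebra

end OpenFrobenius

namespace OpenFrobenius

variable {k A : Type*} [CommRing k] [Ring A] [Algebra k A] {𝒜 : ℤ → Submodule k A}
  [GradedAlgebra 𝒜] {d : A →ₗ[k] A} {ε : A →ₐ[k] k}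

namespace SepAlgebra

/-! ### The homotopy for the commutativity as a trace -/

section Homotopy

theorem ins_ofWord (n : ℤ) (c : SepAlgebra k A) {L : List (Bar ε)} {e : List ℤ} (hL : HasDegrees 𝒜 L e) :
    ins 𝒜 n c (ofWord ε (word ε L) * sep k A) =
      ∑ r ∈ Finset.range (L.length + 1), sgn k (n * wordDegree (e.take r)) •
        (ofWord ε (word ε (L.take r)) * (sep k A * (c * (ofWord ε (word ε (L.drop r)) * sep k A)))) := by
  induction hL with
  | nil => simp [word_nil, sgn_zero, wordDegree]
  | @cons v i L e hv hL ih =>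
    rw [List.length_cons, Finset.sum_range_succ', word_cons, map_mul (ofWord ε), ofWord_ι, mul_assoc,
      mul_assoc, ins_mul n _ (sep_mem (𝒜 := 𝒜)), ins_mul n _ (of_mem hv), ih, ins_of, ins_sep, zero_mul,
      zero_add, add_comm]
    simp only [Finset.smul_sum, Finset.mul_sum]
    congr 1
    · refine Finset.sum_congr rfl fun r _ => ?_
      simp only [List.take_succ_cons, List.drop_succ_cons, word_cons, map_mul, ofWord_ι, smul_smul,
        mul_assoc, List.map_cons, List.sum_cons, ← sgn_add, wordDegree, mul_smul_comm]
      exact congrArg (fun n => sgn k n • _) (by ring)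
    · simp [word_nil, wordDegree, word_cons, mul_assoc, sgn_zero]

variable (hA : IsAugmentedCDGA 𝒜 d ε) {m : ℤ} {δ : A →ₗ[k] A ⊗[k] A}
  (hδ : IsSymmetricOpenFrobenius 𝒜 d m δ)

variable (𝒜) in
/-- `c ⊗ c' ↦ (-1)^{|c| + (|c'| + 1)l} [c] u [c']`. -/
def wrapSplice (l : ℤ) (u : Words ε) : A ⊗[k] A →ₗ[k] Words ε :=
  sgn k l • (LinearMap.mul' k (Words ε) ∘ₗ TensorProduct.map (letter ε ∘ₗ (signHom 𝒜 1).toLinearMap)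
    (LinearMap.mulLeft k u ∘ₗ letter ε ∘ₗ (signHom 𝒜 l).toLinearMap))

theorem wrapSplice_tmul (l : ℤ) (u : Words ε) {p q : ℤ} {c c' : A} (hc : c ∈ 𝒜 p) (hc' : c' ∈ 𝒜 q) :
    wrapSplice 𝒜 l u (c ⊗ₜ c') = sgn k (p + (q + 1) * l) • (letter ε c * u * letter ε c') := by
  simp only [wrapSplice, LinearMap.smul_apply, LinearMap.comp_apply, TensorProduct.map_tmul,
    AlgHom.toLinearMap_apply, signHom_apply 𝒜 _ hc, signHom_apply 𝒜 _ hc', map_smul,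
    LinearMap.mulLeft_apply, LinearMap.mul'_apply, smul_mul_assoc, mul_smul_comm, smul_smul, ← sgn_add,
    mul_assoc]
  exact congrArg (fun n => sgn k n • _) (by ring)

include hδ in
-- Between separators both tensor factors of δ a become letters, enclosing u.
theorem sep_mul_conj {i : ℤ} {a : A} (ha : a ∈ 𝒜 i) (l : ℤ) (u v : Words ε) :
    sep k A * (conj 𝒜 (l - 1) (δ a) (ofWord ε u * sep k A) * (ofWord ε v * sep k A)) =
      sgn k ((i + m + 1) * l) • (ofWord ε (wrapSplice 𝒜 l u (δ a) * v) * sep k A) := by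
  refine map_tensor_of_mem_homogeneousPart 𝒜 (hδ.coprod_mem i a ha)
    (f := LinearMap.mulLeft k (sep k A) ∘ₗ LinearMap.mulRight k (ofWord ε v * sep k A) ∘ₗ
      (conj 𝒜 (l - 1)).flip (ofWord ε u * sep k A))
    (g := sgn k ((i + m + 1) * l) • LinearMap.mulRight k (sep k A) ∘ₗ (ofWord ε).toLinearMap ∘ₗ
      LinearMap.mulRight k v ∘ₗ wrapSplice 𝒜 l u) ?_
  intro p c c' hc hc'
  have h1 := sep_mul_of_mul_ofWord c' v (1 : SepAlgebra k A)
  have h2 := sep_mul_of_mul_ofWord c u (of k A c' * (ofWord ε v * sep k A))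
  rw [mul_one] at h1
  have h3 := h2.trans (congrArg (ofWord ε (letter ε c * u) * ·) h1)
  simp only [map_mul, mul_assoc] at h3
  simp only [LinearMap.comp_apply, LinearMap.smul_apply, LinearMap.flip_apply, conj_tmul _ hc,
    LinearMap.mulRight_apply, LinearMap.mulLeft_apply, map_smul, smul_mul_assoc, mul_smul_comm, mul_assoc,
    h3, wrapSplice_tmul l u hc hc', smul_smul, ← sgn_add, AlgHom.toLinearMap_apply, map_mul]
  refine sgn_smul_congr ?_ _
  by_cases hi : Even i <;> by_cases hl : Even l <;> by_cases hm : Even m <;>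
    by_cases hp : Even p <;> simp only [sgn_eq_ite, Int.even_add, Int.even_sub, Int.even_mul,
        even_neg, Int.not_even_one, even_two, Even.zero, hi, hl, hm, hp, iff_true, iff_false,
        true_iff, false_iff, not_true_eq_false, not_false_eq_true, or_true, or_false, true_or,
        false_or, or_self, iff_self, if_true, if_false, ite_true, ite_false, one_smul, neg_smul,
        smul_neg, neg_neg, one_mul, mul_one, neg_mul, mul_neg]

theorem homotopyT_eq_wrapSplice (δ : A →ₗ[k] A ⊗[k] A) {i j l : ℤ} {a b : A} (ha : a ∈ 𝒜 i) (hb : b ∈ 𝒜 j)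
    {u : Words ε} (hu : u ∈ homogeneousPart (wordComponents 𝒜 ε) l) {L : List (Bar ε)} {e : List ℤ}
    (hL : HasDegrees 𝒜 L e) : homotopyT 𝒜 ε m δ (a ⊗ₜ u) (b ⊗ₜ word ε L) =
      ∑ s ∈ Finset.range (L.length + 1), sgn k ((m + (i + l)) * (j + wordDegree (e.take s))) •
        (b ⊗ₜ (word ε (L.take s) * (wrapSplice 𝒜 l u (δ a) * word ε (L.drop s)))) := by
  obtain ⟨n, c, c', p, q, hc, hc', h⟩ := exists_homogeneous_tensor 𝒜 (δ a)
  rw [homotopyT_apply 𝒜 ε m δ ha hb hu hL c c' p q hc hc' h]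
  refine Finset.sum_congr rfl fun s _ => ?_
  rw [h, map_sum, Finset.sum_mul, Finset.mul_sum, TensorProduct.tmul_sum, Finset.smul_sum]
  refine Finset.sum_congr rfl fun r _ => ?_
  rw [wrapSplice_tmul l u (hc r) (hc' r), smul_mul_assoc, mul_smul_comm, TensorProduct.tmul_smul,
    smul_smul, ← sgn_add]
  simp only [mul_assoc]

include hA hδ in
-- Reduction to chains works as for the product; in s it uses that insertion is linear over A.
-- Inserting c_x at each of the q + 1 separators of b₀ t b₁ ⋯ t b_q t gives the q + 1 summands of T.
theorem homotopyT_trace {i j : ℤ} {r s : SepAlgebra k A} (hr : r ∈ sepPart 𝒜 1 i)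
    (hs : s ∈ sepPart 𝒜 1 j) : homotopyT 𝒜 ε m δ (trace 𝒜 ε r) (trace 𝒜 ε s) =
      sgn k ((m - 1) * (i + 1)) • trace 𝒜 ε (ins 𝒜 (i + m - 1) (conj 𝒜 i (δ 1) r) s) := by
  have hq := isRelTrace_trace hA
  refine cyclic_induction hA (p := fun i r => ∀ j s, s ∈ sepPart 𝒜 1 j →
    homotopyT 𝒜 ε m δ (trace 𝒜 ε r) (trace 𝒜 ε s) =
      sgn k ((m - 1) * (i + 1)) • trace 𝒜 ε (ins 𝒜 (i + m - 1) (conj 𝒜 i (δ 1) r) s))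
      ?_ ?_ ?_ ?_ ?_ ?_ hr j s hs
  · intros; simp
  · intro i r r' hr hr' j s hs; simp [hr j s hs, hr' j s hs]
  · intro i c r hr j s hs; simp [hr j s hs, smul_comm c]
  · intro h; simp at h
  · intro i l r b hr hb h j s hs
    have h1 := hq l i b r hb (sepPart_antitone (Nat.zero_le 1) hr)
    rw [conj_rotate hA hδ hr hb, map_smul, LinearMap.smul_apply, map_smul, smul_comm, add_comm i l,
      ← h j s hs, h1, map_smul, LinearMap.smul_apply, mul_comm i l, sgn_smul_sgn_smul]
  · intro i a L e ha hL _ j s hs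
    refine cyclic_induction hA (p := fun j s => 
      homotopyT 𝒜 ε m δ (trace 𝒜 ε (ofChain ε (a ⊗ₜ word ε L))) (trace 𝒜 ε s) =
      sgn k ((m - 1) * (i + wordDegree e - 1 + 1)) •
        trace 𝒜 ε (ins 𝒜 (i + wordDegree e - 1 + m - 1)
          (conj 𝒜 (i + wordDegree e - 1) (δ 1) (ofChain ε (a ⊗ₜ word ε L))) s))
        ?_ ?_ ?_ ?_ ?_ ?_ hs
    · intros; simp
    · intro j s s' hs hs'; rw [map_add, map_add, hs, hs', map_add, map_add, smul_add]
    · intro j c s hs; rw [map_smul, map_smul, hs, map_smul, map_smul, smul_comm c]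
    · intro h; simp at h
    · intro j l s b hs hb h
      have h0 := sepPart_antitone (Nat.zero_le 1) hs
      have h1 := hq l j b s hb h0
      have hc := isCentralizing_conj hδ (ofChain_mem' ha hL)
      have h2 := hq l _ b _ hb (ins_mem (i + wordDegree e - 1 + m - 1) hc.mem h0)
      rw [h1, map_smul, ins_mul _ _ (of_mem hb), ins_of, zero_mul, zero_add, map_smul, h2] at h
      rw [← sgn_smul_sgn_smul (k := k) (l * j) (homotopyT _ _ _ _ _ _), h, ins_mul _ _ hs, ins_of, mul_zero,
        smul_zero, add_zero]
      simp only [smul_smul, ← sgn_add]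
      exact sgn_smul_congr ⟨l * j + (i + wordDegree e - 1 + m - 1) * l, by ring⟩ _
    · intro j b L' e' hb hL' _
      have hu : word ε L ∈ homogeneousPart (wordComponents 𝒜 ε) (wordDegree e) := word_mem 𝒜 ε hL
      rw [trace_ofChain hA, trace_ofChain hA, homotopyT_eq_wrapSplice δ ha hb hu hL',
        ofChain_tmul a, add_sub_assoc, conj_of_mul hA hδ ha, ofChain_tmul, map_smul, LinearMap.smul_apply,
        ins_mul _ _ (of_mem hb), ins_of, zero_mul, zero_add, ins_ofWord _ _ hL', Finset.mul_sum,
        Finset.smul_sum, map_smul, map_sum, Finset.smul_sum, Finset.smul_sum]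
      refine Finset.sum_congr rfl fun t _ => ?_
      have h3 := trace_ofChain (𝒜 := 𝒜) hA
        (b ⊗ₜ (word ε (L'.take t) * (wrapSplice 𝒜 (wordDegree e) (word ε L) (δ a) * word ε (L'.drop t))))
      rw [ofChain_tmul, map_mul (ofWord ε), mul_assoc] at h3
      rw [sep_mul_conj hδ ha]
      simp only [mul_smul_comm, map_smul, smul_smul, ← sgn_add, h3]
      refine sgn_smul_congr ?_ _
      generalize wordDegree e = l
      generalize wordDegree (e'.take t) = l'
      by_cases hi : Even i <;> by_cases hj : Even j <;> by_cases hl : Even l <;>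
        by_cases hm : Even m <;> by_cases hl' : Even l' <;> simp only [sgn_eq_ite,
            Int.even_add, Int.even_sub, Int.even_mul, even_neg, Int.not_even_one, even_two,
            Even.zero, hi, hj, hl, hm, hl', iff_true, iff_false, true_iff, false_iff,
            not_true_eq_false, not_false_eq_true, or_true, or_false, true_or, false_or, or_self,
            iff_self, if_true, if_false, ite_true, ite_false, one_smul, neg_smul, smul_neg,
            neg_neg, one_mul, mul_one, neg_mul, mul_neg]

end Homotopy

end SepAlgebra

end OpenFrobenius

namespace OpenFrobenius

variable {k A : Type*} [CommRing k] [Ring A] [Algebra k A] {𝒜 : ℤ → Submodule k A}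
  [GradedAlgebra 𝒜] {d : A →ₗ[k] A} {ε : A →ₐ[k] k}

open SepAlgebra

theorem mem_homogeneousPart_of_eq {M : Type*} [AddCommGroup M] [Module k M] {ρ : M →ₗ[k] (ℤ →₀ M)}
    {i j : ℤ} {x : M} (hx : x ∈ homogeneousPart ρ i) (h : i = j) : x ∈ homogeneousPart ρ j := h ▸ hx

/-! ### The Hochschild differential and the Connes operator -/

section Mixed

variable (hA : IsAugmentedCDGA 𝒜 d ε)

theorem exists_trace_eq_of_mem {i : ℤ} {x : Chains ε}
    (hx : x ∈ homogeneousPart (chainComponents 𝒜 ε) i) (hA : IsAugmentedCDGA 𝒜 d ε) :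
    ∃ r ∈ sepPart 𝒜 1 (i - 1), trace 𝒜 ε r = x :=
  ⟨ofChain ε x, ofChain_mem hA hx, trace_ofChain hA x⟩

include hA in
theorem hochschildD_hochschildD (x : Chains ε) :
    hochschildD 𝒜 ε d (hochschildD 𝒜 ε d x) = 0 := by
  rw [← trace_ofChain (𝒜 := 𝒜) hA x, hochschildD_trace hA, hochschildD_trace hA, diff_diff, map_zero]

include hA in
theorem hochschildD_mem {i : ℤ} {x : Chains ε} (hx : x ∈ homogeneousPart (chainComponents 𝒜 ε) i) :
    hochschildD 𝒜 ε d x ∈ homogeneousPart (chainComponents 𝒜 ε) (i + 1) := by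
  obtain ⟨r, hr, rfl⟩ := exists_trace_eq_of_mem hx hA
  rw [hochschildD_trace hA]
  have := trace_mem hA (diff_mem hA hr)
  rwa [sub_add_cancel] at this

include hA in
theorem hochschildD_mem_relChains {x : Chains ε} (hx : x ∈ relChains ε) :
    hochschildD 𝒜 ε d x ∈ relChains ε := by
  refine map_mem_of_relChains hA (fun i a v L e ha hL => ?_) hx
  match L, hL with
  | w :: L, hL =>
    rw [hochschildD_trace_ofChain hA ha hL]
    refine trace_mem_relChains hA (diff_mem hA (sepPart_antitone ?_ (ofChain_mem' ha hL)))
    simp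
  | [], hL =>
    obtain ⟨j, e', hv, h, rfl⟩ := List.forall₂_cons_left_iff.1 hL
    rw [List.forall₂_nil_left_iff] at h
    subst h
    have h1 := firstFace_cons 𝒜 ε ha v []
    have h2 := lastFace_append 𝒜 ε ha v hv List.Forall₂.nil
    have h3 := barDiff_cons (d := d) v [] hL
    rw [List.nil_append, List.map_nil, List.sum_nil, add_zero] at h2
    rw [prefixDiff_singleton, word_nil, barDiff_one, mul_zero, smul_zero, add_zero] at h3
    simp only [hochschildD, LinearMap.sub_apply, LinearMap.add_apply, LinearMap.rTensor_tmul,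
      TensorProduct.map_tmul, h1, h2, h3]
    -- With a single letter the faces a v and v a have no letters left; they cancel because A is
    -- graded commutative.
    rw [hA.mul_comm j i v a hv ha, ← TensorProduct.smul_tmul', smul_smul, ← sgn_add,
      sgn_smul_congr (a := i * (j - 1) + j * i) (b := i), add_sub_cancel_right]
    · refine add_mem (word_cons_mem_relChains _ _ _) ?_
      rw [TensorProduct.tmul_neg, letter_eq_ι]
      exact neg_mem (Submodule.subset_span ⟨_, _, 1, by rw [mul_one]⟩)
    · by_cases hi : Even i <;> by_cases hj : Even j <;> simp only [sgn_eq_ite, Int.even_add,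
        Int.even_sub, Int.even_mul, even_neg, Int.not_even_one, even_two, Even.zero, hi, hj,
        iff_true, iff_false, true_iff, false_iff, not_true_eq_false, not_false_eq_true, or_true,
        or_false, true_or, false_or, or_self, iff_self, if_true, if_false, ite_true, ite_false,
        one_smul, neg_smul, smul_neg, neg_neg, one_mul, mul_one, neg_mul, mul_neg]

include hA in
theorem connesB_mem {i : ℤ} {x : Chains ε} (hx : x ∈ homogeneousPart (chainComponents 𝒜 ε) i) :
    connesB 𝒜 ε x ∈ homogeneousPart (chainComponents 𝒜 ε) (i - 1) := by
  obtain ⟨r, hr, rfl⟩ := exists_trace_eq_of_mem hx hA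
  rw [connesB_trace hA (sepPart_antitone (Nat.zero_le 1) hr)]
  have := trace_mem hA (cyc_mem (i - 1 + 1) (one_mem (𝒜 := 𝒜)) hr)
  exact mem_homogeneousPart_of_eq this (by ring)

include hA in
theorem connesB_mem_relChains' (x : Chains ε) : connesB 𝒜 ε x ∈ relChains ε := by
  refine chains_induction hA (𝒜 := 𝒜) (p := fun x => connesB 𝒜 ε x ∈ relChains ε) ?_ ?_ ?_ x
  · simp
  · intro x y hx hy; rw [map_add]; exact add_mem hx hy
  · intro i x hx
    obtain ⟨r, hr, rfl⟩ := exists_trace_eq_of_mem hx hA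
    rw [connesB_trace hA (sepPart_antitone (Nat.zero_le 1) hr)]
    exact trace_mem_relChains hA (sepPart_antitone (by omega) (cyc_mem (i - 1 + 1) (one_mem (𝒜 := 𝒜)) hr))

include hA in
-- Chains in the image of B have head 1, and a second application makes this head a letter, whose
-- image in Ā is zero.
theorem connesB_connesB (x : Chains ε) : connesB 𝒜 ε (connesB 𝒜 ε x) = 0 := by
  have h : connesB 𝒜 ε ∘ₗ TensorProduct.mk k A (Words ε) 1 = 0 :=
    words_ext hA fun L e hL => by
      simp only [LinearMap.comp_apply, TensorProduct.mk_apply]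
      have h1 : (1 : A) ∈ 𝒜 0 := SetLike.GradedOne.one_mem
      rw [connesB_apply 𝒜 ε h1 hL]
      simp [letter_one]
  exact LinearMap.congr_fun h _

include hA in
-- In the boundary formula for rotations around z = 1 the two extreme terms cancel and dz = 0.
theorem connesB_hochschildD (x : Chains ε) :
    connesB 𝒜 ε (hochschildD 𝒜 ε d x) + hochschildD 𝒜 ε d (connesB 𝒜 ε x) = 0 := by
  refine chains_induction hA (𝒜 := 𝒜) (p := fun x =>
    connesB 𝒜 ε (hochschildD 𝒜 ε d x) + hochschildD 𝒜 ε d (connesB 𝒜 ε x) = 0) ?_ ?_ ?_ x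
  · simp
  · intro x y hx hy
    rw [map_add, map_add, map_add, map_add, add_add_add_comm, hx, hy, add_zero]
  · intro i x hx
    obtain ⟨r, hr, rfl⟩ := exists_trace_eq_of_mem hx hA
    have h0 := sepPart_antitone (Nat.zero_le 1) hr
    rw [hochschildD_trace hA, connesB_trace hA h0, hochschildD_trace hA,
      connesB_trace hA (diff_mem hA hr),
      trace_diff_cyc hA (isRelTrace_trace hA) h0 (one_mem (𝒜 := 𝒜)) (by ring)]
    simp [diff_one, sgn_zero]

end Mixed

/-! ### The shifted complex of relative chains -/

section Shifted

variable (hA : IsAugmentedCDGA 𝒜 d ε) {m : ℤ} {δ : A →ₗ[k] A ⊗[k] A}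
  (hδ : IsSymmetricOpenFrobenius 𝒜 d m δ)

/-- The shifted degree α = i + m is the degree of c_x. The two separators leave one after
differentiation, so that the formulas for products still apply to D x. -/
theorem exists_trace_eq (hA : IsAugmentedCDGA 𝒜 d ε) {α : ℤ} {x : Chains ε} (hx : x ∈ shiftedRelChains 𝒜 ε m α) :
    ∃ i, ∃ r ∈ sepPart 𝒜 2 i, α = i + m ∧ trace 𝒜 ε r = x :=
  ⟨α - m, ofChain ε x, by
    exact mem_of_le_of_eq (ofChain_mem_of_relChains hA hx) le_rfl (by ring), by ring,
    trace_ofChain hA x⟩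

theorem trace_mem_shiftedRelChains (hA : IsAugmentedCDGA 𝒜 d ε) {n : ℕ} {i : ℤ} {r : SepAlgebra k A} (hr : r ∈ sepPart 𝒜 n i) (hn : 2 ≤ n)
    {α : ℤ} (hα : α = i + m) : trace 𝒜 ε r ∈ shiftedRelChains 𝒜 ε m α := by
  refine ⟨trace_mem_relChains hA (sepPart_antitone hn hr), ?_⟩
  exact mem_homogeneousPart_of_eq (trace_mem hA hr) (by rw [hα]; ring)

include hA in
theorem hochschildD_mem_shifted {α : ℤ} {x : Chains ε} (hx : x ∈ shiftedRelChains 𝒜 ε m α) :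
    hochschildD 𝒜 ε d x ∈ shiftedRelChains 𝒜 ε m (α + 1) := by
  refine ⟨hochschildD_mem_relChains hA hx.1, ?_⟩
  exact mem_homogeneousPart_of_eq (hochschildD_mem hA hx.2) (by ring)

include hA in
theorem connesB_mem_shifted {α : ℤ} {x : Chains ε} (hx : x ∈ shiftedRelChains 𝒜 ε m α) :
    connesB 𝒜 ε x ∈ shiftedRelChains 𝒜 ε m (α - 1) := by
  refine ⟨connesB_mem_relChains' hA x, ?_⟩
  exact mem_homogeneousPart_of_eq (connesB_mem hA hx.2) (by ring)

include hA hδ in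
theorem shiftedMul_trace {i j : ℤ} {r s : SepAlgebra k A} (hr : r ∈ sepPart 𝒜 1 i)
    (hs : s ∈ sepPart 𝒜 1 j) : shiftedMul 𝒜 ε m δ (trace 𝒜 ε r) (trace 𝒜 ε s) =
      trace 𝒜 ε (conj 𝒜 i (δ 1) r * s) := by
  rw [shiftedMul, LinearMap.comp_apply, signBy_apply (trace_mem hA hr), map_smul, LinearMap.smul_apply,
    starMul_trace hA hδ hr hs, sgn_smul_sgn_smul]

include hA hδ in
theorem shiftedMul_mem {α β : ℤ} {x y : Chains ε} (hx : x ∈ shiftedRelChains 𝒜 ε m α)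
    (hy : y ∈ shiftedRelChains 𝒜 ε m β) :
    shiftedMul 𝒜 ε m δ x y ∈ shiftedRelChains 𝒜 ε m (α + β) := by
  obtain ⟨i, r, hr, rfl, rfl⟩ := exists_trace_eq hA hx
  obtain ⟨j, s, hs, rfl, rfl⟩ := exists_trace_eq hA hy
  rw [shiftedMul_trace hA hδ (sepPart_antitone (by omega) hr) (sepPart_antitone (by omega) hs)]
  exact trace_mem_shiftedRelChains hA (mul_mem (conj_mem hδ i hr) hs) (by omega) (by ring)

include hδ in
-- This is c_{xy} = c_x c_y: the central factor c_x is pulled out.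
theorem conj_conj_mul {n : ℕ} {i l : ℤ} {r s : SepAlgebra k A} (hr : r ∈ sepPart 𝒜 n i) (j : ℤ)
    (hl : l = i + m + j) :
    conj 𝒜 l (δ 1) (conj 𝒜 i (δ 1) r * s) = conj 𝒜 i (δ 1) r * conj 𝒜 j (δ 1) s :=
  conj_mul_left hδ (isCentralizing_conj hδ hr) (by rw [hl]; ring_nf; simp) s

include hA hδ in
theorem shiftedMul_assoc {α β γ : ℤ} {x y z : Chains ε} (hx : x ∈ shiftedRelChains 𝒜 ε m α)
    (hy : y ∈ shiftedRelChains 𝒜 ε m β) (hz : z ∈ shiftedRelChains 𝒜 ε m γ) :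
    shiftedMul 𝒜 ε m δ (shiftedMul 𝒜 ε m δ x y) z =
      shiftedMul 𝒜 ε m δ x (shiftedMul 𝒜 ε m δ y z) := by
  obtain ⟨i, r, hr, rfl, rfl⟩ := exists_trace_eq hA hx
  obtain ⟨j, s, hs, rfl, rfl⟩ := exists_trace_eq hA hy
  obtain ⟨l, t, ht, rfl, rfl⟩ := exists_trace_eq hA hz
  have hr1 := sepPart_antitone (n' := 1) (by omega) hr
  have hs1 := sepPart_antitone (n' := 1) (by omega) hs
  have ht1 := sepPart_antitone (n' := 1) (by omega) ht
  rw [shiftedMul_trace hA hδ hr1 hs1, shiftedMul_trace hA hδ hs1 ht1,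
    shiftedMul_trace hA hδ (sepPart_antitone (by omega) (mul_mem (conj_mem hδ i hr) hs)) ht1,
    shiftedMul_trace hA hδ hr1 (sepPart_antitone (by omega) (mul_mem (conj_mem hδ j hs) ht)),
    conj_conj_mul hδ hr j rfl, mul_assoc]

include hA hδ in
theorem hochschildD_shiftedMul {α β : ℤ} {x y : Chains ε} (hx : x ∈ shiftedRelChains 𝒜 ε m α)
    (hy : y ∈ shiftedRelChains 𝒜 ε m β) :
    hochschildD 𝒜 ε d (shiftedMul 𝒜 ε m δ x y) = shiftedMul 𝒜 ε m δ (hochschildD 𝒜 ε d x) y +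
      sgn k α • shiftedMul 𝒜 ε m δ x (hochschildD 𝒜 ε d y) := by
  obtain ⟨i, r, hr, rfl, rfl⟩ := exists_trace_eq hA hx
  obtain ⟨j, s, hs, rfl, rfl⟩ := exists_trace_eq hA hy
  have hr1 := sepPart_antitone (n' := 1) (by omega) hr
  have hs1 := sepPart_antitone (n' := 1) (by omega) hs
  rw [hochschildD_trace hA, hochschildD_trace hA, shiftedMul_trace hA hδ hr1 hs1, hochschildD_trace hA,
    shiftedMul_trace hA hδ (diff_mem hA hr) hs1, shiftedMul_trace hA hδ hr1 (diff_mem hA hs),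
    diff_mul hA (conj_mem hδ i hr), diff_conj hA hδ hr, map_add, map_smul]

variable (𝒜 ε m δ) in
/-- The homotopy `T` with the signs for the shifted degrees. -/
def shiftedT : Chains ε →ₗ[k] Chains ε →ₗ[k] Chains ε :=
  homotopyT 𝒜 ε m δ ∘ₗ signBy (chainComponents 𝒜 ε) (fun i => (m - 1) * i)

include hA hδ in
theorem shiftedT_trace {i j : ℤ} {r s : SepAlgebra k A} (hr : r ∈ sepPart 𝒜 1 i)
    (hs : s ∈ sepPart 𝒜 1 j) : shiftedT 𝒜 ε m δ (trace 𝒜 ε r) (trace 𝒜 ε s) =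
      trace 𝒜 ε (ins 𝒜 (i + m - 1) (conj 𝒜 i (δ 1) r) s) := by
  rw [shiftedT, LinearMap.comp_apply, signBy_apply (trace_mem hA hr), map_smul, LinearMap.smul_apply,
    homotopyT_trace hA hδ hr hs, sgn_smul_sgn_smul]

include hA hδ in
theorem shiftedT_mem {α β : ℤ} {x y : Chains ε} (hx : x ∈ shiftedRelChains 𝒜 ε m α)
    (hy : y ∈ shiftedRelChains 𝒜 ε m β) :
    shiftedT 𝒜 ε m δ x y ∈ shiftedRelChains 𝒜 ε m (α + β - 1) := by
  obtain ⟨i, r, hr, rfl, rfl⟩ := exists_trace_eq hA hx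
  obtain ⟨j, s, hs, rfl, rfl⟩ := exists_trace_eq hA hy
  rw [shiftedT_trace hA hδ (sepPart_antitone (by omega) hr) (sepPart_antitone (by omega) hs)]
  exact trace_mem_shiftedRelChains hA (ins_mem _ (conj_mem hδ i hr) hs) (by omega) (by ring)

include hA hδ in
-- The boundary of the insertion of c_x into s contributes trace(c_x s), which is xy, and trace(s
-- c_x), which the symmetry of δ 1 converts into ± yx.
theorem hochschildD_shiftedT {α β : ℤ} {x y : Chains ε} (hx : x ∈ shiftedRelChains 𝒜 ε m α)
    (hy : y ∈ shiftedRelChains 𝒜 ε m β) :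
    hochschildD 𝒜 ε d (shiftedT 𝒜 ε m δ x y) =
      shiftedMul 𝒜 ε m δ x y - sgn k (α * β) • shiftedMul 𝒜 ε m δ y x -
      shiftedT 𝒜 ε m δ (hochschildD 𝒜 ε d x) y -
      sgn k α • shiftedT 𝒜 ε m δ x (hochschildD 𝒜 ε d y) := by
  obtain ⟨i, r, hr, rfl, rfl⟩ := exists_trace_eq hA hx
  obtain ⟨j, s, hs, rfl, rfl⟩ := exists_trace_eq hA hy
  have hr1 := sepPart_antitone (n' := 1) (by omega) hr
  have hs1 := sepPart_antitone (n' := 1) (by omega) hs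
  have h1 := trace_mul_conj hδ (isRelTrace_trace hA) (sepPart_antitone (Nat.zero_le 1) hs1)
    (sepPart_antitone (Nat.zero_le 1) hr1)
  rw [hochschildD_trace hA, hochschildD_trace hA, shiftedT_trace hA hδ hr1 hs1, hochschildD_trace hA,
    shiftedT_trace hA hδ (diff_mem hA hr) hs1, shiftedT_trace hA hδ hr1 (diff_mem hA hs),
    shiftedMul_trace hA hδ hr1 hs1, shiftedMul_trace hA hδ hs1 hr1,
    diff_ins hA (isCentralizing_conj hδ hr) hs, diff_conj hA hδ hr]
  simp only [map_add, map_sub, map_smul, h1, smul_smul, ← sgn_add]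
  rw [sgn_sub_one, sgn_smul_congr (b := (i + m) * (j + m)), show i + 1 + m - 1 = i + m by ring]
  · rw [neg_smul]; abel
  · by_cases hi : Even i <;> by_cases hj : Even j <;> by_cases hm : Even m <;> simp only
      [sgn_eq_ite, Int.even_add, Int.even_sub, Int.even_mul, even_neg, Int.not_even_one, even_two,
      Even.zero, hi, hj, hm, iff_true, iff_false, true_iff, false_iff, not_true_eq_false,
      not_false_eq_true, or_true, or_false, true_or, false_or, or_self, iff_self, if_true,
      if_false, ite_true, ite_false, one_smul, neg_smul, smul_neg, neg_neg, one_mul, mul_one,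
      neg_mul, mul_neg]

include hA hδ in
-- Strict, not only up to homotopy: insertion into c_y t splits by the product rule, and inserting
-- into c_y amounts to inserting into y first.
theorem shiftedT_shiftedMul {α β γ : ℤ} {x y z : Chains ε} (hx : x ∈ shiftedRelChains 𝒜 ε m α)
    (hy : y ∈ shiftedRelChains 𝒜 ε m β) (hz : z ∈ shiftedRelChains 𝒜 ε m γ) :
    shiftedT 𝒜 ε m δ x (shiftedMul 𝒜 ε m δ y z) =
      shiftedMul 𝒜 ε m δ (shiftedT 𝒜 ε m δ x y) z +
      sgn k ((α - 1) * β) • shiftedMul 𝒜 ε m δ y (shiftedT 𝒜 ε m δ x z) := by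
  obtain ⟨i, r, hr, rfl, rfl⟩ := exists_trace_eq hA hx
  obtain ⟨j, s, hs, rfl, rfl⟩ := exists_trace_eq hA hy
  obtain ⟨l, t, ht, rfl, rfl⟩ := exists_trace_eq hA hz
  have hr1 := sepPart_antitone (n' := 1) (by omega) hr
  have hs1 := sepPart_antitone (n' := 1) (by omega) hs
  have ht1 := sepPart_antitone (n' := 1) (by omega) ht
  rw [shiftedMul_trace hA hδ hs1 ht1, shiftedT_trace hA hδ hr1 hs1, shiftedT_trace hA hδ hr1 ht1,
    shiftedT_trace hA hδ hr1 (sepPart_antitone (by omega) (mul_mem (conj_mem hδ j hs) ht)),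
    shiftedMul_trace hA hδ (ins_mem _ (conj_mem hδ i hr) hs1) ht1,
    shiftedMul_trace hA hδ hs1 (ins_mem _ (conj_mem hδ i hr) ht1),
    ins_mul _ _ (conj_mem hδ j hs), ins_conj, map_add, map_smul, add_sub_assoc]

end Shifted

end OpenFrobenius

namespace OpenFrobenius

variable {k A : Type*} [CommRing k] [Ring A] [Algebra k A] {𝒜 : ℤ → Submodule k A}
  [GradedAlgebra 𝒜] {d : A →ₗ[k] A} {ε : A →ₐ[k] k}

open SepAlgebra

/-! ### Multilinear maps given by degree -/

section ByDegree

variable {M : Type*} [AddCommGroup M] [Module k M]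

variable (𝒜) in
/-- The bilinear map that is given by `f i j` in degrees `i`, `j`. -/
def byDegree₂ (f : ℤ → ℤ → Chains ε →ₗ[k] Chains ε →ₗ[k] M) : Chains ε →ₗ[k] Chains ε →ₗ[k] M :=
  byDegree 𝒜 ε fun i => (byDegree 𝒜 ε fun j => (f i j).flip).flip

theorem byDegree₂_apply {i j : ℤ} {x y : Chains ε}
    (hx : x ∈ homogeneousPart (chainComponents 𝒜 ε) i)
    (hy : y ∈ homogeneousPart (chainComponents 𝒜 ε) j)
    (f : ℤ → ℤ → Chains ε →ₗ[k] Chains ε →ₗ[k] M) : byDegree₂ 𝒜 f x y = f i j x y := by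
  rw [byDegree₂, byDegree_apply hx, LinearMap.flip_apply, byDegree_apply hy, LinearMap.flip_apply]

/-- The trilinear map `(x, y, z) ↦ f y z x`. -/
def rotateArgs : (Chains ε →ₗ[k] Chains ε →ₗ[k] Chains ε →ₗ[k] M) →ₗ[k]
    Chains ε →ₗ[k] Chains ε →ₗ[k] Chains ε →ₗ[k] M :=
  LinearMap.lflip.toLinearMap ∘ₗ
    LinearMap.llcomp k (Chains ε) (Chains ε →ₗ[k] Chains ε →ₗ[k] M) (Chains ε →ₗ[k] Chains ε →ₗ[k] M)
      LinearMap.lflip.toLinearMap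

theorem rotateArgs_apply (f : Chains ε →ₗ[k] Chains ε →ₗ[k] Chains ε →ₗ[k] M) (x y z : Chains ε) :
    rotateArgs f x y z = f y z x := rfl

variable (𝒜) in
/-- The trilinear map that is given by `f i j l` in degrees `i`, `j`, `l`. -/
def byDegree₃ (f : ℤ → ℤ → ℤ → Chains ε →ₗ[k] Chains ε →ₗ[k] Chains ε →ₗ[k] M) :
    Chains ε →ₗ[k] Chains ε →ₗ[k] Chains ε →ₗ[k] M :=
  byDegree 𝒜 ε fun i => rotateArgs (byDegree₂ 𝒜 fun j l => rotateArgs (rotateArgs (f i j l)))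

theorem byDegree₃_apply {i j l : ℤ} {x y z : Chains ε}
    (hx : x ∈ homogeneousPart (chainComponents 𝒜 ε) i)
    (hy : y ∈ homogeneousPart (chainComponents 𝒜 ε) j)
    (hz : z ∈ homogeneousPart (chainComponents 𝒜 ε) l)
    (f : ℤ → ℤ → ℤ → Chains ε →ₗ[k] Chains ε →ₗ[k] Chains ε →ₗ[k] M) :
    byDegree₃ 𝒜 f x y z = f i j l x y z := by
  rw [byDegree₃, byDegree_apply hx, rotateArgs_apply, byDegree₂_apply hy hz, rotateArgs_apply,
    rotateArgs_apply]

end ByDegree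

/-! ### Rotation homotopy and double insertion on chains -/

section Homotopies

variable (hA : IsAugmentedCDGA 𝒜 d ε) {m : ℤ} {δ : A →ₗ[k] A ⊗[k] A}
  (hδ : IsSymmetricOpenFrobenius 𝒜 d m δ)

variable (𝒜 ε m δ) in
/-- The rotation of the second argument combined with the insertion of the first. -/
def rotationHomotopy : Chains ε →ₗ[k] Chains ε →ₗ[k] Chains ε :=
  byDegree₂ 𝒜 fun i j =>
    -- A chain of degree i is encoded in degree i - 1, so its central element has degree i - 1 + m.
    -- The signs depend on these degrees, hence the definition by degree.
    (((cycIns 𝒜 (j - 1 + (i - 1 + m)) (i - 1 + m - 1)).flip 1).compl₁₂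
      (conj 𝒜 (i - 1) (δ 1) ∘ₗ ofChain ε) (ofChain ε)).compr₂ (trace 𝒜 ε)

include hA hδ in
-- Makes the formula available for arbitrary representatives, such as differentials and products,
-- which are not encoded chains themselves.
theorem rotationHomotopy_trace {i j : ℤ} {r s : SepAlgebra k A} (hr : r ∈ sepPart 𝒜 1 i)
    (hs : s ∈ sepPart 𝒜 1 j) : rotationHomotopy 𝒜 ε m δ (trace 𝒜 ε r) (trace 𝒜 ε s) =
      trace 𝒜 ε (cycIns 𝒜 (j + (i + m)) (i + m - 1) (conj 𝒜 i (δ 1) r) 1 s) := by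
  rw [rotationHomotopy, byDegree₂_apply (trace_mem hA hr) (trace_mem hA hs), add_sub_cancel_right,
    add_sub_cancel_right, LinearMap.compr₂_apply, LinearMap.compl₁₂_apply, LinearMap.flip_apply,
    LinearMap.comp_apply]
  have hr' : ofChain ε (trace 𝒜 ε r) ∈ sepPart 𝒜 1 i := by
    have := ofChain_mem hA (trace_mem hA hr)
    rwa [add_sub_cancel_right] at this
  have hc := conj_mem hδ i (sepPart_antitone (Nat.zero_le 1) hr')
  -- The encoded representative is replaced in the second argument and then in the first; each time
  -- invariance under rotation of an element of A suffices.
  have h1 := map_ofChain_trace hA (f := fun j => trace 𝒜 ε ∘ₗ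
    cycIns 𝒜 (j + (i + m)) (i + m - 1) (conj 𝒜 i (δ 1) (ofChain ε (trace 𝒜 ε r))) 1)
    (fun j l s b hs hb => by
      simp only [LinearMap.comp_apply]
      rw [cycIns_mul _ _ _ hc _ hs, cycIns_mul _ _ _ hc _ (of_mem hb)]
      simp only [cycIns_of, cyc_of, ins_of, mul_zero, map_zero, LinearMap.zero_apply,
          smul_zero, add_zero,
        zero_add, mul_one, one_mul, map_smul, smul_smul, ← sgn_add]
      rw [sgn_smul_congr (b := 0), sgn_zero, one_smul]
      by_cases hi : Even i <;> by_cases hj : Even j <;> by_cases hl : Even l <;> by_cases hm : Even m <;>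
        simp only [sgn_eq_ite, Int.even_add, Int.even_sub, Int.even_mul, even_neg,
            Int.not_even_one, even_two, Even.zero, hi, hj, hl, hm, iff_true, iff_false, true_iff,
            false_iff, not_true_eq_false, not_false_eq_true, or_true, or_false, true_or, false_or,
            or_self, iff_self, if_true, if_false, ite_true, ite_false, one_smul, neg_smul,
            smul_neg, neg_neg, one_mul, mul_one, neg_mul, mul_neg]) hs
  have h2 := map_ofChain_trace hA (f := fun i => (trace 𝒜 ε ∘ₗ
    (((cycIns 𝒜 (j + (i + m)) (i + m - 1)).flip 1).flip s)) ∘ₗ conj 𝒜 i (δ 1))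
    (fun i l r b hr hb => by
      simp only [LinearMap.comp_apply]
      rw [conj_rotate hA hδ hr hb, map_smul, map_smul]) hr
  exact h1.trans h2

include hA hδ in
theorem rotationHomotopy_mem {α β : ℤ} {x y : Chains ε} (hx : x ∈ shiftedRelChains 𝒜 ε m α)
    (hy : y ∈ shiftedRelChains 𝒜 ε m β) :
    rotationHomotopy 𝒜 ε m δ x y ∈ shiftedRelChains 𝒜 ε m (α + β - 2) := by
  obtain ⟨i, r, hr, rfl, rfl⟩ := exists_trace_eq hA hx
  obtain ⟨j, s, hs, rfl, rfl⟩ := exists_trace_eq hA hy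
  rw [rotationHomotopy_trace hA hδ (sepPart_antitone (by omega) hr) (sepPart_antitone (by omega) hs)]
  exact trace_mem_shiftedRelChains hA
    (cycIns_mem _ _ (sepPart_antitone (Nat.zero_le 2) (conj_mem hδ i hr)) (one_mem (𝒜 := 𝒜)) hs)
    (by omega) (by ring)

variable (𝒜 ε m δ) in
/-- The insertion of the first two arguments, in this order, into the third. -/
def doubleInsertion : Chains ε →ₗ[k] Chains ε →ₗ[k] Chains ε →ₗ[k] Chains ε :=
  byDegree₃ 𝒜 fun i j _ => ((insTwo 𝒜 (i - 1 + m - 1) (j - 1 + m - 1)).compl₁₂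
      (conj 𝒜 (i - 1) (δ 1) ∘ₗ ofChain ε) (conj 𝒜 (j - 1) (δ 1) ∘ₗ ofChain ε)).compr₂
    (LinearMap.lcomp k (Chains ε) (ofChain ε) ∘ₗ
      LinearMap.llcomp k (SepAlgebra k A) (SepAlgebra k A) (Chains ε) (trace 𝒜 ε))

include hA hδ in
theorem doubleInsertion_trace {i j l : ℤ} {r s t : SepAlgebra k A} (hr : r ∈ sepPart 𝒜 1 i)
    (hs : s ∈ sepPart 𝒜 1 j) (ht : t ∈ sepPart 𝒜 1 l) :
    doubleInsertion 𝒜 ε m δ (trace 𝒜 ε r) (trace 𝒜 ε s) (trace 𝒜 ε t) =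
      trace 𝒜 ε (insTwo 𝒜 (i + m - 1) (j + m - 1) (conj 𝒜 i (δ 1) r) (conj 𝒜 j (δ 1) s) t) := by
  have hq := isRelTrace_trace hA
  have hT : ∀ {i : ℤ} {r : SepAlgebra k A}, r ∈ sepPart 𝒜 1 i →
      ofChain ε (trace 𝒜 ε r) ∈ sepPart 𝒜 1 i := fun hr => by
    have := ofChain_mem hA (trace_mem hA hr)
    rwa [add_sub_cancel_right] at this
  rw [doubleInsertion, byDegree₃_apply (trace_mem hA hr) (trace_mem hA hs) (trace_mem hA ht),
    add_sub_cancel_right, add_sub_cancel_right]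
  have h1 := map_ofChain_trace hA (f := fun _ => trace 𝒜 ε ∘ₗ insTwo 𝒜 (i + m - 1) (j + m - 1)
      (conj 𝒜 i (δ 1) (ofChain ε (trace 𝒜 ε r))) (conj 𝒜 j (δ 1) (ofChain ε (trace 𝒜 ε s))))
    (fun l n t b ht hb => by
      have h0 := sepPart_antitone (Nat.zero_le 1) ht
      have h2 := hq n _ b _ hb (insTwo_mem (i + m - 1) (j + m - 1)
        (sepPart_antitone (Nat.zero_le 1) (conj_mem hδ i (hT hr)))
        (sepPart_antitone (Nat.zero_le 1) (conj_mem hδ j (hT hs))) h0)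
      simp only [LinearMap.comp_apply]
      rw [insTwo_mul _ _ _ _ ht, insTwo_mul _ _ _ _ (of_mem hb)]
      simp only [insTwo_of, ins_of, mul_zero, zero_mul, smul_zero, add_zero, zero_add, map_smul, h2,
        smul_smul, ← sgn_add]
      conv_lhs => rw [← one_smul k (trace 𝒜 ε _), ← sgn_zero]
      refine sgn_smul_congr ?_ _
      by_cases hi : Even i <;> by_cases hj : Even j <;> by_cases hl : Even l <;> by_cases hm : Even m <;>
        by_cases hn : Even n <;> simp only [sgn_eq_ite, Int.even_add, Int.even_sub,
            Int.even_mul, even_neg, Int.not_even_one, even_two, Even.zero, hi, hj, hl, hm, hn,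
            iff_true, iff_false, true_iff, false_iff, not_true_eq_false, not_false_eq_true,
            or_true, or_false, true_or, false_or, or_self, iff_self, if_true, if_false, ite_true,
            ite_false, one_smul, neg_smul, smul_neg, neg_neg, one_mul, mul_one, neg_mul, mul_neg])
            ht
  have h2 := map_ofChain_trace hA (f := fun j => (trace 𝒜 ε ∘ₗ
    ((insTwo 𝒜 (i + m - 1) (j + m - 1)) (conj 𝒜 i (δ 1) (ofChain ε (trace 𝒜 ε r)))).flip t) ∘ₗ
      conj 𝒜 j (δ 1))
    (fun i l r b hr hb => by
      simp only [LinearMap.comp_apply]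
      rw [conj_rotate hA hδ hr hb, map_smul, map_smul]) hs
  have h3 := map_ofChain_trace hA (f := fun i => (trace 𝒜 ε ∘ₗ
    ((insTwo 𝒜 (i + m - 1) (j + m - 1)).flip (conj 𝒜 j (δ 1) s)).flip t) ∘ₗ conj 𝒜 i (δ 1))
    (fun i l r b hr hb => by
      simp only [LinearMap.comp_apply]
      rw [conj_rotate hA hδ hr hb, map_smul, map_smul]) hr
  exact h1.trans (h2.trans h3)

include hA hδ in
theorem doubleInsertion_mem {α β γ : ℤ} {x y z : Chains ε} (hx : x ∈ shiftedRelChains 𝒜 ε m α)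
    (hy : y ∈ shiftedRelChains 𝒜 ε m β) (hz : z ∈ shiftedRelChains 𝒜 ε m γ) :
    doubleInsertion 𝒜 ε m δ x y z ∈ shiftedRelChains 𝒜 ε m (α + β + γ - 2) := by
  obtain ⟨i, r, hr, rfl, rfl⟩ := exists_trace_eq hA hx
  obtain ⟨j, s, hs, rfl, rfl⟩ := exists_trace_eq hA hy
  obtain ⟨l, t, ht, rfl, rfl⟩ := exists_trace_eq hA hz
  rw [doubleInsertion_trace hA hδ (sepPart_antitone (by omega) hr) (sepPart_antitone (by omega) hs)
    (sepPart_antitone (by omega) ht)]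
  exact trace_mem_shiftedRelChains hA
    (insTwo_mem _ _ (sepPart_antitone (Nat.zero_le 2) (conj_mem hδ i hr))
      (sepPart_antitone (Nat.zero_le 2) (conj_mem hδ j hs)) ht)
    (by omega) (by ring)

include hA hδ in
-- The three faces of a double insertion are x T(y, z), T(xy, z) and T(x, z) y. In the middle one
-- c_x c_y is recognized as c_{xy}, and in the last one c_y leaves on the right and returns to a
-- product by the symmetry of δ 1. So T is a derivation in its first argument up to homotopy.
theorem hochschildD_doubleInsertion {α β γ : ℤ} {x y z : Chains ε}
    (hx : x ∈ shiftedRelChains 𝒜 ε m α) (hy : y ∈ shiftedRelChains 𝒜 ε m β)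
    (hz : z ∈ shiftedRelChains 𝒜 ε m γ) :
    hochschildD 𝒜 ε d (doubleInsertion 𝒜 ε m δ x y z) =
      shiftedMul 𝒜 ε m δ x (shiftedT 𝒜 ε m δ y z) -
      sgn k α • shiftedT 𝒜 ε m δ (shiftedMul 𝒜 ε m δ x y) z +
      sgn k (α + β * γ) • shiftedMul 𝒜 ε m δ (shiftedT 𝒜 ε m δ x z) y -
      doubleInsertion 𝒜 ε m δ (hochschildD 𝒜 ε d x) y z +
      sgn k α • doubleInsertion 𝒜 ε m δ x (hochschildD 𝒜 ε d y) z +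
      sgn k (α + β) • doubleInsertion 𝒜 ε m δ x y (hochschildD 𝒜 ε d z) := by
  obtain ⟨i, r, hr, rfl, rfl⟩ := exists_trace_eq hA hx
  obtain ⟨j, s, hs, rfl, rfl⟩ := exists_trace_eq hA hy
  obtain ⟨l, t, ht, rfl, rfl⟩ := exists_trace_eq hA hz
  have hr1 := sepPart_antitone (n' := 1) (by omega) hr
  have hs1 := sepPart_antitone (n' := 1) (by omega) hs
  have ht1 := sepPart_antitone (n' := 1) (by omega) ht
  have hi1 := ins_mem (i + m - 1) (conj_mem hδ i hr1) ht1
  have h1 := trace_mul_conj hδ (isRelTrace_trace hA) (sepPart_antitone (Nat.zero_le 1) hi1)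
    (sepPart_antitone (Nat.zero_le 1) hs1)
  rw [doubleInsertion_trace hA hδ hr1 hs1 ht1, hochschildD_trace hA, hochschildD_trace hA,
    hochschildD_trace hA, hochschildD_trace hA, doubleInsertion_trace hA hδ (diff_mem hA hr) hs1 ht1,
    doubleInsertion_trace hA hδ hr1 (diff_mem hA hs) ht1,
    doubleInsertion_trace hA hδ hr1 hs1 (diff_mem hA ht), shiftedT_trace hA hδ hs1 ht1,
    shiftedT_trace hA hδ hr1 ht1, shiftedMul_trace hA hδ hr1 hs1,
    shiftedMul_trace hA hδ hi1 hs1,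
    shiftedMul_trace hA hδ hr1 (ins_mem _ (conj_mem hδ j hs1) ht1),
    shiftedT_trace hA hδ (sepPart_antitone (by omega) (mul_mem (conj_mem hδ i hr1) hs1)) ht1,
    conj_conj_mul hδ hr j rfl,
    diff_insTwo hA (isCentralizing_conj hδ hr) (isCentralizing_conj hδ hs) ht, diff_conj hA hδ hr,
    diff_conj hA hδ hs]
  simp only [map_add, map_sub, map_smul, h1, smul_smul, ← sgn_add, smul_add, smul_sub]
  rw [show i + 1 + m - 1 = i + m by ring, show j + 1 + m - 1 = j + m by ring,
    show i + m + j + m - 1 = i + m + (j + m) - 1 by ring,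
    sgn_smul_congr (a := i + m + (j + m) * l + m * (j + 1)) (b := i + m + (j + m) * (l + m))]
  · abel
  · by_cases hi : Even i <;> by_cases hj : Even j <;> by_cases hl : Even l <;> by_cases hm : Even m <;>
      simp only [sgn_eq_ite, Int.even_add, Int.even_sub, Int.even_mul, even_neg,
          Int.not_even_one, even_two, Even.zero, hi, hj, hl, hm, iff_true, iff_false, true_iff,
          false_iff, not_true_eq_false, not_false_eq_true, or_true, or_false, true_or, false_or,
          or_self, iff_self, if_true, if_false, ite_true, ite_false, one_smul, neg_smul, smul_neg,
          neg_neg, one_mul, mul_one, neg_mul, mul_neg]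

include hA hδ in
/-- The homotopy between the insertion and the first half of the Connes operator of a product. -/
theorem hochschildD_rotationHomotopy' {i j : ℤ} {r s : SepAlgebra k A} (hr : r ∈ sepPart 𝒜 2 i)
    (hs : s ∈ sepPart 𝒜 2 j) :
    hochschildD 𝒜 ε d (rotationHomotopy 𝒜 ε m δ (trace 𝒜 ε r) (trace 𝒜 ε s)) =
      shiftedT 𝒜 ε m δ (trace 𝒜 ε r) (trace 𝒜 ε s) -
      sgn k (j * (i + m)) • trace 𝒜 ε (cyc 𝒜 (j + (i + m) + 1) (conj 𝒜 i (δ 1) r) s) +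
      sgn k ((i + m) * (j + m)) • shiftedMul 𝒜 ε m δ (connesB 𝒜 ε (trace 𝒜 ε s)) (trace 𝒜 ε r) +
      sgn k (i + m) • rotationHomotopy 𝒜 ε m δ (trace 𝒜 ε r) (hochschildD 𝒜 ε d (trace 𝒜 ε s)) +
      rotationHomotopy 𝒜 ε m δ (hochschildD 𝒜 ε d (trace 𝒜 ε r)) (trace 𝒜 ε s) := by
  have hr1 := sepPart_antitone (n' := 1) (by omega) hr
  have hs1 := sepPart_antitone (n' := 1) (by omega) hs
  have hs0 := sepPart_antitone (Nat.zero_le 2) hs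
  have hb := cyc_mem (j + 1) (one_mem (𝒜 := 𝒜)) hs1
  have h1 := trace_mul_conj hδ (isRelTrace_trace hA) (sepPart_antitone (Nat.zero_le _) hb)
    (sepPart_antitone (Nat.zero_le 1) hr1)
  rw [rotationHomotopy_trace hA hδ hr1 hs1, hochschildD_trace hA, hochschildD_trace hA,
    hochschildD_trace hA, rotationHomotopy_trace hA hδ hr1 (diff_mem hA hs),
    rotationHomotopy_trace hA hδ (diff_mem hA hr) hs1, connesB_trace hA hs0,
    shiftedMul_trace hA hδ (sepPart_antitone (by omega) hb) hr1, shiftedT_trace hA hδ hr1 hs1,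
    trace_diff_cycIns hA (isRelTrace_trace hA) (isCentralizing_conj hδ hr) hs (one_mem (𝒜 := 𝒜))
      (p' := j + 1) (by ring) (by ring), diff_one, h1, diff_conj hA hδ hr]
  simp only [map_zero, LinearMap.zero_apply, smul_zero, sub_zero, one_mul, zero_mul, sgn_zero,
      one_smul,
    add_zero, smul_smul, ← sgn_add]
  rw [show i + 1 + m - 1 = i + m by ring, show j + 1 + (i + m) = j + (i + m) + 1 by ring,
    show j + (i + 1 + m) = j + (i + m) + 1 by ring, sgn_sub_one, neg_smul,
    sgn_smul_congr (a := j * (i + m) + m * (i + 1)) (b := (i + m) * (j + m))]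
  · abel
  · by_cases hi : Even i <;> by_cases hj : Even j <;> by_cases hm : Even m <;> simp only
      [sgn_eq_ite, Int.even_add, Int.even_sub, Int.even_mul, even_neg, Int.not_even_one, even_two,
      Even.zero, hi, hj, hm, iff_true, iff_false, true_iff, false_iff, not_true_eq_false,
      not_false_eq_true, or_true, or_false, true_or, false_or, or_self, iff_self, if_true,
      if_false, ite_true, ite_false, one_smul, neg_smul, smul_neg, neg_neg, one_mul, mul_one,
      neg_mul, mul_neg]

include hδ in
-- Cutting 1' r 1'' at a separator of r and rotating around s puts s between 1'' and 1'. By the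
-- symmetry of δ 1 these factors, now around s, form c_y, and what is rotated is r.
theorem cyc_conj {i j : ℤ} {r s : SepAlgebra k A} (hr : r ∈ sepPart 𝒜 0 i) :
    cyc 𝒜 (i + m + j + 1) s (conj 𝒜 i (δ 1) r) =
      sgn k (m * (j + 1)) • cyc 𝒜 (i + m + j + 1) (conj 𝒜 j (δ 1) s) r := by
  have h1 : cyc 𝒜 (i + m + j + 1) s (conj 𝒜 i (δ 1) r) = (cyc 𝒜 (i + m + j + 1) s ∘ₗ
      (conj 𝒜 i).flip r ∘ₗ (sgn k m • koszulFlip (components 𝒜) (components 𝒜))) (δ 1) := by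
    conv_lhs => rw [hδ.symm]
    simp
  have h2 : sgn k (m * (j + 1)) • cyc 𝒜 (i + m + j + 1) (conj 𝒜 j (δ 1) s) r =
      (sgn k (m * (j + 1)) • ((cyc 𝒜 (i + m + j + 1)).flip r ∘ₗ (conj 𝒜 j).flip s)) (δ 1) := by
    simp
  rw [h1, h2]
  refine map_tensor_of_mem_homogeneousPart 𝒜 (unit_mem hδ) ?_
  intro l b c hb hc
  have h3 : koszulFlip (components 𝒜) (components 𝒜) (b ⊗ₜ c) = sgn k (l * (m - l)) • (c ⊗ₜ b) := by
    rw [koszulFlip, LinearMap.comp_apply, tensorSign_apply (mem_homogeneousPart_components 𝒜 hb)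
      (mem_homogeneousPart_components 𝒜 hc)]
    simp
  simp only [LinearMap.comp_apply, LinearMap.flip_apply, LinearMap.smul_apply, h3, map_smul,
    conj_tmul _ hc, conj_tmul _ hb]
  rw [cyc_mul _ _ (of_mem hc), cyc_mul _ _ hr]
  simp only [cyc_of, smul_zero, zero_add, add_zero, smul_smul, ← sgn_add, mul_assoc]
  refine sgn_smul_congr ?_ _
  by_cases hi : Even i <;> by_cases hj : Even j <;> by_cases hl : Even l <;> by_cases hm : Even m <;>
    simp only [sgn_eq_ite, Int.even_add, Int.even_sub, Int.even_mul, even_neg,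
        Int.not_even_one, even_two, Even.zero, hi, hj, hl, hm, iff_true, iff_false, true_iff,
        false_iff, not_true_eq_false, not_false_eq_true, or_true, or_false, true_or, false_or,
        or_self, iff_self, if_true, if_false, ite_true, ite_false, one_smul, neg_smul, smul_neg,
        neg_neg, one_mul, mul_one, neg_mul, mul_neg]

end Homotopies

end OpenFrobenius

namespace OpenFrobenius

variable {k A : Type*} [CommRing k] [Ring A] [Algebra k A] {𝒜 : ℤ → Submodule k A}
  [GradedAlgebra 𝒜] {d : A →ₗ[k] A} {ε : A →ₐ[k] k}

open SepAlgebra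

/-! ### The bracket up to homotopy and the seven-term relation -/

section SevenTerm

variable (hA : IsAugmentedCDGA 𝒜 d ε) {m : ℤ} {δ : A →ₗ[k] A ⊗[k] A}
  (hδ : IsSymmetricOpenFrobenius 𝒜 d m δ)

include hA hδ in
-- A rotation of c_x s around 1 cuts s or c_x. The first half is a rotation of s around c_x and, by
-- the symmetry, the second is a rotation of r around c_y. The rotation homotopies of (x, y) and (y,
-- x) evaluate the two halves.
theorem connesB_shiftedMul' {α β : ℤ} {x y : Chains ε} (hx : x ∈ shiftedRelChains 𝒜 ε m α)
    (hy : y ∈ shiftedRelChains 𝒜 ε m β) :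
    connesB 𝒜 ε (shiftedMul 𝒜 ε m δ x y) =
      shiftedT 𝒜 ε m δ x y +
      sgn k (α * β) • shiftedMul 𝒜 ε m δ (connesB 𝒜 ε y) x +
      sgn k α • rotationHomotopy 𝒜 ε m δ x (hochschildD 𝒜 ε d y) +
      rotationHomotopy 𝒜 ε m δ (hochschildD 𝒜 ε d x) y -
      hochschildD 𝒜 ε d (rotationHomotopy 𝒜 ε m δ x y) +
      sgn k (α * β) • (shiftedT 𝒜 ε m δ y x +
        sgn k (α * β) • shiftedMul 𝒜 ε m δ (connesB 𝒜 ε x) y +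
        sgn k β • rotationHomotopy 𝒜 ε m δ y (hochschildD 𝒜 ε d x) +
        rotationHomotopy 𝒜 ε m δ (hochschildD 𝒜 ε d y) x -
        hochschildD 𝒜 ε d (rotationHomotopy 𝒜 ε m δ y x)) := by
  obtain ⟨i, r, hr, rfl, rfl⟩ := exists_trace_eq hA hx
  obtain ⟨j, s, hs, rfl, rfl⟩ := exists_trace_eq hA hy
  have hr1 := sepPart_antitone (n' := 1) (by omega) hr
  have hs1 := sepPart_antitone (n' := 1) (by omega) hs
  have h1 := hochschildD_rotationHomotopy' hA hδ hr hs
  have h2 := hochschildD_rotationHomotopy' hA hδ hs hr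
  rw [h1, h2, shiftedMul_trace hA hδ hr1 hs1,
    connesB_trace hA (sepPart_antitone (Nat.zero_le _) (mul_mem (conj_mem hδ i hr) hs)),
    cyc_mul _ _ (conj_mem hδ i hr), mul_one, one_mul, cyc_conj hδ (sepPart_antitone (Nat.zero_le 2) hr),
    map_add, map_smul, map_smul, show j + (i + m) + 1 = i + m + j + 1 by ring,
    show i + (j + m) + 1 = i + m + j + 1 by ring]
  by_cases hi : Even i <;> by_cases hj : Even j <;> by_cases hm : Even m <;> simp only
      [sgn_eq_ite, Int.even_add, Int.even_sub, Int.even_mul, even_neg, Int.not_even_one, even_two,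
      Even.zero, hi, hj, hm, iff_true, iff_false, true_iff, false_iff, not_true_eq_false,
      not_false_eq_true, or_true, or_false, true_or, false_or, or_self, iff_self, if_true,
      if_false, ite_true, ite_false, one_smul, neg_smul, smul_neg, neg_neg, one_mul, mul_one,
      neg_mul, mul_neg] <;> abel

variable (𝒜 ε m δ) in
/-- The homotopy for the compatibility of the Connes operator with the product and the bracket. -/
def bracketHomotopy : Chains ε →ₗ[k] Chains ε →ₗ[k] Chains ε :=
  -- The first two terms serve the two halves of the rotation, and the third moves B y from the left
  -- of x to its right. Here i + (m - 1) is the shifted degree.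
  byDegree₂ 𝒜 fun i j => - rotationHomotopy 𝒜 ε m δ -
    sgn k ((i + (m - 1)) * (j + (m - 1))) • (rotationHomotopy 𝒜 ε m δ).flip -
    sgn k (i + (m - 1)) • (shiftedT 𝒜 ε m δ).compl₂ (connesB 𝒜 ε)

theorem bracketHomotopy_apply {α β : ℤ} {x y : Chains ε} (hx : x ∈ shiftedRelChains 𝒜 ε m α)
    (hy : y ∈ shiftedRelChains 𝒜 ε m β) : bracketHomotopy 𝒜 ε m δ x y =
      - rotationHomotopy 𝒜 ε m δ x y - sgn k (α * β) • rotationHomotopy 𝒜 ε m δ y x -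
        sgn k α • shiftedT 𝒜 ε m δ x (connesB 𝒜 ε y) := by
  rw [bracketHomotopy, byDegree₂_apply hx.2 hy.2, sub_add_cancel, sub_add_cancel]
  rfl

theorem shiftedRelChains_of_eq {α β : ℤ} {x : Chains ε} (hx : x ∈ shiftedRelChains 𝒜 ε m α)
    (h : α = β) : x ∈ shiftedRelChains 𝒜 ε m β := h ▸ hx

include hA hδ in
theorem bracketHomotopy_mem {α β : ℤ} {x y : Chains ε} (hx : x ∈ shiftedRelChains 𝒜 ε m α)
    (hy : y ∈ shiftedRelChains 𝒜 ε m β) :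
    bracketHomotopy 𝒜 ε m δ x y ∈ shiftedRelChains 𝒜 ε m (α + β - 2) := by
  rw [bracketHomotopy_apply hx hy]
  refine sub_mem (sub_mem (neg_mem (rotationHomotopy_mem hA hδ hx hy)) (Submodule.smul_mem _ _ ?_))
    (Submodule.smul_mem _ _ ?_)
  · exact shiftedRelChains_of_eq (rotationHomotopy_mem hA hδ hy hx) (by ring)
  · exact shiftedRelChains_of_eq (shiftedT_mem hA hδ hx (connesB_mem_shifted hA hy)) (by ring)

include hA in
theorem connesB_hochschildD' (x : Chains ε) :
    connesB 𝒜 ε (hochschildD 𝒜 ε d x) = - hochschildD 𝒜 ε d (connesB 𝒜 ε x) :=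
  eq_neg_of_add_eq_zero_left (connesB_hochschildD hA x)

include hA hδ in
/-- The deviation of the Connes operator from a derivation is homotopic to the bracket. -/
theorem connesB_shiftedMul {α β : ℤ} {x y : Chains ε} (hx : x ∈ shiftedRelChains 𝒜 ε m α)
    (hy : y ∈ shiftedRelChains 𝒜 ε m β) :
    connesB 𝒜 ε (shiftedMul 𝒜 ε m δ x y) =
      shiftedMul 𝒜 ε m δ (connesB 𝒜 ε x) y + sgn k α • shiftedMul 𝒜 ε m δ x (connesB 𝒜 ε y) +
      shiftedT 𝒜 ε m δ x y + sgn k (α * β) • shiftedT 𝒜 ε m δ y x +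
      hochschildD 𝒜 ε d (bracketHomotopy 𝒜 ε m δ x y) -
      bracketHomotopy 𝒜 ε m δ (hochschildD 𝒜 ε d x) y -
      sgn k α • bracketHomotopy 𝒜 ε m δ x (hochschildD 𝒜 ε d y) := by
  have hDx := hochschildD_mem_shifted hA hx
  have hDy := hochschildD_mem_shifted hA hy
  rw [connesB_shiftedMul' hA hδ hx hy, bracketHomotopy_apply hx hy, bracketHomotopy_apply hDx hy,
    bracketHomotopy_apply hx hDy, connesB_hochschildD' hA]
  simp only [map_sub, map_neg, map_smul]
  rw [hochschildD_shiftedT hA hδ hx (connesB_mem_shifted hA hy)]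
  simp only [smul_add, smul_sub, smul_neg, smul_smul, ← sgn_add]
  by_cases hi : Even α <;> by_cases hj : Even β <;> simp only [sgn_eq_ite, Int.even_add,
      Int.even_sub, Int.even_mul, even_neg, Int.not_even_one, even_two, Even.zero, hi, hj,
      iff_true, iff_false, true_iff, false_iff, not_true_eq_false, not_false_eq_true, or_true,
      or_false, true_or, false_or, or_self, iff_self, if_true, if_false, ite_true, ite_false,
      one_smul, neg_smul, smul_neg, neg_neg, one_mul, mul_one, neg_mul, mul_neg] <;> abel

variable (𝒜 ε m δ) in
/-- The homotopy for the seven-term relation. -/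
def sevenTermHomotopy : Chains ε →ₗ[k] Chains ε →ₗ[k] Chains ε →ₗ[k] Chains ε :=
  byDegree₃ 𝒜 fun i j l =>
    -- In order: the derivation property of T(–, x) on yz; the bracket homotopies for B(x(yz)),
    -- B(xy)z and yB(xz); commuting B x with y before z; commuting x with y before B z.
    (-sgn k ((i + (m - 1)) * (j + (m - 1)) + (i + (m - 1)) * (l + (m - 1)) + (j + (m - 1)))) •
        rotateArgs (doubleInsertion 𝒜 ε m δ) +
      rotateArgs ((shiftedMul 𝒜 ε m δ).compr₂ (bracketHomotopy 𝒜 ε m δ).flip) +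
      (-1 : k) • (bracketHomotopy 𝒜 ε m δ).compr₂ (shiftedMul 𝒜 ε m δ) +
      (-sgn k ((i + (m - 1)) * (j + (m - 1)))) • (LinearMap.lflip.toLinearMap ∘ₗ
        (bracketHomotopy 𝒜 ε m δ).compr₂ (shiftedMul 𝒜 ε m δ).flip) +
      (shiftedT 𝒜 ε m δ ∘ₗ connesB 𝒜 ε).compr₂ (shiftedMul 𝒜 ε m δ) +
      sgn k (i + (m - 1) + (j + (m - 1))) •
        (shiftedT 𝒜 ε m δ).compr₂ ((shiftedMul 𝒜 ε m δ).compl₂ (connesB 𝒜 ε))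

theorem sevenTermHomotopy_apply {α β γ : ℤ} {x y z : Chains ε} (hx : x ∈ shiftedRelChains 𝒜 ε m α)
    (hy : y ∈ shiftedRelChains 𝒜 ε m β) (hz : z ∈ shiftedRelChains 𝒜 ε m γ) :
    sevenTermHomotopy 𝒜 ε m δ x y z =
      -(sgn k (α * β + α * γ + β) • doubleInsertion 𝒜 ε m δ y z x) +
      bracketHomotopy 𝒜 ε m δ x (shiftedMul 𝒜 ε m δ y z) -
      shiftedMul 𝒜 ε m δ (bracketHomotopy 𝒜 ε m δ x y) z -
      sgn k (α * β) • shiftedMul 𝒜 ε m δ y (bracketHomotopy 𝒜 ε m δ x z) +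
      shiftedMul 𝒜 ε m δ (shiftedT 𝒜 ε m δ (connesB 𝒜 ε x) y) z +
      sgn k (α + β) • shiftedMul 𝒜 ε m δ (shiftedT 𝒜 ε m δ x y) (connesB 𝒜 ε z) := by
  rw [sevenTermHomotopy, byDegree₃_apply hx.2 hy.2 hz.2, sub_add_cancel, sub_add_cancel, sub_add_cancel]
  simp only [LinearMap.add_apply, LinearMap.smul_apply]
  simp only [neg_smul, one_smul, sub_eq_add_neg]
  rfl

include hA hδ in
theorem sevenTermHomotopy_mem {α β γ : ℤ} {x y z : Chains ε} (hx : x ∈ shiftedRelChains 𝒜 ε m α)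
    (hy : y ∈ shiftedRelChains 𝒜 ε m β) (hz : z ∈ shiftedRelChains 𝒜 ε m γ) :
    sevenTermHomotopy 𝒜 ε m δ x y z ∈ shiftedRelChains 𝒜 ε m (α + β + γ - 2) := by
  rw [sevenTermHomotopy_apply hx hy hz]
  have hm := fun {α β : ℤ} {x y : Chains ε} => shiftedMul_mem hA hδ (α := α) (β := β) (x := x) (y := y)
  have hT := fun {α β : ℤ} {x y : Chains ε} => shiftedT_mem hA hδ (α := α) (β := β) (x := x) (y := y)
  have hG := fun {α β : ℤ} {x y : Chains ε} =>
    bracketHomotopy_mem hA hδ (α := α) (β := β) (x := x) (y := y)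
  refine add_mem (add_mem (sub_mem (sub_mem (add_mem (neg_mem (Submodule.smul_mem _ _ ?_)) ?_) ?_)
    (Submodule.smul_mem _ _ ?_)) ?_) (Submodule.smul_mem _ _ ?_)
  · exact shiftedRelChains_of_eq (doubleInsertion_mem hA hδ hy hz hx) (by ring)
  · exact shiftedRelChains_of_eq (hG hx (hm hy hz)) (by ring)
  · exact shiftedRelChains_of_eq (hm (hG hx hy) hz) (by ring)
  · exact shiftedRelChains_of_eq (hm hy (hG hx hz)) (by ring)
  · exact shiftedRelChains_of_eq (hm (hT (connesB_mem_shifted hA hx) hy) hz) (by ring)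
  · exact shiftedRelChains_of_eq (hm (hT hx hy) (connesB_mem_shifted hA hz)) (by ring)

set_option maxHeartbeats 1600000 in
include hA hδ in
-- Expand B(x(yz)), B(xy) and B(xz) by the derivation formula with its bracket; the terms x B(yz)
-- cancel. The brackets that remain cancel by the strict and the homotopy Leibniz rules of T, and
-- the terms y(Bx)z and yx(Bz) are reordered by commutativity up to T.
theorem sevenTermDefect_eq {α β γ : ℤ} {x y z : Chains ε} (hx : x ∈ shiftedRelChains 𝒜 ε m α)
    (hy : y ∈ shiftedRelChains 𝒜 ε m β) (hz : z ∈ shiftedRelChains 𝒜 ε m γ) :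
    sevenTermDefect (shiftedMul 𝒜 ε m δ) (connesB 𝒜 ε) α β x y z =
      hochschildD 𝒜 ε d (sevenTermHomotopy 𝒜 ε m δ x y z) -
        (sevenTermHomotopy 𝒜 ε m δ (hochschildD 𝒜 ε d x) y z +
          sgn k α • sevenTermHomotopy 𝒜 ε m δ x (hochschildD 𝒜 ε d y) z +
          sgn k (α + β) • sevenTermHomotopy 𝒜 ε m δ x y (hochschildD 𝒜 ε d z)) := by
  have hDx := hochschildD_mem_shifted hA hx
  have hDy := hochschildD_mem_shifted hA hy
  have hDz := hochschildD_mem_shifted hA hz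
  have hBx := connesB_mem_shifted hA hx
  have hBy := connesB_mem_shifted hA hy
  have hBz := connesB_mem_shifted hA hz
  have hyz := shiftedMul_mem hA hδ hy hz
  have hxy := shiftedMul_mem hA hδ hx hy
  have hGxy := bracketHomotopy_mem hA hδ hx hy
  have hGxz := bracketHomotopy_mem hA hδ hx hz
  have hTBxy := shiftedT_mem hA hδ hBx hy
  have hTxy := shiftedT_mem hA hδ hx hy
  rw [sevenTermHomotopy_apply hx hy hz, sevenTermHomotopy_apply hDx hy hz,
    sevenTermHomotopy_apply hx hDy hz, sevenTermHomotopy_apply hx hy hDz]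
  rw [sevenTermDefect, shiftedMul_assoc hA hδ hx hy hz, connesB_shiftedMul hA hδ hx hyz,
    connesB_shiftedMul hA hδ hx hy, connesB_shiftedMul hA hδ hx hz, shiftedT_shiftedMul hA hδ hx hy hz]
  simp only [map_add, map_sub, map_neg, map_smul, LinearMap.add_apply, LinearMap.sub_apply,
    LinearMap.neg_apply, LinearMap.smul_apply, connesB_hochschildD' hA, hochschildD_shiftedMul hA hδ hy hz,
    hochschildD_shiftedMul hA hδ hGxy hz, hochschildD_shiftedMul hA hδ hy hGxz,
    hochschildD_shiftedMul hA hδ hTBxy hz, hochschildD_shiftedMul hA hδ hTxy hBz,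
    hochschildD_doubleInsertion hA hδ hy hz hx, hochschildD_shiftedT hA hδ hBx hy,
    hochschildD_shiftedT hA hδ hx hy, shiftedMul_assoc hA hδ hBx hy hz, shiftedMul_assoc hA hδ hy hBx hz,
    shiftedMul_assoc hA hδ hx hBy hz, shiftedMul_assoc hA hδ hx hy hBz, shiftedMul_assoc hA hδ hy hx hBz]
  -- All structural identities have been used. What remains is linear bookkeeping of signs, valid
  -- for arbitrary operators.
  generalize shiftedMul 𝒜 ε m δ = M
  generalize shiftedT 𝒜 ε m δ = T
  generalize bracketHomotopy 𝒜 ε m δ = G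
  generalize doubleInsertion 𝒜 ε m δ = J
  generalize connesB 𝒜 ε = B
  generalize hochschildD 𝒜 ε d = D
  simp only [smul_add, smul_sub, smul_neg, smul_smul, ← sgn_add]
  by_cases hi : Even α <;> by_cases hj : Even β <;> by_cases hl : Even γ <;> simp only
      [sgn_eq_ite, Int.even_add, Int.even_sub, Int.even_mul, even_neg, Int.not_even_one, even_two,
      Even.zero, hi, hj, hl, iff_true, iff_false, true_iff, false_iff, not_true_eq_false,
      not_false_eq_true, or_true, or_false, true_or, false_or, or_self, iff_self, if_true,
      if_false, ite_true, ite_false, one_smul, neg_smul, smul_neg, neg_neg, one_mul, mul_one,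
      neg_mul, mul_neg] <;> abel

end SevenTerm

end OpenFrobenius

namespace OpenFrobenius

variable {k A : Type*} [CommRing k] [Ring A] [Algebra k A] {𝒜 : ℤ → Submodule k A}
  [GradedAlgebra 𝒜] {d : A →ₗ[k] A} {ε : A →ₐ[k] k}

open SepAlgebra

/-! ### The explicit product formulas and the unshifted signs -/

section StarMul

variable (hA : IsAugmentedCDGA 𝒜 d ε) {m : ℤ} {δ : A →ₗ[k] A ⊗[k] A}
  (hδ : IsSymmetricOpenFrobenius 𝒜 d m δ)

include hδ in
theorem starMul_eq_sum_of_coprod_mul {j l : ℤ} {a b : A} {u v : Words ε} (hb : b ∈ 𝒜 j)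
    (hu : u ∈ homogeneousPart (wordComponents 𝒜 ε) l) {n : ℕ} {c c' : Fin n → A} {p q : Fin n → ℤ}
    (hc : ∀ r, c r ∈ 𝒜 (p r)) (hc' : ∀ r, c' r ∈ 𝒜 (q r)) (h : δ (a * b) = ∑ r, c r ⊗ₜ[k] c' r) :
    starMul 𝒜 ε δ (a ⊗ₜ u) (b ⊗ₜ v) =
      ∑ r, sgn k (p r + (q r + j + 1) * l) • (c r ⊗ₜ[k] (u * letter ε (c' r) * v)) := by
  rw [starMul_eq_headSplice hδ a hb hu, h, map_sum, Finset.smul_sum]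
  refine Finset.sum_congr rfl fun r _ => ?_
  rw [headSplice_tmul l u v (hc r) (hc' r), smul_smul, ← sgn_add]
  congr 2
  ring

include hδ in
theorem starMul_eq_sum_of_coprod_right {i j l : ℤ} {a b : A} {u v : Words ε} (ha : a ∈ 𝒜 i)
    (hb : b ∈ 𝒜 j) (hu : u ∈ homogeneousPart (wordComponents 𝒜 ε) l) {n : ℕ} {c c' : Fin n → A}
    {p q : Fin n → ℤ} (hc : ∀ r, c r ∈ 𝒜 (p r)) (hc' : ∀ r, c' r ∈ 𝒜 (q r))
    (h : δ b = ∑ r, c r ⊗ₜ[k] c' r) :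
    starMul 𝒜 ε δ (a ⊗ₜ u) (b ⊗ₜ v) =
      ∑ r, sgn k ((m + 1) * i + p r + (q r + j + 1) * l) •
        ((a * c r) ⊗ₜ[k] (u * letter ε (c' r) * v)) := by
  rw [starMul_eq_headSplice hδ a hb hu, hδ.coprod_mul_left i a b ha, map_smul,
    headSplice_rTensor l u v ha, h, map_sum, map_sum, Finset.smul_sum, Finset.smul_sum, Finset.smul_sum]
  refine Finset.sum_congr rfl fun r _ => ?_
  rw [headSplice_tmul l u v (hc r) (hc' r), map_smul, smul_smul, smul_smul, smul_smul, ← sgn_add,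
    ← sgn_add, ← sgn_add, LinearMap.rTensor_tmul, LinearMap.mulLeft_apply]
  congr 2
  ring

theorem starMul_eq_shiftedMul {i : ℤ} {x : Chains ε}
    (hx : x ∈ homogeneousPart (chainComponents 𝒜 ε) i) (y : Chains ε) :
    starMul 𝒜 ε δ x y = sgn k ((m - 1) * i) • shiftedMul 𝒜 ε m δ x y := by
  rw [shiftedMul, LinearMap.comp_apply, signBy_apply hx, map_smul, LinearMap.smul_apply,
    sgn_smul_sgn_smul]

theorem homotopyT_eq_shiftedT {i : ℤ} {x : Chains ε}
    (hx : x ∈ homogeneousPart (chainComponents 𝒜 ε) i) (y : Chains ε) :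
    homotopyT 𝒜 ε m δ x y = sgn k ((m - 1) * i) • shiftedT 𝒜 ε m δ x y := by
  rw [shiftedT, LinearMap.comp_apply, signBy_apply hx, map_smul, LinearMap.smul_apply,
    sgn_smul_sgn_smul]

theorem mem_shiftedRelChains {i : ℤ} {x : Chains ε}
    (hx : x ∈ relChains ε ⊓ homogeneousPart (chainComponents 𝒜 ε) i) :
    x ∈ shiftedRelChains 𝒜 ε m (i + (m - 1)) :=
  ⟨hx.1, mem_homogeneousPart_of_eq hx.2 (by ring)⟩

include hA in
/-- Linear conditions on relative chains can be checked on homogeneous ones. -/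
theorem shiftedRelChains_induction {p : Chains ε → Prop} (zero : p 0)
    (add : ∀ x y, p x → p y → p (x + y)) (mem : ∀ α, ∀ x ∈ shiftedRelChains 𝒜 ε m α, p x)
    {x : Chains ε} (hx : x ∈ relChains ε) : p x :=
  relChains_induction hA zero add (fun _ x hx => mem _ x (mem_shiftedRelChains hx)) hx

include hA hδ in
theorem shiftedMul_mem_relChains {x y : Chains ε} (hx : x ∈ relChains ε) (hy : y ∈ relChains ε) :
    shiftedMul 𝒜 ε m δ x y ∈ relChains ε := by
  refine shiftedRelChains_induction hA (𝒜 := 𝒜) (m := m)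
    (p := fun x => shiftedMul 𝒜 ε m δ x y ∈ relChains ε) (by simp)
    (fun x x' hx hx' => by simpa using add_mem hx hx') (fun α x hx => ?_) hx
  refine shiftedRelChains_induction hA (𝒜 := 𝒜) (m := m)
    (p := fun y => shiftedMul 𝒜 ε m δ x y ∈ relChains ε) (by simp)
    (fun y y' hy hy' => by simpa using add_mem hy hy') (fun β y hy => ?_) hy
  exact (shiftedMul_mem hA hδ hx hy).1

include hA hδ in
theorem shiftedMul_assoc_of_relChains {x y z : Chains ε} (hx : x ∈ relChains ε) (hy : y ∈ relChains ε)
    (hz : z ∈ relChains ε) : shiftedMul 𝒜 ε m δ (shiftedMul 𝒜 ε m δ x y) z =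
      shiftedMul 𝒜 ε m δ x (shiftedMul 𝒜 ε m δ y z) := by
  refine shiftedRelChains_induction hA (𝒜 := 𝒜) (m := m)
    (p := fun x => shiftedMul 𝒜 ε m δ (shiftedMul 𝒜 ε m δ x y) z =
      shiftedMul 𝒜 ε m δ x (shiftedMul 𝒜 ε m δ y z)) (by simp)
    (fun x x' hx hx' => by simp [hx, hx']) (fun α x hx => ?_) hx
  refine shiftedRelChains_induction hA (𝒜 := 𝒜) (m := m)
    (p := fun y => shiftedMul 𝒜 ε m δ (shiftedMul 𝒜 ε m δ x y) z =
      shiftedMul 𝒜 ε m δ x (shiftedMul 𝒜 ε m δ y z)) (by simp)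
    (fun y y' hy hy' => by simp [hy, hy']) (fun β y hy => ?_) hy
  refine shiftedRelChains_induction hA (𝒜 := 𝒜) (m := m)
    (p := fun z => shiftedMul 𝒜 ε m δ (shiftedMul 𝒜 ε m δ x y) z =
      shiftedMul 𝒜 ε m δ x (shiftedMul 𝒜 ε m δ y z)) (by simp)
    (fun z z' hz hz' => by simp [hz, hz']) (fun γ z hz => ?_) hz
  exact shiftedMul_assoc hA hδ hx hy hz

include hA hδ in
theorem starMul_mem {i j : ℤ} {x y : Chains ε}
    (hx : x ∈ relChains ε ⊓ homogeneousPart (chainComponents 𝒜 ε) i)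
    (hy : y ∈ relChains ε ⊓ homogeneousPart (chainComponents 𝒜 ε) j) :
    starMul 𝒜 ε δ x y ∈
      relChains ε ⊓ homogeneousPart (chainComponents 𝒜 ε) (i + j + (m - 1)) := by
  rw [starMul_eq_shiftedMul (m := m) hx.2]
  have h := shiftedMul_mem hA hδ (mem_shiftedRelChains hx) (mem_shiftedRelChains hy)
  exact Submodule.smul_mem _ _ ⟨h.1, mem_homogeneousPart_of_eq h.2 (by ring)⟩

include hA hδ in
theorem hochschildD_starMul {i j : ℤ} {x y : Chains ε}
    (hx : x ∈ relChains ε ⊓ homogeneousPart (chainComponents 𝒜 ε) i)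
    (hy : y ∈ relChains ε ⊓ homogeneousPart (chainComponents 𝒜 ε) j) :
    hochschildD 𝒜 ε d (starMul 𝒜 ε δ x y) =
      sgn k (m - 1) • (starMul 𝒜 ε δ (hochschildD 𝒜 ε d x) y +
        sgn k i • starMul 𝒜 ε δ x (hochschildD 𝒜 ε d y)) := by
  rw [starMul_eq_shiftedMul (m := m) hx.2, starMul_eq_shiftedMul (m := m) hx.2,
    starMul_eq_shiftedMul (m := m) (hochschildD_mem hA hx.2), map_smul,
    hochschildD_shiftedMul hA hδ (mem_shiftedRelChains hx) (mem_shiftedRelChains hy)]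
  by_cases hi : Even i <;> by_cases hm : Even m <;> simp only [sgn_eq_ite, Int.even_add,
      Int.even_sub, Int.even_mul, even_neg, Int.not_even_one, even_two, Even.zero, hi, hm,
      iff_true, iff_false, true_iff, false_iff, not_true_eq_false, not_false_eq_true, or_true,
      or_false, true_or, false_or, or_self, iff_self, if_true, if_false, ite_true, ite_false,
      one_smul, neg_smul, smul_neg, neg_neg, one_mul, mul_one, neg_mul, mul_neg] <;> abel

include hA hδ in
theorem starMul_assoc {i : ℤ} {x y z : Chains ε}
    (hx : x ∈ relChains ε ⊓ homogeneousPart (chainComponents 𝒜 ε) i) (hy : y ∈ relChains ε)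
    (hz : z ∈ relChains ε) : starMul 𝒜 ε δ (starMul 𝒜 ε δ x y) z =
      sgn k ((m - 1) * i + (m - 1)) • starMul 𝒜 ε δ x (starMul 𝒜 ε δ y z) := by
  refine relChains_induction hA (𝒜 := 𝒜) (p := fun y => starMul 𝒜 ε δ (starMul 𝒜 ε δ x y) z =
      sgn k ((m - 1) * i + (m - 1)) • starMul 𝒜 ε δ x (starMul 𝒜 ε δ y z)) (by simp)
    (fun y y' hy hy' => by simp only [map_add, LinearMap.add_apply, smul_add, hy, hy'])
    (fun j y hy => ?_) hy
  rw [starMul_eq_shiftedMul (m := m) (starMul_mem hA hδ hx hy).2, starMul_eq_shiftedMul (m := m) hx.2,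
    starMul_eq_shiftedMul (m := m) hx.2, starMul_eq_shiftedMul (m := m) hy.2, map_smul, map_smul,
    LinearMap.smul_apply, shiftedMul_assoc_of_relChains hA hδ hx.1 hy.1 hz]
  by_cases hi : Even i <;> by_cases hj : Even j <;> by_cases hm : Even m <;> simp only
      [sgn_eq_ite, Int.even_add, Int.even_sub, Int.even_mul, even_neg, Int.not_even_one, even_two,
      Even.zero, hi, hj, hm, iff_true, iff_false, true_iff, false_iff, not_true_eq_false,
      not_false_eq_true, or_true, or_false, true_or, false_or, or_self, iff_self, if_true,
      if_false, ite_true, ite_false, one_smul, neg_smul, smul_neg, neg_neg, one_mul, mul_one,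
      neg_mul, mul_neg]

include hA hδ in
theorem homotopyT_mem {i j : ℤ} {x y : Chains ε}
    (hx : x ∈ relChains ε ⊓ homogeneousPart (chainComponents 𝒜 ε) i)
    (hy : y ∈ relChains ε ⊓ homogeneousPart (chainComponents 𝒜 ε) j) :
    homotopyT 𝒜 ε m δ x y ∈
      relChains ε ⊓ homogeneousPart (chainComponents 𝒜 ε) (i + j + (m - 2)) := by
  rw [homotopyT_eq_shiftedT (m := m) hx.2]
  have h := shiftedT_mem hA hδ (mem_shiftedRelChains hx) (mem_shiftedRelChains hy)
  exact Submodule.smul_mem _ _ ⟨h.1, mem_homogeneousPart_of_eq h.2 (by ring)⟩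

include hA hδ in
theorem hochschildD_homotopyT {i j : ℤ} {x y : Chains ε}
    (hx : x ∈ relChains ε ⊓ homogeneousPart (chainComponents 𝒜 ε) i)
    (hy : y ∈ relChains ε ⊓ homogeneousPart (chainComponents 𝒜 ε) j) :
    hochschildD 𝒜 ε d (homotopyT 𝒜 ε m δ x y) -
        sgn k (m - 2) • (homotopyT 𝒜 ε m δ (hochschildD 𝒜 ε d x) y +
          sgn k i • homotopyT 𝒜 ε m δ x (hochschildD 𝒜 ε d y)) =
      starMul 𝒜 ε δ x y - sgn k (i * j + (m - 1)) • starMul 𝒜 ε δ y x := by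
  rw [homotopyT_eq_shiftedT (m := m) hx.2, homotopyT_eq_shiftedT (m := m) hx.2,
    homotopyT_eq_shiftedT (m := m) (hochschildD_mem hA hx.2), map_smul,
    starMul_eq_shiftedMul (m := m) hx.2, starMul_eq_shiftedMul (m := m) hy.2,
    hochschildD_shiftedT hA hδ (mem_shiftedRelChains hx) (mem_shiftedRelChains hy)]
  by_cases hi : Even i <;> by_cases hj : Even j <;> by_cases hm : Even m <;> simp only
      [sgn_eq_ite, Int.even_add, Int.even_sub, Int.even_mul, even_neg, Int.not_even_one, even_two,
      Even.zero, hi, hj, hm, iff_true, iff_false, true_iff, false_iff, not_true_eq_false,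
      not_false_eq_true, or_true, or_false, true_or, false_or, or_self, iff_self, if_true,
      if_false, ite_true, ite_false, one_smul, neg_smul, smul_neg, neg_neg, one_mul, mul_one,
      neg_mul, mul_neg] <;> abel

end StarMul

end OpenFrobenius

namespace OpenFrobenius

/-! ### Batalin-Vilkovisky algebras from the seven-term relation -/

section BV

variable {k V : Type*} [CommRing k] [AddCommGroup V] [Module k V] {gr : ℤ → Submodule k V}
  {mul : V →ₗ[k] V →ₗ[k] V} {Δ σ : V →ₗ[k] V}

variable (mul Δ σ) in
/-- The deviation of `Δ` from a derivation of the product, where `σ` is the sign operator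
`a ↦ (-1)^{|a|} a`. -/
def bvBracket : V →ₗ[k] V →ₗ[k] V :=
  (mul ∘ₗ σ).compr₂ Δ - mul ∘ₗ Δ ∘ₗ σ - mul.compl₂ Δ

variable (hσ : ∀ i, ∀ a ∈ gr i, σ a = sgn k i • a)

include hσ in
theorem bvBracket_apply {i : ℤ} {a : V} (ha : a ∈ gr i) (b : V) : bvBracket mul Δ σ a b =
    sgn k i • Δ (mul a b) - sgn k i • mul (Δ a) b - mul a (Δ b) := by
  simp [bvBracket, hσ i a ha]

include hσ in
theorem op_mul {i : ℤ} {a : V} (ha : a ∈ gr i) (b : V) :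
    Δ (mul a b) = sgn k i • bvBracket mul Δ σ a b + mul (Δ a) b + sgn k i • mul a (Δ b) := by
  rw [bvBracket_apply hσ ha]
  by_cases hi : Even i <;> simp only [sgn_eq_ite, Int.even_add, Int.even_sub, Int.even_mul,
      even_neg, Int.not_even_one, even_two, Even.zero, hi, iff_true, iff_false, true_iff,
      false_iff, not_true_eq_false, not_false_eq_true, or_true, or_false, true_or, false_or,
      or_self, iff_self, if_true, if_false, ite_true, ite_false, one_smul, neg_smul, smul_neg,
      neg_neg, one_mul, mul_one, neg_mul, mul_neg] <;> abel

variable (hΔ : ∀ i, ∀ a ∈ gr i, Δ a ∈ gr (i - 1)) (hΔΔ : ∀ a, Δ (Δ a) = 0)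

include hσ hΔ hΔΔ in
-- As Δ² = 0, applying Δ to the definition of the bracket leaves only terms with Δ on two of the
-- three expressions; hence Δ is a derivation of its own bracket.
theorem op_bvBracket {i : ℤ} {a : V} (ha : a ∈ gr i) (b : V) :
    Δ (bvBracket mul Δ σ a b) =
      bvBracket mul Δ σ (Δ a) b - sgn k i • bvBracket mul Δ σ a (Δ b) := by
  rw [bvBracket_apply hσ ha, bvBracket_apply hσ ha, bvBracket_apply hσ (hΔ i a ha)]
  simp only [map_sub, map_smul, hΔΔ, map_zero, LinearMap.zero_apply]
  by_cases hi : Even i <;> simp only [sgn_eq_ite, Int.even_add, Int.even_sub, Int.even_mul,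
      even_neg, Int.not_even_one, even_two, Even.zero, hi, iff_true, iff_false, true_iff,
      false_iff, not_true_eq_false, not_false_eq_true, or_true, or_false, true_or, false_or,
      or_self, iff_self, if_true, if_false, ite_true, ite_false, one_smul, neg_smul, smul_neg,
      neg_neg, one_mul, mul_one, neg_mul, mul_neg] <;> abel

variable (mul_mem : ∀ i j, ∀ a ∈ gr i, ∀ b ∈ gr j, mul a b ∈ gr (i + j))

include hσ hΔ mul_mem in
theorem bvBracket_mem {i j : ℤ} {a b : V} (ha : a ∈ gr i) (hb : b ∈ gr j) :
    bvBracket mul Δ σ a b ∈ gr (i + j - 1) := by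
  rw [bvBracket_apply hσ ha]
  refine sub_mem (sub_mem (Submodule.smul_mem _ _ (hΔ _ _ (mul_mem _ _ _ ha _ hb)))
    (Submodule.smul_mem _ _ ?_)) ?_
  · have := mul_mem _ _ _ (hΔ _ _ ha) _ hb
    rwa [show i - 1 + j = i + j - 1 by ring] at this
  · have := mul_mem _ _ _ ha _ (hΔ _ _ hb)
    rwa [← add_sub_assoc] at this

variable (mul_assoc : ∀ a b c, mul (mul a b) c = mul a (mul b c))
  (mul_comm : ∀ i j, ∀ a ∈ gr i, ∀ b ∈ gr j, mul a b = sgn k (i * j) • mul b a)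
  (seven : ∀ i j, ∀ a ∈ gr i, ∀ b ∈ gr j, ∀ c, sevenTermDefect mul Δ i j a b c = 0)

include hσ hΔ mul_mem mul_assoc mul_comm seven in
-- The seven-term relation replaces Δ(abc); the other terms match after b is commuted past a and Δ
-- a.
theorem bvBracket_mul {i j : ℤ} {a b : V} (ha : a ∈ gr i) (hb : b ∈ gr j) (c : V) :
    bvBracket mul Δ σ a (mul b c) =
      mul (bvBracket mul Δ σ a b) c + sgn k ((i - 1) * j) • mul b (bvBracket mul Δ σ a c) := by
  have h := seven i j a ha b hb c
  rw [sevenTermDefect, sub_eq_zero] at h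
  rw [bvBracket_apply hσ ha, bvBracket_apply hσ ha, bvBracket_apply hσ ha, ← mul_assoc a b c, h]
  simp only [map_sub, map_smul, LinearMap.sub_apply, LinearMap.smul_apply]
  rw [← mul_assoc b (Δ a) c, mul_comm j (i - 1) b hb _ (hΔ _ _ ha), ← mul_assoc b a (Δ c),
    mul_comm j i b hb a ha]
  simp only [map_smul, LinearMap.smul_apply, mul_assoc]
  by_cases hi : Even i <;> by_cases hj : Even j <;> simp only [sgn_eq_ite, Int.even_add,
      Int.even_sub, Int.even_mul, even_neg, Int.not_even_one, even_two, Even.zero, hi, hj,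
      iff_true, iff_false, true_iff, false_iff, not_true_eq_false, not_false_eq_true, or_true,
      or_false, true_or, false_or, or_self, iff_self, if_true, if_false, ite_true, ite_false,
      one_smul, neg_smul, smul_neg, neg_neg, one_mul, mul_one, neg_mul, mul_neg] <;> abel

include hσ hΔ mul_comm in
theorem bvBracket_antisymm {i j : ℤ} {a b : V} (ha : a ∈ gr i) (hb : b ∈ gr j) :
    bvBracket mul Δ σ a b = -(sgn k ((i - 1) * (j - 1)) • bvBracket mul Δ σ b a) := by
  rw [bvBracket_apply hσ ha, bvBracket_apply hσ hb, mul_comm i j a ha b hb,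
    mul_comm (i - 1) j _ (hΔ _ _ ha) b hb, mul_comm i (j - 1) a ha _ (hΔ _ _ hb), map_smul]
  by_cases hi : Even i <;> by_cases hj : Even j <;> simp only [sgn_eq_ite, Int.even_add,
      Int.even_sub, Int.even_mul, even_neg, Int.not_even_one, even_two, Even.zero, hi, hj,
      iff_true, iff_false, true_iff, false_iff, not_true_eq_false, not_false_eq_true, or_true,
      or_false, true_or, false_or, or_self, iff_self, if_true, if_false, ite_true, ite_false,
      one_smul, neg_smul, smul_neg, neg_neg, one_mul, mul_one, neg_mul, mul_neg] <;> abel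

include hσ hΔ hΔΔ mul_mem mul_assoc mul_comm seven in
-- Apply Δ to [a, bc] = [a, b]c ± b[a, c]. On the left Δ passes through the bracket; on the right Δ
-- of each product produces a further bracket. All terms with a single bracket cancel by the Leibniz
-- rule, and the nested brackets form the Jacobi identity.
theorem bvBracket_jacobi {i j : ℤ} {a b : V} (ha : a ∈ gr i) (hb : b ∈ gr j) (c : V) :
    bvBracket mul Δ σ (bvBracket mul Δ σ a b) c = bvBracket mul Δ σ a (bvBracket mul Δ σ b c) -
      sgn k ((i - 1) * (j - 1)) • bvBracket mul Δ σ b (bvBracket mul Δ σ a c) := by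
  have leib := fun {i j a b} ha hb c =>
    bvBracket_mul hσ hΔ mul_mem mul_assoc mul_comm seven (i := i) (j := j) (a := a) (b := b) ha hb c
  have h1 := op_bvBracket hσ hΔ hΔΔ (mul := mul) ha (mul b c)
  rw [leib ha hb, leib (hΔ _ _ ha) hb, map_add, map_smul,
    op_mul hσ (bvBracket_mem hσ hΔ mul_mem ha hb), op_mul hσ hb, op_bvBracket hσ hΔ hΔΔ ha,
    op_bvBracket hσ hΔ hΔΔ ha, op_mul hσ hb, map_add, map_add, map_smul, map_smul,
    leib ha (hΔ _ _ hb), leib ha hb] at h1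
  simp only [map_sub, map_smul, LinearMap.sub_apply, LinearMap.smul_apply] at h1
  rw [← sub_eq_zero] at h1 ⊢
  -- The Jacobi defect is this sign times the relation just derived.
  rw [← smul_zero (sgn k (i + j - 1)), ← h1]
  by_cases hi : Even i <;> by_cases hj : Even j <;> simp only [sgn_eq_ite, Int.even_add,
      Int.even_sub, Int.even_mul, even_neg, Int.not_even_one, even_two, Even.zero, hi, hj,
      iff_true, iff_false, true_iff, false_iff, not_true_eq_false, not_false_eq_true, or_true,
      or_false, true_or, false_or, or_self, iff_self, if_true, if_false, ite_true, ite_false,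
      one_smul, neg_smul, smul_neg, neg_neg, one_mul, mul_one, neg_mul, mul_neg] <;> abel

include hσ hΔ hΔΔ mul_mem mul_assoc mul_comm in
/-- A graded commutative algebra with a square-zero operator that satisfies the seven-term relation
is a BV-algebra. -/
theorem isBVAlgebra_of_sevenTerm (hgr : DirectSum.IsInternal gr)
    (seven : ∀ i j l, ∀ a ∈ gr i, ∀ b ∈ gr j, ∀ c ∈ gr l, sevenTermDefect mul Δ i j a b c = 0) :
    IsBVAlgebra gr (-1) mul (bvBracket mul Δ σ) Δ := by
  have seven' : ∀ i j, ∀ a ∈ gr i, ∀ b ∈ gr j, ∀ c, sevenTermDefect mul Δ i j a b c = 0 := by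
    intro i j a ha b hb c
    have hc : c ∈ ⨆ l, gr l := by rw [hgr.submodule_iSup_eq_top]; trivial
    refine Submodule.iSup_induction _ (motive := fun c => sevenTermDefect mul Δ i j a b c = 0) hc
      (fun l c hc => seven i j l a ha b hb c hc) (by simp [sevenTermDefect]) fun c c' hc hc' => ?_
    have h : sevenTermDefect mul Δ i j a b (c + c') =
        sevenTermDefect mul Δ i j a b c + sevenTermDefect mul Δ i j a b c' := by
      simp only [sevenTermDefect, map_add, smul_add, LinearMap.add_apply]
      abel
    rw [h, hc, hc', add_zero]
  exact {
    isInternal := hgr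
    mul_mem := fun i j a b ha hb => mul_mem i j a ha b hb
    br_mem := fun i j a b ha hb => bvBracket_mem hσ hΔ mul_mem ha hb
    mul_assoc := mul_assoc
    mul_comm := fun i j a b ha hb => mul_comm i j a ha b hb
    leibniz := fun i j a b c ha hb =>
      bvBracket_mul hσ hΔ mul_mem mul_assoc mul_comm seven' ha hb c
    antisymm := fun i j a b ha hb => bvBracket_antisymm hσ hΔ mul_comm ha hb
    jacobi := fun i j a b c ha hb =>
      bvBracket_jacobi hσ hΔ hΔΔ mul_mem mul_assoc mul_comm seven' ha hb c
    op_mem := hΔ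
    op_op := hΔΔ
    br_eq := fun i a b ha => bvBracket_apply hσ ha b }

end BV

/-! ### Linear algebra of quotients and gradings -/

section Quotient

variable {k V W : Type*} [CommRing k] [AddCommGroup V] [Module k V] [AddCommGroup W] [Module k W]

theorem map_sevenTermDefect (f : V →ₗ[k] W) {mul : V →ₗ[k] V →ₗ[k] V} {Δ : V →ₗ[k] V}
    {mul' : W →ₗ[k] W →ₗ[k] W} {Δ' : W →ₗ[k] W} (hmul : ∀ a b, f (mul a b) = mul' (f a) (f b))
    (hΔ : ∀ a, f (Δ a) = Δ' (f a)) (i j : ℤ) (a b c : V) :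
    f (sevenTermDefect mul Δ i j a b c) = sevenTermDefect mul' Δ' i j (f a) (f b) (f c) := by
  simp only [sevenTermDefect, map_sub, map_add, map_smul, hmul, hΔ]

/-- A bilinear map on a quotient, induced by a bilinear map that vanishes on the submodule. -/
def quotientLift₂ (N : Submodule k V) (f : V →ₗ[k] V →ₗ[k] W) (hl : ∀ x ∈ N, ∀ y, f x y = 0)
    (hr : ∀ x, ∀ y ∈ N, f x y = 0) : V ⧸ N →ₗ[k] V ⧸ N →ₗ[k] W :=
  N.liftQ (N.liftQ f.flip fun y hy => LinearMap.ext fun x => hr x y hy).flip fun x hx =>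
    N.linearMap_qext <| LinearMap.ext fun y => hl x hx y

/-- A graded family of submodules with compatible projections is a direct sum decomposition. -/
theorem isInternal_of_projections {gr : ℤ → Submodule k V} (π : ℤ → V →ₗ[k] V)
    (hπ : ∀ i, ∀ a ∈ gr i, π i a = a) (hπ' : ∀ i j, i ≠ j → ∀ a ∈ gr j, π i a = 0)
    (htop : ⨆ i, gr i = ⊤) : DirectSum.IsInternal gr := by
  rw [DirectSum.isInternal_submodule_iff_iSupIndep_and_iSup_eq_top]
  refine ⟨fun i => ?_, htop⟩
  rw [Submodule.disjoint_def]
  intro a ha ha'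
  have h : ⨆ (j) (_ : j ≠ i), gr j ≤ LinearMap.ker (π i) :=
    iSup₂_le fun j hj a ha => hπ' i j hj.symm a ha
  rw [← hπ i a ha]
  exact h ha'

end Quotient

end OpenFrobenius

namespace OpenFrobenius

variable {k A : Type*} [CommRing k] [Ring A] [Algebra k A] {𝒜 : ℤ → Submodule k A}
  [GradedAlgebra 𝒜] {d : A →ₗ[k] A} {ε : A →ₐ[k] k}

/-! ### Relative Hochschild homology -/

section Homology

variable (hA : IsAugmentedCDGA 𝒜 d ε)

include hA in
theorem hochschildD_component (i : ℤ) (x : Chains ε) :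
    hochschildD 𝒜 ε d (component 𝒜 ε i x) = component 𝒜 ε (i + 1) (hochschildD 𝒜 ε d x) := by
  refine chains_induction hA (𝒜 := 𝒜) (p := fun x => hochschildD 𝒜 ε d (component 𝒜 ε i x) =
    component 𝒜 ε (i + 1) (hochschildD 𝒜 ε d x)) (by simp) (fun x y hx hy => by simp [hx, hy])
    (fun j x hx => ?_) x
  rw [component_of_mem hx, component_of_mem (hochschildD_mem hA hx)]
  simp only [add_left_inj]
  split_ifs <;> simp

include hA in
-- The sign operator anticommutes with D, hence preserves cycles and boundaries. Its action on
-- homology is needed to write the bracket as a bilinear map on all elements, not only on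
-- homogeneous ones.
theorem hochschildD_signBy (n : ℤ) (x : Chains ε) :
    hochschildD 𝒜 ε d (signBy (chainComponents 𝒜 ε) (fun i => i + n) x) =
      -signBy (chainComponents 𝒜 ε) (fun i => i + n) (hochschildD 𝒜 ε d x) := by
  refine chains_induction hA (𝒜 := 𝒜) (p := fun x =>
    hochschildD 𝒜 ε d (signBy (chainComponents 𝒜 ε) (fun i => i + n) x) =
      -signBy (chainComponents 𝒜 ε) (fun i => i + n) (hochschildD 𝒜 ε d x)) (by simp)
    (fun x y hx hy => by simp only [map_add, neg_add, hx, hy]) (fun i x hx => ?_) x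
  rw [signBy_apply hx, signBy_apply (hochschildD_mem hA hx), map_smul, add_right_comm, sgn_add _ 1]
  simp [sgn_one]

include hA in
theorem signBy_mem_relChains (f : ℤ → ℤ) {x : Chains ε} (hx : x ∈ relChains ε) :
    signBy (chainComponents 𝒜 ε) f x ∈ relChains ε := by
  refine relChains_induction hA (𝒜 := 𝒜) (p := fun x =>
    signBy (chainComponents 𝒜 ε) f x ∈ relChains ε) (by simp)
    (fun x y hx hy => by simpa using add_mem hx hy) (fun i x hx => ?_) hx
  rw [signBy_apply hx.2]
  exact Submodule.smul_mem _ _ hx.1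

include hA in
theorem component_mem_relCycles (i : ℤ) {x : Chains ε} (hx : x ∈ relCycles 𝒜 ε d) :
    component 𝒜 ε i x ∈ relCycles 𝒜 ε d := by
  refine ⟨component_mem_relChains hA i hx.1, ?_⟩
  rw [SetLike.mem_coe, LinearMap.mem_ker, hochschildD_component hA, LinearMap.mem_ker.1 hx.2, map_zero]

include hA in
/-- Linear conditions on relative cycles can be checked on homogeneous ones. -/
theorem relCycles_induction (m : ℤ) {p : Chains ε → Prop} (zero : p 0)
    (add : ∀ x y, p x → p y → p (x + y))
    (mem : ∀ α, ∀ x ∈ shiftedRelChains 𝒜 ε m α, hochschildD 𝒜 ε d x = 0 → p x)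
    {x : Chains ε} (hx : x ∈ relCycles 𝒜 ε d) : p x := by
  rw [← sum_component (𝒜 := 𝒜) hA x]
  refine Finset.sum_induction _ p add zero fun i _ => ?_
  have h := component_mem_relCycles hA i hx
  exact mem _ _ (mem_shiftedRelChains ⟨h.1, component_mem hA i x⟩) h.2

/-- The operator on homology induced by an operator on chains. -/
def relHHMap (f : Chains ε →ₗ[k] Chains ε) (hZ : ∀ x ∈ relCycles 𝒜 ε d, f x ∈ relCycles 𝒜 ε d)
    (hB : ∀ x ∈ relBoundaries 𝒜 ε d, f x ∈ relBoundaries 𝒜 ε d) :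
    RelHH 𝒜 ε d →ₗ[k] RelHH 𝒜 ε d :=
  Submodule.mapQ _ _ (f.restrict hZ) fun x hx => hB x hx

theorem relHHMap_relClass (f : Chains ε →ₗ[k] Chains ε)
    (hZ : ∀ x ∈ relCycles 𝒜 ε d, f x ∈ relCycles 𝒜 ε d)
    (hB : ∀ x ∈ relBoundaries 𝒜 ε d, f x ∈ relBoundaries 𝒜 ε d) (x : relCycles 𝒜 ε d) :
    relHHMap f hZ hB (relClass 𝒜 ε d x) = relClass 𝒜 ε d ⟨f x, hZ x x.2⟩ := rfl

theorem relClass_surjective : Function.Surjective (relClass 𝒜 ε d) := Submodule.mkQ_surjective _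

theorem relClass_eq_zero {x : relCycles 𝒜 ε d} :
    relClass 𝒜 ε d x = 0 ↔ (x : Chains ε) ∈ relBoundaries 𝒜 ε d :=
  Submodule.Quotient.mk_eq_zero _

theorem relClass_eq {x y : relCycles 𝒜 ε d} :
    relClass 𝒜 ε d x = relClass 𝒜 ε d y ↔ (x - y : Chains ε) ∈ relBoundaries 𝒜 ε d := by
  rw [← sub_eq_zero, ← map_sub, relClass_eq_zero]
  rfl

theorem hochschildD_mem_relBoundaries {x : Chains ε} (hx : x ∈ relChains ε) :
    hochschildD 𝒜 ε d x ∈ relBoundaries 𝒜 ε d := Submodule.mem_map_of_mem hx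

include hA in
theorem connesB_mem_relCycles {x : Chains ε} (hx : x ∈ relCycles 𝒜 ε d) :
    connesB 𝒜 ε x ∈ relCycles 𝒜 ε d := by
  refine ⟨connesB_mem_relChains' hA x, ?_⟩
  have h := connesB_hochschildD' hA x
  rw [LinearMap.mem_ker.1 hx.2, map_zero, eq_comm, neg_eq_zero] at h
  exact h

include hA in
theorem connesB_mem_relBoundaries {x : Chains ε} (hx : x ∈ relBoundaries 𝒜 ε d) :
    connesB 𝒜 ε x ∈ relBoundaries 𝒜 ε d := by
  obtain ⟨w, hw, rfl⟩ := hx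
  rw [connesB_hochschildD' hA]
  exact neg_mem (hochschildD_mem_relBoundaries (connesB_mem_relChains' hA w))

include hA in
theorem signBy_mem_relCycles (n : ℤ) {x : Chains ε} (hx : x ∈ relCycles 𝒜 ε d) :
    signBy (chainComponents 𝒜 ε) (fun i => i + n) x ∈ relCycles 𝒜 ε d := by
  refine ⟨signBy_mem_relChains hA _ hx.1, ?_⟩
  rw [SetLike.mem_coe, LinearMap.mem_ker, hochschildD_signBy hA, LinearMap.mem_ker.1 hx.2, map_zero, neg_zero]

include hA in
theorem signBy_mem_relBoundaries (n : ℤ) {x : Chains ε} (hx : x ∈ relBoundaries 𝒜 ε d) :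
    signBy (chainComponents 𝒜 ε) (fun i => i + n) x ∈ relBoundaries 𝒜 ε d := by
  obtain ⟨w, hw, rfl⟩ := hx
  rw [← neg_mem_iff, ← hochschildD_signBy hA]
  exact hochschildD_mem_relBoundaries (signBy_mem_relChains hA _ hw)

include hA in
theorem component_mem_relBoundaries (i : ℤ) {x : Chains ε} (hx : x ∈ relBoundaries 𝒜 ε d) :
    component 𝒜 ε i x ∈ relBoundaries 𝒜 ε d := by
  obtain ⟨w, hw, rfl⟩ := hx
  rw [← sub_add_cancel i 1, ← hochschildD_component hA]
  exact hochschildD_mem_relBoundaries (component_mem_relChains hA _ hw)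

theorem exists_relClass_eq {m α : ℤ} {a : RelHH 𝒜 ε d}
    (ha : a ∈ relHHDegree 𝒜 ε d (α - (m - 1))) :
    ∃ x : relCycles 𝒜 ε d, (x : Chains ε) ∈ shiftedRelChains 𝒜 ε m α ∧ relClass 𝒜 ε d x = a := by
  obtain ⟨x, hx, rfl⟩ := ha
  exact ⟨x, ⟨x.2.1, hx⟩, rfl⟩

theorem relClass_mem_relHHDegree {m α : ℤ} {x : relCycles 𝒜 ε d}
    (hx : (x : Chains ε) ∈ shiftedRelChains 𝒜 ε m α) :
    relClass 𝒜 ε d x ∈ relHHDegree 𝒜 ε d (α - (m - 1)) :=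
  Submodule.mem_map_of_mem (Submodule.mem_comap.2 hx.2)

include hA in
theorem isInternal_relHHDegree (m : ℤ) :
    DirectSum.IsInternal (fun n => relHHDegree 𝒜 ε d (n - (m - 1))) := by
  refine isInternal_of_projections
    (fun n => relHHMap (component 𝒜 ε (n - (m - 1))) (fun _ => component_mem_relCycles hA _)
      fun _ => component_mem_relBoundaries hA _) ?_ ?_ ?_
  · intro i a ha
    obtain ⟨x, hx, rfl⟩ := exists_relClass_eq ha
    rw [relHHMap_relClass]
    congr 1
    exact Subtype.ext (component_self hx.2)
  · intro i j hij a ha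
    obtain ⟨x, hx, rfl⟩ := exists_relClass_eq ha
    rw [relHHMap_relClass, relClass_eq_zero, Subtype.coe_mk, component_of_mem hx.2, if_neg (by omega)]
    exact zero_mem _
  · rw [eq_top_iff]
    rintro a -
    obtain ⟨⟨x, hx⟩, rfl⟩ := relClass_surjective a
    -- With the proof of being a cycle quantified inside, the induction over homogeneous components
    -- runs on plain chains.
    suffices h : ∃ hx' : x ∈ relCycles 𝒜 ε d,
        relClass 𝒜 ε d ⟨x, hx'⟩ ∈ ⨆ n, relHHDegree 𝒜 ε d (n - (m - 1)) from h.2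
    refine relCycles_induction hA m (p := fun x => ∃ hx' : x ∈ relCycles 𝒜 ε d,
        relClass 𝒜 ε d ⟨x, hx'⟩ ∈ ⨆ n, relHHDegree 𝒜 ε d (n - (m - 1))) ?_ ?_ ?_ hx
    · refine ⟨zero_mem _, ?_⟩
      have : relClass 𝒜 ε d ⟨0, zero_mem _⟩ = 0 := map_zero _
      rw [this]
      exact zero_mem _
    · rintro x y ⟨hx, hx'⟩ ⟨hy, hy'⟩
      refine ⟨add_mem hx hy, ?_⟩
      have := (map_add (relClass 𝒜 ε d) ⟨x, hx⟩ ⟨y, hy⟩).symm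
      rw [AddMemClass.mk_add_mk] at this
      rw [← this]
      exact add_mem hx' hy'
    · intro α x hx hDx
      exact ⟨⟨hx.1, hDx⟩, Submodule.mem_iSup_of_mem α (relClass_mem_relHHDegree hx)⟩

variable {m : ℤ} {δ : A →ₗ[k] A ⊗[k] A} (hδ : IsSymmetricOpenFrobenius 𝒜 d m δ)

include hA hδ in
theorem shiftedMul_mem_relCycles {x y : Chains ε} (hx : x ∈ relCycles 𝒜 ε d)
    (hy : y ∈ relCycles 𝒜 ε d) : shiftedMul 𝒜 ε m δ x y ∈ relCycles 𝒜 ε d := by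
  refine relCycles_induction hA m (p := fun x => shiftedMul 𝒜 ε m δ x y ∈ relCycles 𝒜 ε d) (by simp)
    (fun x x' hx hx' => by simpa using add_mem hx hx') (fun α x hx hDx => ?_) hx
  refine relCycles_induction hA m (p := fun y => shiftedMul 𝒜 ε m δ x y ∈ relCycles 𝒜 ε d) (by simp)
    (fun y y' hy hy' => by simpa using add_mem hy hy') (fun β y hy hDy => ?_) hy
  refine ⟨shiftedMul_mem_relChains hA hδ hx.1 hy.1, ?_⟩
  rw [SetLike.mem_coe, LinearMap.mem_ker, hochschildD_shiftedMul hA hδ hx hy, hDx, hDy]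
  simp

include hA hδ in
theorem shiftedMul_mem_relBoundaries_left {x y : Chains ε} (hx : x ∈ relBoundaries 𝒜 ε d)
    (hy : y ∈ relCycles 𝒜 ε d) : shiftedMul 𝒜 ε m δ x y ∈ relBoundaries 𝒜 ε d := by
  obtain ⟨w, hw, rfl⟩ := hx
  refine shiftedRelChains_induction (m := m) hA (p := fun w =>
    shiftedMul 𝒜 ε m δ (hochschildD 𝒜 ε d w) y ∈ relBoundaries 𝒜 ε d) (by simp)
    (fun w w' hw hw' => by simpa using add_mem hw hw') (fun α w hw => ?_) hw
  refine relCycles_induction hA m (p := fun y =>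
    shiftedMul 𝒜 ε m δ (hochschildD 𝒜 ε d w) y ∈ relBoundaries 𝒜 ε d) (by simp)
    (fun y y' hy hy' => by simpa using add_mem hy hy') (fun β y hy hDy => ?_) hy
  have h := hochschildD_shiftedMul hA hδ hw hy
  rw [hDy, map_zero, smul_zero, add_zero] at h
  rw [← h]
  exact hochschildD_mem_relBoundaries (shiftedMul_mem_relChains hA hδ hw.1 hy.1)

include hA hδ in
theorem shiftedMul_mem_relBoundaries_right {x y : Chains ε} (hx : x ∈ relCycles 𝒜 ε d)
    (hy : y ∈ relBoundaries 𝒜 ε d) : shiftedMul 𝒜 ε m δ x y ∈ relBoundaries 𝒜 ε d := by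
  obtain ⟨w, hw, rfl⟩ := hy
  refine relCycles_induction hA m (p := fun x =>
    shiftedMul 𝒜 ε m δ x (hochschildD 𝒜 ε d w) ∈ relBoundaries 𝒜 ε d) (by simp)
    (fun x x' hx hx' => by simpa using add_mem hx hx') (fun α x hx hDx => ?_) hx
  refine shiftedRelChains_induction (m := m) hA (p := fun w =>
    shiftedMul 𝒜 ε m δ x (hochschildD 𝒜 ε d w) ∈ relBoundaries 𝒜 ε d) (by simp)
    (fun w w' hw hw' => by simpa using add_mem hw hw') (fun β w hw => ?_) hw
  have h := hochschildD_shiftedMul hA hδ hx hw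
  rw [hDx, map_zero, LinearMap.zero_apply, zero_add] at h
  rw [← sgn_smul_sgn_smul (k := k) α (shiftedMul 𝒜 ε m δ x _), ← h]
  exact Submodule.smul_mem _ _
    (hochschildD_mem_relBoundaries (shiftedMul_mem_relChains hA hδ hx.1 hw.1))

/-- The Connes operator on relative Hochschild homology. -/
def relHHOp : RelHH 𝒜 ε d →ₗ[k] RelHH 𝒜 ε d :=
  relHHMap (connesB 𝒜 ε) (fun _ => connesB_mem_relCycles hA) fun _ => connesB_mem_relBoundaries hA

variable (m) in
/-- The sign operator of the shifted relative Hochschild homology. -/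
def relHHSign : RelHH 𝒜 ε d →ₗ[k] RelHH 𝒜 ε d :=
  relHHMap (signBy (chainComponents 𝒜 ε) (fun i => i + (m - 1))) (fun _ => signBy_mem_relCycles hA _)
    fun _ => signBy_mem_relBoundaries hA _

/-- The product on the relative cycles. -/
def relCyclesMul : relCycles 𝒜 ε d →ₗ[k] relCycles 𝒜 ε d →ₗ[k] relCycles 𝒜 ε d :=
  LinearMap.mk₂ k (fun x y => ⟨shiftedMul 𝒜 ε m δ x y, shiftedMul_mem_relCycles hA hδ x.2 y.2⟩)
    (fun x x' y => Subtype.ext (by simp)) (fun c x y => Subtype.ext (by simp))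
    (fun x y y' => Subtype.ext (by simp)) (fun c x y => Subtype.ext (by simp))

/-- The product on the shifted relative Hochschild homology. -/
def relHHMul : RelHH 𝒜 ε d →ₗ[k] RelHH 𝒜 ε d →ₗ[k] RelHH 𝒜 ε d :=
  quotientLift₂ _ ((relCyclesMul hA hδ).compr₂ (relClass 𝒜 ε d))
    (fun _ hx y => relClass_eq_zero.2 (shiftedMul_mem_relBoundaries_left hA hδ hx y.2))
    (fun x _ hy => relClass_eq_zero.2 (shiftedMul_mem_relBoundaries_right hA hδ x.2 hy))

theorem relHHMul_relClass (x y : relCycles 𝒜 ε d) :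
    relHHMul hA hδ (relClass 𝒜 ε d x) (relClass 𝒜 ε d y) =
      relClass 𝒜 ε d ⟨shiftedMul 𝒜 ε m δ x y, shiftedMul_mem_relCycles hA hδ x.2 y.2⟩ := rfl

theorem sevenTermDefect_relHH {i j l : ℤ} {x y z : relCycles 𝒜 ε d}
    (hx : (x : Chains ε) ∈ shiftedRelChains 𝒜 ε m i) (hy : (y : Chains ε) ∈ shiftedRelChains 𝒜 ε m j)
    (hz : (z : Chains ε) ∈ shiftedRelChains 𝒜 ε m l) :
    sevenTermDefect (relHHMul hA hδ) (relHHOp hA) i j (relClass 𝒜 ε d x) (relClass 𝒜 ε d y)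
      (relClass 𝒜 ε d z) = 0 := by
  rw [← map_sevenTermDefect (relClass 𝒜 ε d) (mul := relCyclesMul hA hδ)
    (Δ := (connesB 𝒜 ε).restrict fun _ => connesB_mem_relCycles hA)
    (fun _ _ => rfl) (fun _ => rfl), relClass_eq_zero, ← Submodule.subtype_apply,
    map_sevenTermDefect (relCycles 𝒜 ε d).subtype (mul' := shiftedMul 𝒜 ε m δ)
      (Δ' := connesB 𝒜 ε) (fun _ _ => rfl) (fun _ => rfl)]
  simp only [Submodule.subtype_apply]
  rw [sevenTermDefect_eq hA hδ hx hy hz, LinearMap.mem_ker.1 x.2.2, LinearMap.mem_ker.1 y.2.2,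
    LinearMap.mem_ker.1 z.2.2]
  simp only [map_zero, LinearMap.zero_apply, smul_zero, add_zero, sub_zero]
  exact hochschildD_mem_relBoundaries (sevenTermHomotopy_mem hA hδ hx hy hz).1

/-- On cycles the homotopy identities for commutativity and for the seven-term relation leave only a
boundary of a relative chain, so both relations become exact on homology; associativity and B² = 0
hold already on chains. -/
theorem isBVAlgebra_relHH : IsBVAlgebra (fun n => relHHDegree 𝒜 ε d (n - (m - 1))) (-1)
    (relHHMul hA hδ) (bvBracket (relHHMul hA hδ) (relHHOp hA) (relHHSign hA m)) (relHHOp hA) := by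
  refine isBVAlgebra_of_sevenTerm ?_ ?_ ?_ ?_ ?_ ?_ (isInternal_relHHDegree hA m) ?_
  · intro i a ha
    obtain ⟨x, hx, rfl⟩ := exists_relClass_eq ha
    rw [relHHSign, relHHMap_relClass, ← map_smul]
    congr 1
    refine Subtype.ext ((signBy_apply hx.2 _).trans ?_)
    rw [Submodule.coe_smul, sub_add_cancel]
  · intro i a ha
    obtain ⟨x, hx, rfl⟩ := exists_relClass_eq ha
    exact relClass_mem_relHHDegree (connesB_mem_shifted hA hx)
  · intro a
    obtain ⟨x, rfl⟩ := relClass_surjective a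
    rw [relHHOp, relHHMap_relClass, relHHMap_relClass, relClass_eq_zero]
    simp [connesB_connesB hA]
  · intro i j a ha b hb
    obtain ⟨x, hx, rfl⟩ := exists_relClass_eq ha
    obtain ⟨y, hy, rfl⟩ := exists_relClass_eq hb
    exact relClass_mem_relHHDegree (shiftedMul_mem hA hδ hx hy)
  · intro a b c
    obtain ⟨x, rfl⟩ := relClass_surjective a
    obtain ⟨y, rfl⟩ := relClass_surjective b
    obtain ⟨z, rfl⟩ := relClass_surjective c
    rw [relHHMul_relClass, relHHMul_relClass, relHHMul_relClass, relHHMul_relClass]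
    exact congrArg (relClass 𝒜 ε d) <| Subtype.ext (shiftedMul_assoc_of_relChains hA hδ x.2.1 y.2.1 z.2.1)
  · intro i j a ha b hb
    obtain ⟨x, hx, rfl⟩ := exists_relClass_eq ha
    obtain ⟨y, hy, rfl⟩ := exists_relClass_eq hb
    rw [relHHMul_relClass, relHHMul_relClass, ← map_smul, relClass_eq, Submodule.coe_smul]
    have h := hochschildD_shiftedT hA hδ hx hy
    rw [LinearMap.mem_ker.1 x.2.2, LinearMap.mem_ker.1 y.2.2] at h
    simp only [map_zero, LinearMap.zero_apply, smul_zero, sub_zero] at h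
    rw [← h]
    exact hochschildD_mem_relBoundaries (shiftedT_mem hA hδ hx hy).1
  · intro i j l a ha b hb c hc
    obtain ⟨x, hx, rfl⟩ := exists_relClass_eq ha
    obtain ⟨y, hy, rfl⟩ := exists_relClass_eq hb
    obtain ⟨z, hz, rfl⟩ := exists_relClass_eq hc
    exact sevenTermDefect_relHH hA hδ hx hy hz

end Homology

end OpenFrobenius

end

theorem theorem6p1 {k A : Type*} [CommRing k] [Ring A] [Algebra k A]
    (𝒜 : ℤ → Submodule k A) [GradedAlgebra 𝒜] (d : A →ₗ[k] A) (ε : A →ₐ[k] k)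
    (hA : IsAugmentedCDGA 𝒜 d ε) (m : ℤ) (δ : A →ₗ[k] A ⊗[k] A)
    (hδ : IsSymmetricOpenFrobenius 𝒜 d m δ) :
    -- the Hochschild differential and the Connes operator, also on the relative chains
    (∀ x, hochschildD 𝒜 ε d (hochschildD 𝒜 ε d x) = 0) ∧
    (∀ x ∈ relChains ε, hochschildD 𝒜 ε d x ∈ relChains ε) ∧
    (∀ x, connesB 𝒜 ε (connesB 𝒜 ε x) = 0) ∧
    (∀ x, connesB 𝒜 ε (hochschildD 𝒜 ε d x) + hochschildD 𝒜 ε d (connesB 𝒜 ε x) = 0) ∧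
    (∀ x ∈ relChains ε, connesB 𝒜 ε x ∈ relChains ε) ∧
    -- the three formulas for the product of `a[a₁, …, aₚ]` and `b[b₁, …, b_q]`,
    -- where `u = [a₁, …, aₚ]` and `v = [b₁, …, b_q]`
    (∀ (i j l : ℤ) (a b : A) (u v : Words ε), a ∈ 𝒜 i → b ∈ 𝒜 j →
      u ∈ homogeneousPart (wordComponents 𝒜 ε) l →
      ∀ (n : ℕ) (c c' : Fin n → A) (p q : Fin n → ℤ),
        (∀ r, c r ∈ 𝒜 (p r)) → (∀ r, c' r ∈ 𝒜 (q r)) →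
        (δ (a * b) = ∑ r, c r ⊗ₜ[k] c' r →
          starMul 𝒜 ε δ (a ⊗ₜ u) (b ⊗ₜ v) =
            ∑ r, sgn k (p r + (q r + j + 1) * l) • (c r ⊗ₜ[k] (u * letter ε (c' r) * v))) ∧
        (δ a = ∑ r, c r ⊗ₜ[k] c' r →
          starMul 𝒜 ε δ (a ⊗ₜ u) (b ⊗ₜ v) =
            ∑ r, sgn k (p r + (q r + 1) * l) • (c r ⊗ₜ[k] (u * letter ε (c' r * b) * v))) ∧
        (δ b = ∑ r, c r ⊗ₜ[k] c' r →
          starMul 𝒜 ε δ (a ⊗ₜ u) (b ⊗ₜ v) =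
            ∑ r, sgn k ((m + 1) * i + p r + (q r + j + 1) * l) •
              ((a * c r) ⊗ₜ[k] (u * letter ε (c' r) * v)))) ∧
    -- on the relative chains the product has degree `m - 1` and is a chain map
    (∀ (i j : ℤ), ∀ x ∈ relChains ε ⊓ homogeneousPart (chainComponents 𝒜 ε) i,
      ∀ y ∈ relChains ε ⊓ homogeneousPart (chainComponents 𝒜 ε) j,
        starMul 𝒜 ε δ x y ∈
          relChains ε ⊓ homogeneousPart (chainComponents 𝒜 ε) (i + j + (m - 1)) ∧
        hochschildD 𝒜 ε d (starMul 𝒜 ε δ x y) =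
          sgn k (m - 1) • (starMul 𝒜 ε δ (hochschildD 𝒜 ε d x) y +
            sgn k i • starMul 𝒜 ε δ x (hochschildD 𝒜 ε d y))) ∧
    -- it is strictly associative, before and after the shift of degrees
    (∀ (i : ℤ), ∀ x ∈ relChains ε ⊓ homogeneousPart (chainComponents 𝒜 ε) i,
      ∀ y ∈ relChains ε, ∀ z ∈ relChains ε,
        starMul 𝒜 ε δ (starMul 𝒜 ε δ x y) z =
          sgn k ((m - 1) * i + (m - 1)) • starMul 𝒜 ε δ x (starMul 𝒜 ε δ y z)) ∧
    (∀ x ∈ relChains ε, ∀ y ∈ relChains ε, ∀ z ∈ relChains ε,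
      shiftedMul 𝒜 ε m δ (shiftedMul 𝒜 ε m δ x y) z =
        shiftedMul 𝒜 ε m δ x (shiftedMul 𝒜 ε m δ y z)) ∧
    -- it is commutative up to the homotopy `T`
    (∀ (i j : ℤ), ∀ x ∈ relChains ε ⊓ homogeneousPart (chainComponents 𝒜 ε) i,
      ∀ y ∈ relChains ε ⊓ homogeneousPart (chainComponents 𝒜 ε) j,
        homotopyT 𝒜 ε m δ x y ∈
          relChains ε ⊓ homogeneousPart (chainComponents 𝒜 ε) (i + j + (m - 2)) ∧
        hochschildD 𝒜 ε d (homotopyT 𝒜 ε m δ x y) -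
            sgn k (m - 2) • (homotopyT 𝒜 ε m δ (hochschildD 𝒜 ε d x) y +
              sgn k i • homotopyT 𝒜 ε m δ x (hochschildD 𝒜 ε d y)) =
          starMul 𝒜 ε δ x y - sgn k (i * j + (m - 1)) • starMul 𝒜 ε δ y x) ∧
    -- the shifted product and the Connes operator satisfy the `7`-term relation up to homotopy
    (∃ K : Chains ε →ₗ[k] Chains ε →ₗ[k] Chains ε →ₗ[k] Chains ε,
      ∀ (i j l : ℤ), ∀ x ∈ shiftedRelChains 𝒜 ε m i, ∀ y ∈ shiftedRelChains 𝒜 ε m j,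
        ∀ z ∈ shiftedRelChains 𝒜 ε m l,
          K x y z ∈ shiftedRelChains 𝒜 ε m (i + j + l - 2) ∧
          sevenTermDefect (shiftedMul 𝒜 ε m δ) (connesB 𝒜 ε) i j x y z =
            hochschildD 𝒜 ε d (K x y z) -
              (K (hochschildD 𝒜 ε d x) y z + sgn k i • K x (hochschildD 𝒜 ε d y) z +
                sgn k (i + j) • K x y (hochschildD 𝒜 ε d z))) ∧
    -- the induced operations make the shifted relative Hochschild homology a BV-algebra
    (∃ (hmul : ∀ x ∈ relCycles 𝒜 ε d, ∀ y ∈ relCycles 𝒜 ε d,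
          shiftedMul 𝒜 ε m δ x y ∈ relCycles 𝒜 ε d)
        (hB : ∀ x ∈ relCycles 𝒜 ε d, connesB 𝒜 ε x ∈ relCycles 𝒜 ε d)
        (mul br : RelHH 𝒜 ε d →ₗ[k] RelHH 𝒜 ε d →ₗ[k] RelHH 𝒜 ε d)
        (Δ : RelHH 𝒜 ε d →ₗ[k] RelHH 𝒜 ε d),
      (∀ x y : relCycles 𝒜 ε d, mul (relClass 𝒜 ε d x) (relClass 𝒜 ε d y) =
        relClass 𝒜 ε d ⟨shiftedMul 𝒜 ε m δ x y, hmul x x.2 y y.2⟩) ∧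
      (∀ x : relCycles 𝒜 ε d, Δ (relClass 𝒜 ε d x) =
        relClass 𝒜 ε d ⟨connesB 𝒜 ε x, hB x x.2⟩) ∧
      IsBVAlgebra (fun n => relHHDegree 𝒜 ε d (n - (m - 1))) (-1) mul br Δ) := by
  refine ⟨hochschildD_hochschildD hA, fun x => hochschildD_mem_relChains hA, connesB_connesB hA,
    connesB_hochschildD hA, fun x _ => connesB_mem_relChains' hA x, ?_,
    fun i j x hx y hy => ⟨starMul_mem hA hδ hx hy, hochschildD_starMul hA hδ hx hy⟩,
    fun i x hx y hy z hz => starMul_assoc hA hδ hx hy hz,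
    fun x hx y hy z hz => shiftedMul_assoc_of_relChains hA hδ hx hy hz,
    fun i j x hx y hy => ⟨homotopyT_mem hA hδ hx hy, hochschildD_homotopyT hA hδ hx hy⟩,
    ⟨sevenTermHomotopy 𝒜 ε m δ, fun i j l x hx y hy z hz =>
      ⟨sevenTermHomotopy_mem hA hδ hx hy hz, sevenTermDefect_eq hA hδ hx hy hz⟩⟩,
    fun x hx y hy => shiftedMul_mem_relCycles hA hδ hx hy, fun x hx => connesB_mem_relCycles hA hx,
    relHHMul hA hδ, bvBracket (relHHMul hA hδ) (relHHOp hA) (relHHSign hA m), relHHOp hA,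
    relHHMul_relClass hA hδ, fun x => rfl, isBVAlgebra_relHH hA hδ⟩
  intro i j l a b u v ha hb hu n c c' p q hc hc'
  exact ⟨starMul_eq_sum_of_coprod_mul hδ hb hu hc hc',
    starMul_apply 𝒜 ε δ hu a b v c c' p q hc hc',
    starMul_eq_sum_of_coprod_right hδ ha hb hu hc hc'⟩
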